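/- **Setting.** Let $K$ be a field and let $\Lambda=K\mathcal Q/I$ be a special biserial weakly symmetric algebra: $\mathcal Q$ is a finite quiver (paths are composed from left to right) and $I$ is generated by a set $\rho$ of relations such that 1. every vertex is either the source of exactly two arrows and the target of exactly two arrows (valency two), or the source of exactly one arrow and the target of exactly one arrow (valency one); 2. if $\alpha\ne\beta$ are arrows starting at $i$ and $\gamma$ is an arrow ending at $i$, exactly one of $\gamma\alpha,\gamma\beta$ is in $\rho$; if $\gamma\neq\delta$ are arrows ending at $i$ and $\alpha$ is an arrow starting at $i$, exactly one of $\gamma\alpha,\delta\alpha$ is in $\rho$; 3. for each vertex $i$ of valency two there are closed paths $C_i,D_i$ at $i$ of length $\ge 2$, starting with the two different arrows at $i$, and non-zero scalars $p_i,q_i\in K$ such that $p_iC_i+q_iD_i\in\rho$; for each vertex $i$ of valency one there is a closed path $C_i$ at $i$ of length $\geq 2$ such that $C_i\alpha\in\rho$, where $\alpha$ is the arrow starting at $i$; these paths $C_i,D_i$ (the socle paths) contain no subpath of length two belonging to $\rho$; 4. every rotation of a socle path is a socle path; 5. $\rho$ consists precisely of the relations described above. Modules are right $\Lambda$-modules.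 A *band word* $W$ is a sequence $(a_t,b_t)_{t=0}^m$, with indices modulo $m+1$, of paths of positive length $a_t:e_t\to f_t$ and $b_t:e_{t+1}\to f_t$, where the $e_t,f_t$ are vertices of valency two, such that for every $t$: one of $a_t$, $b_{t-1}$ is a proper initial subpath of $C_{e_t}$ and the other one of $D_{e_t}$; the last arrows of $a_t$ and $b_t$ are different; and $W$ is not the concatenation of copies of a shorter such sequence. Let $A_t:f_t\to e_t$ and $B_t:f_t\to e_{t+1}$ be the paths for which $a_tA_t$ is a socle path at $e_t$ and $b_tB_t$ is a socle path at $e_{t+1}$. Write the socle relations at $f_t$ and at $e_t$ as $$p_t\,(A_ta_t)+q_t\,(B_tb_t)=0,\qquad p'_t\,(a_tA_t)+q'_t\,(b_{t-1}B_{t-1})=0 .$$ For $0\ne\lambda\in K$ the *band module* $M(\lambda)$ has one basis vector for each vertex along the paths $a_t,b_t$ of the cyclic word $e_0\xrightarrow{a_0}f_0\xleftarrow{b_0}e_1\xrightarrow{a_1}f_1\leftarrow\cdots f_m\xleftarrow{b_m}e_{m+1}=e_0$ (the two copies of $e_0$ at the ends of the word being identified), so that its dimension is $\sum_t(|a_t|+|b_t|)$;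 the arrows occurring in the word send the basis vector at their start to the basis vector at their end, except that the first arrow of $a_0$ acts as multiplication by $\lambda$. **Proposition.** Let $W$ be a band word, $0\ne\lambda\in K$, and put $$v:=\prod_{t=0}^m\frac{q_t}{p_t}\cdot\frac{p'_t}{q'_t}.$$ Then $v\neq 0$, the module $M(\lambda)$ has a minimal projective resolution, and $$\Omega^2(M(\lambda))\cong M(v\lambda).$$ Hence $\Omega^{2r}(M(\lambda))\cong M(v^r\lambda)$ for all $r\ge1$, and $M(\lambda)$ has complexity one: the dimensions of the terms $P_n$ of its minimal projective resolution have a common upper bound, and $P_n$ does not vanish for all large $n$. -/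

import Mathlib

universe u v w x y

/-! ### Minimal projective resolutions, syzygies, complexity -/

/-- A submodule `N` of `P` is superfluous (small) if `N + L = P` forces `L = P`. -/
def Submodule.IsSuperfluous {R : Type u} [Ring R] {P : Type v} [AddCommGroup P] [Module R P]
    (N : Submodule R P) : Prop :=
  ∀ L : Submodule R P, N ⊔ L = ⊤ → L = ⊤

/-- A minimal projective resolution `⋯ → X 2 → X 1 → X 0 → M → 0` of the `R`-module `M`: it is
exact, all the `X n` are projective, and each of the maps `X 0 → M` and `X (n + 1) → im (d n)` is
a projective cover, i.e. has a superfluous kernel. -/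
structure MinimalProjectiveResolution (R : Type u) [Ring R] (M : Type v) [AddCommGroup M]
    [Module R M] where
  /-- the terms of the resolution -/
  X : ℕ → Type w
  [addCommGroup : ∀ n, AddCommGroup (X n)]
  [module : ∀ n, Module R (X n)]
  projective : ∀ n, Module.Projective R (X n)
  /-- the augmentation -/
  aug : X 0 →ₗ[R] M
  /-- the differentials -/
  d : ∀ n, X (n + 1) →ₗ[R] X n
  aug_surjective : Function.Surjective aug
  exact_aug : Function.Exact (d 0) aug
  exact_d : ∀ n, Function.Exact (d (n + 1)) (d n)
  minimal_aug : (LinearMap.ker aug).IsSuperfluous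
  minimal_d : ∀ n, (LinearMap.ker (d n)).IsSuperfluous

namespace MinimalProjectiveResolution

attribute [instance] addCommGroup module

variable {R : Type u} [Ring R] {M : Type v} [AddCommGroup M] [Module R M]

/-- `P.syzygySucc n` is the syzygy `Ω^{n+1}(M)` computed from the minimal projective resolution
`P`: the kernel of the map out of `X n`. So `P.syzygySucc 0 = ker (X 0 → M)` is `Ω(M)`. -/
def syzygySucc (P : MinimalProjectiveResolution.{u, v, w} R M) :
    (n : ℕ) → Submodule R (P.X n)
  | 0 => LinearMap.ker P.aug
  | n + 1 => LinearMap.ker (P.d n)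

/-- The module resolved by `P` has complexity `c`, for modules over a `K`-algebra `R`: `c` is the
least natural number such that `dim_K (X n)` grows at most like `(n + 1) ^ (c - 1)`. In
particular the complexity is at most one iff the dimensions `dim_K (X n)` have a common finite
upper bound, and it is zero iff `X n = 0` for all large `n` (with the `X n` finite-dimensional). -/
def HasComplexity (K : Type x) [Field K] [Algebra K R]
    (P : MinimalProjectiveResolution.{u, v, w} R M) (c : ℕ) : Prop :=
  IsLeast {c : ℕ | ∃ κ : ℕ, ∀ n : ℕ,
    ((n + 1 : ℕ) : Cardinal) * Module.rank K (RestrictScalars K R (P.X n)) ≤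
      (κ : Cardinal) * ((n + 1 : ℕ) : Cardinal) ^ c} c

end MinimalProjectiveResolution

namespace SpecialBiserial

/-! ### Path algebras

The arrows of a quiver on `V` are the elements of `Quiver.Total V`, with `left` the source and
`right` the target. Paths are composed from left to right, and a path of positive length is
given by the list of its arrows, in this order. -/

/-- `IsPath i l j`: the list `l` of arrows is a path from `i` to `j`. -/
def IsPath {V : Type v} [Quiver.{w} V] : V → List (Quiver.Total V) → V → Prop
  | i, [], j => i = j
  | i, α :: l, j => α.left = i ∧ IsPath α.right l j

section PathAlgebra

variable (K : Type u) [Field K] (V : Type v) [Quiver.{w} V] [Fintype V]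

/-- The generators: a trivial path `e_i` for each vertex `i`, and the arrows. -/
abbrev Gen : Type (max v w) := V ⊕ Quiver.Total V

/-- The defining relations of the path algebra: the `e_i` are orthogonal idempotents with sum `1`,
and `e_i α = α = α e_j` for an arrow `α` from `i` to `j`. -/
inductive PathRel : FreeAlgebra K (Gen V) → FreeAlgebra K (Gen V) → Prop
  | idem (i : V) : PathRel (FreeAlgebra.ι K (Sum.inl i) * FreeAlgebra.ι K (Sum.inl i))
      (FreeAlgebra.ι K (Sum.inl i))
  | orth (i j : V) (h : i ≠ j) :
      PathRel (FreeAlgebra.ι K (Sum.inl i) * FreeAlgebra.ι K (Sum.inl j)) 0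
  | sum_one : PathRel (∑ i : V, FreeAlgebra.ι K (Sum.inl i)) 1
  | source (α : Quiver.Total V) :
      PathRel (FreeAlgebra.ι K (Sum.inl α.left) * FreeAlgebra.ι K (Sum.inr α))
        (FreeAlgebra.ι K (Sum.inr α))
  | target (α : Quiver.Total V) :
      PathRel (FreeAlgebra.ι K (Sum.inr α) * FreeAlgebra.ι K (Sum.inl α.right))
        (FreeAlgebra.ι K (Sum.inr α))

/-- The path algebra `K𝒬` of the quiver. -/
abbrev PathAlgebra : Type (max u v w) := RingQuot (PathRel K V)

variable {V}

/-- The idempotent `e_i` in the path algebra. -/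
noncomputable def PathAlgebra.vertex (i : V) : PathAlgebra K V :=
  RingQuot.mkAlgHom K (PathRel K V) (FreeAlgebra.ι K (Sum.inl i))

/-- An arrow, as an element of the path algebra. -/
noncomputable def PathAlgebra.arrow (α : Quiver.Total V) : PathAlgebra K V :=
  RingQuot.mkAlgHom K (PathRel K V) (FreeAlgebra.ι K (Sum.inr α))

/-- A path of positive length, as an element of the path algebra. -/
noncomputable def PathAlgebra.path (l : List (Quiver.Total V)) : PathAlgebra K V :=
  (l.map (PathAlgebra.arrow K)).prod

end PathAlgebra

/-! ### Special biserial weakly symmetric algebras -/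

/-- Source of precisely two arrows and target of precisely two arrows. -/
def ValencyTwo {V : Type v} [Quiver.{w} V] (i : V) : Prop :=
  {α : Quiver.Total V | α.left = i}.ncard = 2 ∧ {α : Quiver.Total V | α.right = i}.ncard = 2

/-- Source of precisely one arrow and target of precisely one arrow. -/
def ValencyOne {V : Type v} [Quiver.{w} V] (i : V) : Prop :=
  {α : Quiver.Total V | α.left = i}.ncard = 1 ∧ {α : Quiver.Total V | α.right = i}.ncard = 1

/-- The presentation (quiver with relations) of a special biserial weakly symmetric algebra.
The values `D i`, `p i`, `q i` only matter at vertices `i` of valency two. -/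
structure Presentation (K : Type u) [Field K] (V : Type v) [Quiver.{w} V] where
  /-- `Zero γ α`: the path `γα` of length two is one of the relations -/
  Zero : Quiver.Total V → Quiver.Total V → Prop
  /-- the closed path `C_i` -/
  C : V → List (Quiver.Total V)
  /-- the closed path `D_i` -/
  D : V → List (Quiver.Total V)
  /-- the scalar `p_i` -/
  p : V → K
  /-- the scalar `q_i` -/
  q : V → K
  valency : ∀ i : V, ValencyTwo i ∨ ValencyOne i
  /-- the monomial relations of length two are paths through a vertex of valency two -/
  zero_path : ∀ γ α, Zero γ α → γ.right = α.left ∧ ValencyTwo α.left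
  zero_right : ∀ γ α β, γ.right = α.left → γ.right = β.left → α ≠ β →
    Xor (Zero γ α) (Zero γ β)
  zero_left : ∀ γ δ α, γ.right = α.left → δ.right = α.left → γ ≠ δ →
    Xor (Zero γ α) (Zero δ α)
  C_path : ∀ i, IsPath i (C i) i
  two_le_C : ∀ i, 2 ≤ (C i).length
  D_path : ∀ i, ValencyTwo i → IsPath i (D i) i
  two_le_D : ∀ i, ValencyTwo i → 2 ≤ (D i).length
  p_ne_zero : ∀ i, ValencyTwo i → p i ≠ 0
  q_ne_zero : ∀ i, ValencyTwo i → q i ≠ 0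
  /-- `C_i` and `D_i` are different: they start with the two different arrows at `i` -/
  head_ne : ∀ i, ValencyTwo i → (C i).head? ≠ (D i).head?
  /-- every rotation of a path `C_i` or `D_i` is again one of these paths -/
  rotation : ∀ i j l₁ l₂, (l₁ ++ l₂ = C i ∨ ValencyTwo i ∧ l₁ ++ l₂ = D i) → IsPath i l₁ j →
    (l₂ ++ l₁ = C j ∨ ValencyTwo j ∧ l₂ ++ l₁ = D j)
  /-- the paths `C_i` and `D_i` are not zero: they contain no zero relation of length two -/
  C_nonzero : ∀ i, (C i).IsChain (fun γ α => ¬ Zero γ α)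
  D_nonzero : ∀ i, ValencyTwo i → (D i).IsChain (fun γ α => ¬ Zero γ α)

namespace Presentation

variable {K : Type u} [Field K] {V : Type v} [Quiver.{w} V] [Fintype V]

/-- The set `ρ` of relations, put equal to zero in the path algebra. -/
inductive Rel (S : Presentation K V) : PathAlgebra K V → PathAlgebra K V → Prop
  | zero (γ α : Quiver.Total V) (h : S.Zero γ α) : Rel S (PathAlgebra.path K [γ, α]) 0
  | two (i : V) (h : ValencyTwo i) :
      Rel S (S.p i • PathAlgebra.path K (S.C i) + S.q i • PathAlgebra.path K (S.D i)) 0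
  | one (i : V) (h : ValencyOne i) (α : Quiver.Total V) (hα : α.left = i) :
      Rel S (PathAlgebra.path K (S.C i ++ [α])) 0

/-- The algebra `Λ = K𝒬/I`, where `I` is the ideal generated by `ρ`. -/
def Alg (S : Presentation K V) : Type (max u v w) := RingQuot S.Rel

noncomputable instance (S : Presentation K V) : Ring S.Alg := inferInstanceAs (Ring (RingQuot S.Rel))

noncomputable instance (S : Presentation K V) : Algebra K S.Alg :=
  inferInstanceAs (Algebra K (RingQuot S.Rel))

open Classical in
/-- For `l` one of the paths `C_i`, `D_i`: its coefficient in the relation `p_i C_i + q_i D_i`. -/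
noncomputable def scalar (S : Presentation K V) (i : V) (l : List (Quiver.Total V)) : K :=
  if l = S.C i then S.p i else S.q i

open Classical in
/-- For `l` an initial subpath of `C_i` or `D_i`: the path `l'` such that `l l'` is `C_i` or
`D_i`. -/
noncomputable def complement (S : Presentation K V) (i : V) (l : List (Quiver.Total V)) :
    List (Quiver.Total V) :=
  if l <+: S.C i then (S.C i).drop l.length else (S.D i).drop l.length

end Presentation

/-! ### Band words -/

/-- `l` is a proper initial subpath of `l'`, of positive length. -/
def IsProperInitial {α : Type u} (l l' : List α) : Prop :=
  l ≠ [] ∧ l <+: l' ∧ l ≠ l'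

/-- A band word
`e_0 --a_0--> f_0 <--b_0-- e_1 --a_1--> f_1 <-- ⋯ f_m <--b_m-- e_{m+1} = e_0`.
The indices are taken modulo `m + 1`. -/
structure BandWord {K : Type u} [Field K] {V : Type v} [Quiver.{w} V]
    (S : Presentation K V) where
  /-- the number `m` -/
  m : ℕ
  /-- the vertices `e_t` -/
  e : Fin (m + 1) → V
  /-- the vertices `f_t` -/
  f : Fin (m + 1) → V
  /-- the path `a_t` from `e_t` to `f_t` -/
  a : Fin (m + 1) → List (Quiver.Total V)
  /-- the path `b_t` from `e_{t+1}` to `f_t` -/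
  b : Fin (m + 1) → List (Quiver.Total V)
  valency_e : ∀ t, ValencyTwo (e t)
  valency_f : ∀ t, ValencyTwo (f t)
  a_path : ∀ t, IsPath (e t) (a t) (f t)
  b_path : ∀ t, IsPath (e (t + 1)) (b t) (f t)
  /-- `a_t` and `b_{t-1}` are proper initial subpaths of the two socle paths at `e_t` -/
  initial : ∀ t,
    (IsProperInitial (a t) (S.C (e t)) ∧ IsProperInitial (b (t - 1)) (S.D (e t))) ∨
    (IsProperInitial (a t) (S.D (e t)) ∧ IsProperInitial (b (t - 1)) (S.C (e t)))
  /-- `a_t` and `b_t` arrive at `f_t` through the two different arrows ending there, so that they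
  are final subpaths of the two different socle paths at `f_t` -/
  last_ne : ∀ t, (a t).getLast? ≠ (b t).getLast?
  /-- the word is not the concatenation of copies of a shorter one -/
  minimal : ∀ s : Fin (m + 1), (∀ t, a (t + s) = a t ∧ b (t + s) = b t) → s = 0

namespace BandWord

variable {K : Type u} [Field K] {V : Type v} [Quiver.{w} V] {S : Presentation K V}

/-- The path `A_t` from `f_t` to `e_t`, with `a_t A_t` one of the two socle paths at `e_t`. -/
noncomputable def A (W : BandWord S) (t : Fin (W.m + 1)) : List (Quiver.Total V) :=
  S.complement (W.e t) (W.a t)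

/-- The path `B_t` from `f_t` to `e_{t+1}`, with `b_t B_t` one of the two socle paths at
`e_{t+1}`. -/
noncomputable def B (W : BandWord S) (t : Fin (W.m + 1)) : List (Quiver.Total V) :=
  S.complement (W.e (t + 1)) (W.b t)

/-- The scalar `p_t` in the socle relation `p_t (A_t a_t) + q_t (B_t b_t) = 0` at `f_t`. -/
noncomputable def pF (W : BandWord S) (t : Fin (W.m + 1)) : K :=
  S.scalar (W.f t) (W.A t ++ W.a t)

/-- The scalar `q_t` in the socle relation `p_t (A_t a_t) + q_t (B_t b_t) = 0` at `f_t`. -/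
noncomputable def qF (W : BandWord S) (t : Fin (W.m + 1)) : K :=
  S.scalar (W.f t) (W.B t ++ W.b t)

/-- The scalar `p'_t` in the socle relation `p'_t (a_t A_t) + q'_t (b_{t-1} B_{t-1}) = 0` at
`e_t`. -/
noncomputable def pE (W : BandWord S) (t : Fin (W.m + 1)) : K :=
  S.scalar (W.e t) (W.a t ++ W.A t)

/-- The scalar `q'_t` in the socle relation `p'_t (a_t A_t) + q'_t (b_{t-1} B_{t-1}) = 0` at
`e_t`. -/
noncomputable def qE (W : BandWord S) (t : Fin (W.m + 1)) : K :=
  S.scalar (W.e t) (W.b (t - 1) ++ W.B (t - 1))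

/-- The parameter `v = ∏ (q_t / p_t) (p'_t / q'_t)` of the band word. -/
noncomputable def parameter (W : BandWord S) : K :=
  ∏ t, (W.qF t / W.pF t) * (W.pE t / W.qE t)

/-! ### Band modules

The arrow occurrences in the word and the points of the word (the vertices along the paths, with
the two ends of the word identified, and with `e_t` and `f_t` taken only once) are both indexed by
`W.Pos`: the `k`-th arrow of `a_t` corresponds to the point where this arrow starts, and the `k`-th
arrow of `b_t` corresponds to the point where this arrow ends. So `Sum.inl ⟨t, 0⟩` is the
point `e_t`, and `Sum.inr ⟨t, k⟩` with `k` maximal is the point `f_t`. -/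

/-- Arrow occurrences in the word; also, the points of the word. -/
abbrev Pos (W : BandWord S) : Type :=
  (Σ t : Fin (W.m + 1), Fin (W.a t).length) ⊕ (Σ t : Fin (W.m + 1), Fin (W.b t).length)

/-- The arrow of the quiver at an arrow occurrence. -/
def label (W : BandWord S) : W.Pos → Quiver.Total V
  | Sum.inl ⟨t, k⟩ => (W.a t)[k]
  | Sum.inr ⟨t, k⟩ => (W.b t)[k]

/-- The vertex of the quiver at a point of the word. -/
def vertexAt (W : BandWord S) : W.Pos → V
  | Sum.inl ⟨t, k⟩ => ((W.a t)[k]).left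
  | Sum.inr ⟨t, k⟩ => ((W.b t)[k]).right

theorem a_ne_nil (W : BandWord S) (t : Fin (W.m + 1)) : W.a t ≠ [] := by
  rcases W.initial t with h | h
  · exact h.1.1
  · exact h.1.1

theorem b_ne_nil (W : BandWord S) (t : Fin (W.m + 1)) : W.b t ≠ [] := by
  have h := W.initial (t + 1)
  rw [add_sub_cancel_right] at h
  rcases h with h | h
  · exact h.2.1
  · exact h.2.1

/-- The point where an arrow occurrence starts. -/
def start (W : BandWord S) : W.Pos → W.Pos
  | Sum.inl ⟨t, k⟩ => Sum.inl ⟨t, k⟩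
  | Sum.inr ⟨t, ⟨0, _⟩⟩ => Sum.inl ⟨t + 1, ⟨0, List.length_pos_iff.2 (W.a_ne_nil (t + 1))⟩⟩
  | Sum.inr ⟨t, ⟨k + 1, h⟩⟩ => Sum.inr ⟨t, ⟨k, Nat.lt_of_succ_lt h⟩⟩

/-- The point where an arrow occurrence ends. -/
def finish (W : BandWord S) : W.Pos → W.Pos
  | Sum.inl ⟨t, k⟩ =>
      if h : k.1 + 1 < (W.a t).length then Sum.inl ⟨t, ⟨k.1 + 1, h⟩⟩
      else Sum.inr ⟨t, ⟨(W.b t).length - 1,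
        Nat.sub_lt (List.length_pos_iff.2 (W.b_ne_nil t)) Nat.one_pos⟩⟩
  | Sum.inr ⟨t, k⟩ => Sum.inr ⟨t, k⟩

/-- The scalar by which an arrow occurrence acts in `M(lam)`: it is `lam` for the first arrow of
`a_0`, and `1` otherwise. -/
def weight (W : BandWord S) (lam : K) : W.Pos → K
  | Sum.inl ⟨t, k⟩ => if t = 0 ∧ k.1 = 0 then lam else 1
  | Sum.inr _ => 1

open Classical in
/-- The action of `e_i` on `M(lam)`, on row vectors indexed by the points of the word. -/
noncomputable def vertexMatrix (W : BandWord S) (i : V) : Matrix W.Pos W.Pos K :=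
  Matrix.diagonal fun s => if W.vertexAt s = i then 1 else 0

open Classical in
/-- The action of the arrow `α` on `M(lam)`, on row vectors indexed by the points of the word:
each occurrence of `α` sends the basis vector of its starting point to its weight times the basis
vector of its end point. -/
noncomputable def arrowMatrix (W : BandWord S) (lam : K) (α : Quiver.Total V) :
    Matrix W.Pos W.Pos K :=
  ∑ s : W.Pos, if W.label s = α then Matrix.single (W.start s) (W.finish s) (W.weight lam s) else 0

/-! The next lemmas show that these matrices satisfy the relations of `Λ`. -/

theorem isPath_append {l₁ l₂ : List (Quiver.Total V)} {i j : V} :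
    IsPath i (l₁ ++ l₂) j ↔ ∃ k, IsPath i l₁ k ∧ IsPath k l₂ j := by
  induction l₁ generalizing i with
  | nil => simp [IsPath]
  | cons α l ih => simp [IsPath, ih, and_assoc]

theorem isPath_getElem_zero {l : List (Quiver.Total V)} {i j : V} (h : IsPath i l j)
    (h0 : 0 < l.length) : (l[0]).left = i := by
  cases l with
  | nil => simp at h0
  | cons α l => exact h.1

theorem isPath_getElem_succ {l : List (Quiver.Total V)} {i j : V} (h : IsPath i l j) (k : ℕ)
    (hk : k + 1 < l.length) : (l[k]).right = (l[k + 1]).left := by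
  induction l generalizing i k with
  | nil => simp at hk
  | cons α l ih =>
    cases k with
    | zero => simpa using (isPath_getElem_zero h.2 (by simpa using hk)).symm
    | succ k => simpa using ih h.2 k (by simpa using hk)

theorem isPath_getElem_last {l : List (Quiver.Total V)} {i j : V} (h : IsPath i l j)
    (k : ℕ) (hk : k + 1 = l.length) : (l[k]).right = j := by
  induction l generalizing i k with
  | nil => simp at hk
  | cons α l ih =>
    cases k with
    | zero =>
      have : l = [] := List.length_eq_zero_iff.1 (by simpa using hk.symm)
      subst this
      exact h.2
    | succ k => simpa using ih h.2 k (by simpa using hk)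

theorem vertexAt_start (W : BandWord S) (s : W.Pos) :
    W.vertexAt (W.start s) = (W.label s).left := by
  rcases s with ⟨t, k⟩ | ⟨t, ⟨_ | k, h⟩⟩
  · rfl
  · exact (isPath_getElem_zero (W.a_path (t + 1)) _).trans
      (isPath_getElem_zero (W.b_path t) _).symm
  · exact isPath_getElem_succ (W.b_path t) k h

theorem vertexAt_finish (W : BandWord S) (s : W.Pos) :
    W.vertexAt (W.finish s) = (W.label s).right := by
  rcases s with ⟨t, k⟩ | ⟨t, k⟩
  · by_cases h : k.1 + 1 < (W.a t).length
    · simp only [finish, h, dite_true]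
      exact (isPath_getElem_succ (W.a_path t) k.1 h).symm
    · simp only [finish, h, dite_false]
      have hb := List.length_pos_iff.2 (W.b_ne_nil t)
      exact (isPath_getElem_last (W.b_path t) _ (Nat.sub_add_cancel hb)).trans
        (isPath_getElem_last (W.a_path t) k.1 (by have := k.2; omega)).symm
  · rfl

/-- Consecutive arrow occurrences lie on the same path `a_t` or `b_t`. -/
theorem chain_lies_on (W : BandWord S) (s : W.Pos) (l : List W.Pos)
    (h : (s :: l).IsChain (fun x y => W.finish x = W.start y)) :
    (∃ (t : Fin (W.m + 1)) (k : Fin (W.a t).length), s = Sum.inl ⟨t, k⟩ ∧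
      (s :: l).map W.label <+: (W.a t).drop k) ∨
    (∃ (t : Fin (W.m + 1)) (k : Fin (W.b t).length), s = Sum.inr ⟨t, k⟩ ∧
      (s :: l).map W.label <+: (W.b t).drop k) := by
  induction l generalizing s with
  | nil =>
    rcases s with ⟨t, k⟩ | ⟨t, k⟩
    · refine Or.inl ⟨t, k, rfl, ?_⟩
      rw [List.drop_eq_getElem_cons k.2]
      exact (List.prefix_cons_inj _).2 ⟨_, rfl⟩
    · refine Or.inr ⟨t, k, rfl, ?_⟩
      rw [List.drop_eq_getElem_cons k.2]
      exact (List.prefix_cons_inj _).2 ⟨_, rfl⟩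
  | cons s' l ih =>
    rw [List.isChain_cons_cons] at h
    obtain ⟨hs, hl⟩ := h
    have ih' := ih s' hl
    rcases s with ⟨t, k⟩ | ⟨t, k⟩
    · left
      refine ⟨t, k, rfl, ?_⟩
      rw [List.drop_eq_getElem_cons k.2, List.map_cons]
      rcases ih' with ⟨t', k', rfl, h'⟩ | ⟨t', ⟨k', hk'⟩, rfl, h'⟩
      · by_cases hk : k.1 + 1 < (W.a t).length
        · simp only [finish, hk, dite_true, start, Sum.inl.injEq, Sigma.mk.injEq] at hs
          obtain ⟨rfl, hs⟩ := hs
          obtain rfl := eq_of_heq hs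
          exact (List.prefix_cons_inj _).2 h'
        · simp [finish, hk, start] at hs
      · exfalso
        by_cases hk : k.1 + 1 < (W.a t).length
        · cases k' with
          | zero =>
            simp only [finish, hk, dite_true, start, Sum.inl.injEq, Sigma.mk.injEq] at hs
            obtain ⟨rfl, hs⟩ := hs
            have := congrArg Fin.val (eq_of_heq hs)
            simp at this
          | succ k' => simp [finish, hk, start] at hs
        · cases k' with
          | zero => simp [finish, hk, start] at hs
          | succ k' =>
            simp only [finish, hk, dite_false, start, Sum.inr.injEq, Sigma.mk.injEq] at hs
            obtain ⟨rfl, hs⟩ := hs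
            have := congrArg Fin.val (eq_of_heq hs)
            simp only at this
            omega
    · right
      refine ⟨t, k, rfl, ?_⟩
      rw [List.drop_eq_getElem_cons k.2, List.map_cons]
      rcases ih' with ⟨t', k', rfl, h'⟩ | ⟨t', ⟨k', hk'⟩, rfl, h'⟩
      · simp [finish, start] at hs
      · cases k' with
        | zero => simp [finish, start] at hs
        | succ k' =>
          simp only [finish, start, Sum.inr.injEq, Sigma.mk.injEq] at hs
          obtain ⟨rfl, hs⟩ := hs
          obtain rfl := eq_of_heq hs
          exact (List.prefix_cons_inj _).2 h'

theorem arrowMatrix_apply_ne_zero (W : BandWord S) (lam : K) (α : Quiver.Total V) (x y : W.Pos)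
    (h : W.arrowMatrix lam α x y ≠ 0) : ∃ s, W.label s = α ∧ W.start s = x ∧ W.finish s = y := by
  classical
  rw [arrowMatrix, Matrix.sum_apply] at h
  obtain ⟨s, -, hs⟩ := Finset.exists_ne_zero_of_sum_ne_zero h
  by_cases h1 : W.label s = α
  · rw [if_pos h1, Matrix.single_apply] at hs
    by_cases h2 : W.start s = x ∧ W.finish s = y
    · exact ⟨s, h1, h2.1, h2.2⟩
    · exact absurd (if_neg h2) hs
  · rw [if_neg h1] at hs
    exact absurd rfl hs

theorem exists_chain (W : BandWord S) (lam : K) (l : List (Quiver.Total V)) (x y : W.Pos)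
    (h : (l.map (W.arrowMatrix lam)).prod x y ≠ 0) :
    ∃ L : List W.Pos, L.map W.label = l ∧ (∀ s ∈ L.head?, W.start s = x) ∧
      L.IsChain (fun x y => W.finish x = W.start y) := by
  induction l generalizing x with
  | nil => exact ⟨[], rfl, by simp, List.isChain_nil⟩
  | cons α l ih =>
    rw [List.map_cons, List.prod_cons, Matrix.mul_apply] at h
    obtain ⟨z, -, hz⟩ := Finset.exists_ne_zero_of_sum_ne_zero h
    obtain ⟨s, rfl, rfl, rfl⟩ :=
      W.arrowMatrix_apply_ne_zero lam α x z (left_ne_zero_of_mul hz)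
    obtain ⟨L, rfl, h1, h2⟩ := ih _ (right_ne_zero_of_mul hz)
    exact ⟨s :: L, rfl, by simp, List.isChain_cons.2 ⟨fun u hu => (h1 u hu).symm, h2⟩⟩

/-- A path which does not act as zero is a subpath of one of the `a_t` or `b_t`. -/
theorem infix_of_ne_zero (W : BandWord S) (lam : K) (l : List (Quiver.Total V)) (hl : l ≠ [])
    (h : (l.map (W.arrowMatrix lam)).prod ≠ 0) : ∃ t, l <:+: W.a t ∨ l <:+: W.b t := by
  obtain ⟨x, y, hxy⟩ : ∃ x y, (l.map (W.arrowMatrix lam)).prod x y ≠ 0 := by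
    by_contra! h'
    exact h (Matrix.ext h')
  obtain ⟨L, rfl, -, hL⟩ := W.exists_chain lam l x y hxy
  cases L with
  | nil => simp at hl
  | cons s L =>
    rcases W.chain_lies_on s L hL with ⟨t, k, -, h'⟩ | ⟨t, k, -, h'⟩
    · exact ⟨t, Or.inl (h'.isInfix.trans (List.drop_suffix _ _).isInfix)⟩
    · exact ⟨t, Or.inr (h'.isInfix.trans (List.drop_suffix _ _).isInfix)⟩

/-- The paths `a_t` and `b_t` are properly contained in socle paths. -/
theorem exists_socle (W : BandWord S) (l : List (Quiver.Total V))
    (h : ∃ t, l <:+: W.a t ∨ l <:+: W.b t) :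
    ∃ i E, (E = S.C i ∨ ValencyTwo i ∧ E = S.D i) ∧ l <:+: E ∧ l.length < E.length := by
  have key : ∀ u E : List (Quiver.Total V), IsProperInitial u E → l <:+: u →
      l <:+: E ∧ l.length < E.length := by
    intro u E hu hl
    refine ⟨hl.trans hu.2.1.isInfix, lt_of_le_of_lt hl.length_le ?_⟩
    refine lt_of_le_of_ne hu.2.1.length_le fun h' => hu.2.2 (hu.2.1.eq_of_length h')
  obtain ⟨t, h | h⟩ := h
  · rcases W.initial t with h' | h'
    · exact ⟨_, _, Or.inl rfl, key _ _ h'.1 h⟩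
    · exact ⟨_, _, Or.inr ⟨W.valency_e t, rfl⟩, key _ _ h'.1 h⟩
  · have hi := W.initial (t + 1)
    rw [add_sub_cancel_right] at hi
    rcases hi with h' | h'
    · exact ⟨_, _, Or.inr ⟨W.valency_e _, rfl⟩, key _ _ h'.2 h⟩
    · exact ⟨_, _, Or.inl rfl, key _ _ h'.2 h⟩

theorem socle_isPath (S : Presentation K V) (i : V) (E : List (Quiver.Total V))
    (h : E = S.C i ∨ ValencyTwo i ∧ E = S.D i) : IsPath i E i := by
  rcases h with rfl | ⟨h, rfl⟩
  · exact S.C_path i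
  · exact S.D_path i h

/-- A socle path acts as zero. -/
theorem socle_eq_zero (W : BandWord S) (lam : K) (i : V) (l : List (Quiver.Total V))
    (h : l = S.C i ∨ ValencyTwo i ∧ l = S.D i) : (l.map (W.arrowMatrix lam)).prod = 0 := by
  have hl : l ≠ [] := by
    rcases h with h | ⟨h2, h⟩
    · rintro rfl
      have := S.two_le_C i
      simp [← h] at this
    · rintro rfl
      have := S.two_le_D i h2
      simp [← h] at this
  by_contra hne
  obtain ⟨j, E, hE, ⟨x, y, rfl⟩, hlen⟩ := W.exists_socle l (W.infix_of_ne_zero lam l hl hne)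
  have hp := socle_isPath S j _ hE
  rw [List.append_assoc, isPath_append] at hp
  obtain ⟨k, hx, hp⟩ := hp
  have hr := S.rotation j k x (l ++ y) (by simpa using hE) hx
  have hki : k = i := by
    have h1 := socle_isPath S i l h
    cases l with
    | nil => exact absurd rfl hl
    | cons α l => exact hp.1.symm.trans h1.1
  subst hki
  have hlen2 : l.length < (l ++ y ++ x).length := by simp at hlen ⊢; omega
  have hhead : (l ++ y ++ x).head? = l.head? := by
    cases l with
    | nil => exact absurd rfl hl
    | cons α l => simp
  rcases h with rfl | ⟨h2, rfl⟩
  · rcases hr with hr | ⟨h2, hr⟩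
    · rw [hr] at hlen2
      exact lt_irrefl _ hlen2
    · rw [hr] at hhead
      exact S.head_ne k h2 hhead.symm
  · rcases hr with hr | ⟨_, hr⟩
    · rw [hr] at hhead
      exact S.head_ne k h2 hhead
    · rw [hr] at hlen2
      exact lt_irrefl _ hlen2

/-- The zero relations of length two act as zero. -/
theorem zero_eq_zero (W : BandWord S) (lam : K) (γ α : Quiver.Total V) (h : S.Zero γ α) :
    ([γ, α].map (W.arrowMatrix lam)).prod = 0 := by
  by_contra hne
  obtain ⟨j, E, hE, hin, -⟩ := W.exists_socle _ (W.infix_of_ne_zero lam [γ, α] (by simp) hne)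
  have hc : E.IsChain (fun γ α => ¬ S.Zero γ α) := by
    rcases hE with rfl | ⟨h2, rfl⟩
    · exact S.C_nonzero j
    · exact S.D_nonzero j h2
  obtain ⟨x, y, rfl⟩ := hin
  exact List.isChain_pair.1 hc.left_of_append.right_of_append h

variable [Fintype V]

/-- The action of the free algebra on the generators. -/
noncomputable def freeRep (W : BandWord S) (lam : K) :
    FreeAlgebra K (Gen V) →ₐ[K] Matrix W.Pos W.Pos K :=
  FreeAlgebra.lift K (Sum.elim W.vertexMatrix (W.arrowMatrix lam))

theorem freeRep_rel (W : BandWord S) (lam : K) ⦃x y : FreeAlgebra K (Gen V)⦄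
    (h : PathRel K V x y) : W.freeRep lam x = W.freeRep lam y := by
  classical
  cases h with
  | idem i =>
    simp [freeRep, vertexMatrix]
  | orth i j h =>
    simp only [freeRep, vertexMatrix, map_mul, FreeAlgebra.lift_ι_apply, Sum.elim_inl,
      Matrix.diagonal_mul_diagonal, map_zero]
    rw [← Matrix.diagonal_zero]
    congr 1
    ext s
    by_cases h1 : W.vertexAt s = i
    · simp [h1, h]
    · simp [h1]
  | sum_one =>
    simp only [freeRep, vertexMatrix, map_sum, FreeAlgebra.lift_ι_apply, Sum.elim_inl, map_one]
    ext s s'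
    rw [Matrix.sum_apply]
    by_cases h : s = s'
    · subst h
      simp
    · simp [h]
  | source α =>
    simp only [freeRep, map_mul, FreeAlgebra.lift_ι_apply, Sum.elim_inl, Sum.elim_inr]
    ext s s'
    rw [vertexMatrix, Matrix.diagonal_mul]
    by_cases h : W.arrowMatrix lam α s s' = 0
    · simp [h]
    · obtain ⟨z, rfl, rfl, rfl⟩ := W.arrowMatrix_apply_ne_zero lam α s s' h
      simp [W.vertexAt_start]
  | target α =>
    simp only [freeRep, map_mul, FreeAlgebra.lift_ι_apply, Sum.elim_inl, Sum.elim_inr]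
    ext s s'
    rw [vertexMatrix, Matrix.mul_diagonal]
    by_cases h : W.arrowMatrix lam α s s' = 0
    · simp [h]
    · obtain ⟨z, rfl, rfl, rfl⟩ := W.arrowMatrix_apply_ne_zero lam α s s' h
      simp [W.vertexAt_finish]

/-- The action of the path algebra. -/
noncomputable def pathRep (W : BandWord S) (lam : K) :
    PathAlgebra K V →ₐ[K] Matrix W.Pos W.Pos K :=
  RingQuot.liftAlgHom K ⟨W.freeRep lam, W.freeRep_rel lam⟩

theorem pathRep_path (W : BandWord S) (lam : K) (l : List (Quiver.Total V)) :
    W.pathRep lam (PathAlgebra.path K l) = (l.map (W.arrowMatrix lam)).prod := by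
  rw [PathAlgebra.path, map_list_prod, List.map_map]
  congr 1
  refine List.map_congr_left fun α _ => ?_
  simp [pathRep, PathAlgebra.arrow, freeRep]

theorem pathRep_rel (W : BandWord S) (lam : K) ⦃x y : PathAlgebra K V⦄ (h : S.Rel x y) :
    W.pathRep lam x = W.pathRep lam y := by
  cases h with
  | zero γ α h => rw [W.pathRep_path, W.zero_eq_zero lam γ α h, map_zero]
  | two i h =>
    rw [map_add, map_smul, map_smul, W.pathRep_path, W.pathRep_path,
      W.socle_eq_zero lam i _ (Or.inl rfl), W.socle_eq_zero lam i _ (Or.inr ⟨h, rfl⟩)]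
    simp
  | one i h α hα =>
    rw [W.pathRep_path, List.map_append, List.prod_append,
      W.socle_eq_zero lam i _ (Or.inl rfl), zero_mul, map_zero]

/-- The action of `Λ` on `M(lam)`, by matrices acting on row vectors from the right. -/
noncomputable def rep (W : BandWord S) (lam : K) : S.Alg →ₐ[K] Matrix W.Pos W.Pos K :=
  RingQuot.liftAlgHom K ⟨W.pathRep lam, W.pathRep_rel lam⟩

/-- The underlying vector space of the band module `M(lam)` (with `V = K`), with one coordinate
for each point of the word. -/
def BandModule (W : BandWord S) (_lam : K) : Type u := W.Pos → K

noncomputable instance (W : BandWord S) (lam : K) : AddCommGroup (W.BandModule lam) :=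
  inferInstanceAs (AddCommGroup (W.Pos → K))

/-- The band module `M(lam)` as a right `Λ`-module, i.e. a module over the opposite algebra. -/
noncomputable instance (W : BandWord S) (lam : K) : Module S.Algᵐᵒᵖ (W.BandModule lam) where
  smul x c := Matrix.vecMul (show W.Pos → K from c) (W.rep lam x.unop)
  one_smul c := by
    change Matrix.vecMul _ (W.rep lam 1) = _
    rw [map_one, Matrix.vecMul_one]
  mul_smul x y c := by
    change Matrix.vecMul _ (W.rep lam (y.unop * x.unop)) = Matrix.vecMul (Matrix.vecMul _ _) _
    rw [map_mul, Matrix.vecMul_vecMul]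
  smul_zero x := Matrix.zero_vecMul _
  smul_add x c c' := Matrix.add_vecMul _ _ _
  add_smul x y c := by
    change Matrix.vecMul _ (W.rep lam (x.unop + y.unop)) = _
    rw [map_add]
    exact Matrix.vecMul_add _ _ _
  zero_smul c := by
    change Matrix.vecMul _ (W.rep lam 0) = _
    rw [map_zero]
    exact Matrix.vecMul_zero _

end BandWord

end SpecialBiserial

/-! Let P be the sum of the e_{e_t}Λ with generators ε_t, and Q the sum of the e_{f_t}Λ with
generators φ_t. Sending ε_t to the basis vector at e_t maps P onto M(λ), and the kernel is generated
by the elements ε_t a_t - λ_t ε_{t+1} b_t, where λ_0 = λ and λ_t = 1 otherwise. So M(λ) is the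
cokernel of a map Q → P of the shape φ_t ↦ c_t ε_t a_t + c'_{t+1} ε_{t+1} b_t (`SocleCycle.dmap`).

The kernel of such a map is the image of a map P → Q of the same shape, with the complementary paths
A_t, B_t in place of a_t, b_t (`SocleCycle.swap`). In the composite the mixed products a_t B_t and
b_t A_t vanish, and the remaining terms cancel as soon as the coefficients match the socle relation
at e_t (`dmap_dmap`). One step further, the socle relation at f_t leads back to a map Q → P of the
first shape, with λ_t replaced by μ_t = λ_t p'_t q_t / (q'_{t+1} p_t) (`twist`). Hence Ω²(M(λ)) is
the cokernel of this third map. Rescaling the ε_t changes the family μ_t by a coboundary, so only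
the product of the μ_t matters, and it equals vλ (`prod_twist`, `Fin.exists_coboundary`).

Exactness (`exists_dmap_eq`, `exists_dmap_eq_of_aug_eq_zero`) is linear algebra with paths: the
middle term is spanned by the expected kernel and finitely many vectors whose images are
independent. Independence rests on `exists_coeff`: at a vertex of valency two the initial subpaths
of the socle paths satisfy no relation but the socle relation. This is seen in an explicit
representation of Λ. Minimality holds because the kernels have entries in the nilpotent arrow ideal.

The presentations splice to a minimal resolution with terms P, Q, P, Q, ...
(`nonempty_of_periodic`). Uniqueness of projective covers transfers the result to every minimal
resolution (`syzygy_of_periodic`). The two terms are finite-dimensional and non-zero, so the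
complexity is one. -/

/-! ### Projective covers -/

/-- A surjection from a projective module whose kernel is superfluous. -/
structure LinearMap.IsProjectiveCover {R : Type u} [Ring R] {P : Type v} [AddCommGroup P]
    [Module R P] {M : Type w} [AddCommGroup M] [Module R M] (f : P →ₗ[R] M) : Prop where
  projective : Module.Projective R P
  surjective : Function.Surjective f
  superfluous : (LinearMap.ker f).IsSuperfluous

namespace LinearMap.IsProjectiveCover

variable {R : Type u} [Ring R]

/-- Projective covers of the same module are isomorphic over that module. -/
theorem exists_equiv {P : Type v} [AddCommGroup P] [Module R P] {Q : Type w} [AddCommGroup Q]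
    [Module R Q] {M : Type x} [AddCommGroup M] [Module R M] {f : P →ₗ[R] M} {g : Q →ₗ[R] M}
    (hf : f.IsProjectiveCover) (hg : g.IsProjectiveCover) :
    ∃ e : P ≃ₗ[R] Q, ∀ z, g (e z) = f z := by
  have := hf.projective
  have := hg.projective
  obtain ⟨h, hh⟩ := Module.projective_lifting_property g f hg.surjective
  have hh' : ∀ z, g (h z) = f z := fun z => LinearMap.congr_fun hh z
  have hsurj : Function.Surjective h := by
    rw [← LinearMap.range_eq_top]
    apply hg.superfluous
    rw [eq_top_iff]
    intro z _
    obtain ⟨p, hp⟩ := hf.surjective (g z)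
    refine Submodule.mem_sup.2 ⟨z - h p, ?_, h p, ⟨p, rfl⟩, by abel⟩
    simp [hh', hp]
  -- A section `k` of `h` is onto as well, because `z - k (h z)` lies in the superfluous kernel of
  -- `f`. This makes `h` injective.
  obtain ⟨k, hk⟩ := Module.projective_lifting_property h LinearMap.id hsurj
  have hk' : ∀ z, h (k z) = z := fun z => LinearMap.congr_fun hk z
  have hk_surj : LinearMap.range k = ⊤ := by
    apply hf.superfluous
    rw [eq_top_iff]
    intro z _
    refine Submodule.mem_sup.2 ⟨z - k (h z), ?_, k (h z), ⟨_, rfl⟩, by abel⟩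
    rw [LinearMap.mem_ker, map_sub, ← hh', ← hh', hk', sub_self]
  have hinj : Function.Injective h := by
    intro z z' hz
    obtain ⟨q, rfl⟩ := LinearMap.range_eq_top.1 hk_surj z
    obtain ⟨q', rfl⟩ := LinearMap.range_eq_top.1 hk_surj z'
    rw [hk', hk'] at hz
    rw [hz]
  exact ⟨LinearEquiv.ofBijective h ⟨hinj, hsurj⟩, hh'⟩

/-- The corestriction of a map to the kernel of the next map, for an exact sequence. -/
theorem codRestrict_ker {Q : Type v} [AddCommGroup Q] [Module R Q] {P : Type w} [AddCommGroup P]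
    [Module R P] {M : Type x} [AddCommGroup M] [Module R M] {g : Q →ₗ[R] P} {f : P →ₗ[R] M}
    (hQ : Module.Projective R Q) (hgf : Function.Exact g f)
    (hg : (LinearMap.ker g).IsSuperfluous) :
    (g.codRestrict (LinearMap.ker f) hgf.apply_apply_eq_zero).IsProjectiveCover where
  projective := hQ
  surjective := by
    rintro ⟨z, hz⟩
    obtain ⟨q, rfl⟩ := (hgf z).1 hz
    exact ⟨q, rfl⟩
  superfluous := by
    convert hg using 1
    ext z
    exact Subtype.ext_iff

/-- The first two steps of minimal projective resolutions of isomorphic modules are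
isomorphic. -/
theorem second_step {P : Type v} [AddCommGroup P] [Module R P] {Q : Type v} [AddCommGroup Q]
    [Module R Q] {M : Type w} [AddCommGroup M] [Module R M]
    {P' : Type x} [AddCommGroup P'] [Module R P'] {Q' : Type x} [AddCommGroup Q']
    [Module R Q'] {M' : Type y} [AddCommGroup M'] [Module R M']
    {f : P →ₗ[R] M} {g : Q →ₗ[R] P} {f' : P' →ₗ[R] M'} {g' : Q' →ₗ[R] P'}
    (hf : f.IsProjectiveCover) (hQ : Module.Projective R Q) (hgf : Function.Exact g f)
    (hg : (LinearMap.ker g).IsSuperfluous)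
    (hf' : f'.IsProjectiveCover) (hQ' : Module.Projective R Q') (hgf' : Function.Exact g' f')
    (hg' : (LinearMap.ker g').IsSuperfluous) (φ : M' ≃ₗ[R] M) :
    Nonempty (P' ≃ₗ[R] P) ∧ Nonempty (Q' ≃ₗ[R] Q) ∧
      Nonempty (LinearMap.ker g' ≃ₗ[R] LinearMap.ker g) := by
  have hφf : (φ.toLinearMap ∘ₗ f').IsProjectiveCover :=
    ⟨hf'.projective, φ.surjective.comp hf'.surjective, by
      rw [LinearEquiv.ker_comp]; exact hf'.superfluous⟩
  obtain ⟨e, he⟩ := hφf.exists_equiv hf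
  -- Once `g'` is transported along `e`, both second maps become projective covers of the same
  -- module `ker f`.
  have hexact : Function.Exact (e.toLinearMap ∘ₗ g') f := by
    intro z
    constructor
    · intro hz
      obtain ⟨p, rfl⟩ := e.surjective z
      rw [he] at hz
      obtain ⟨q, rfl⟩ := (hgf' p).1 (φ.map_eq_zero_iff.1 hz)
      exact ⟨q, rfl⟩
    · rintro ⟨q, rfl⟩
      simp [he, (hgf' _).2 ⟨q, rfl⟩]
  have hsup : (LinearMap.ker (e.toLinearMap ∘ₗ g')).IsSuperfluous := by
    rwa [LinearEquiv.ker_comp]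
  obtain ⟨e', he'⟩ := (codRestrict_ker hQ' hexact hsup).exists_equiv (codRestrict_ker hQ hgf hg)
  have he'' : ∀ z, g (e' z) = e (g' z) := fun z => congrArg Subtype.val (he' z)
  refine ⟨⟨e⟩, ⟨e'⟩, ⟨e'.ofSubmodules _ _ ?_⟩⟩
  ext z
  constructor
  · rintro ⟨q, hq, rfl⟩
    have hq' : g' q = 0 := hq
    simp [he'', hq']
  · intro hz
    have hz' : g z = 0 := hz
    refine ⟨e'.symm z, ?_, by simp⟩
    have := he'' (e'.symm z)
    rw [LinearEquiv.apply_symm_apply, hz'] at this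
    exact e.map_eq_zero_iff.1 this.symm

end LinearMap.IsProjectiveCover

/-! ### Splicing periodic presentations; syzygies and complexity -/

namespace MinimalProjectiveResolution

open LinearMap

variable {R : Type u} [Ring R]

theorem isProjectiveCover_aug {M : Type v} [AddCommGroup M] [Module R M]
    (P : MinimalProjectiveResolution.{u, v, w} R M) : P.aug.IsProjectiveCover :=
  ⟨P.projective 0, P.aug_surjective, P.minimal_aug⟩

/-- The parity of a natural number, `false` for even numbers. -/
def parity : ℕ → Bool
  | 0 => false
  | 1 => true
  | n + 2 => parity n

section Periodic

variable {ι : Type x} {M : ι → Type v} [∀ i, AddCommGroup (M i)] [∀ i, Module R (M i)]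
  {P : Bool → Type w} [∀ b, AddCommGroup (P b)] [∀ b, Module R (P b)] (s : ι → ι)
  (f : ∀ i, P false →ₗ[R] M i) (g : ι → (P true →ₗ[R] P false))
  (φ : ∀ i, M (s i) ≃ₗ[R] ker (g i))

/-- The differentials obtained by splicing presentations of the modules `M i`, `M (s i)`,
`M (s (s i))`, ... -/
def splice : ∀ n, ι → (P (parity (n + 1)) →ₗ[R] P (parity n))
  | 0, i => g i
  | 1, i => (ker (g i)).subtype ∘ₗ (φ i).toLinearMap ∘ₗ f (s i)
  | n + 2, i => splice n (s i)

variable {s f g}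

theorem splice_one_apply (i : ι) (z : P false) :
    splice s f g φ 1 i z = (φ i (f (s i) z) : P true) :=
  rfl

theorem splice_one_eq_zero_iff (i : ι) (z : P false) :
    splice s f g φ 1 i z = 0 ↔ f (s i) z = 0 := by
  rw [splice_one_apply]
  exact (Submodule.coe_eq_zero).trans (φ i).map_eq_zero_iff

/-- Recursion in steps of two along the orbit of `s`. The first junction uses that `f (s i)` is
onto, so that the spliced map fills `ker (g i)`; the second uses that `φ i` is injective, so that
the spliced map has the kernel of `f (s i)`. -/
theorem exact_splice (hf : ∀ i, Function.Surjective (f i)) (hgf : ∀ i, Function.Exact (g i) (f i)) :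
    ∀ n i, Function.Exact (splice s f g φ (n + 1) i) (splice s f g φ n i)
  | 0, i => fun z => by
    constructor
    · intro hz
      obtain ⟨y, hy⟩ := hf _ ((φ i).symm ⟨z, hz⟩)
      refine ⟨y, (splice_one_apply φ i y).trans ?_⟩
      rw [hy, LinearEquiv.apply_symm_apply]
    · rintro ⟨y, rfl⟩
      exact (φ i (f (s i) y)).2
  | 1, i => fun z => (splice_one_eq_zero_iff φ i z).trans (hgf (s i) z)
  | n + 2, i => exact_splice hf hgf n (s i)

theorem superfluous_splice (hf : ∀ i, (ker (f i)).IsSuperfluous)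
    (hg : ∀ i, (ker (g i)).IsSuperfluous) :
    ∀ n i, (ker (splice s f g φ n i)).IsSuperfluous
  | 0, i => hg i
  | 1, i => by
    have h : ker (splice s f g φ 1 i : P false →ₗ[R] P true) = ker (f (s i)) :=
      Submodule.ext fun z => splice_one_eq_zero_iff φ i z
    have := hf (s i)
    rw [← h] at this
    exact this
  | n + 2, i => superfluous_splice hf hg n (s i)

/-- A family of modules whose second syzygies are again in the family, with presentations by the
same two projective modules, has minimal projective resolutions. -/
theorem nonempty_of_periodic (φ : ∀ i, M (s i) ≃ₗ[R] ker (g i)) (hP : Module.Projective R (P true))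
    (hf : ∀ i, (f i).IsProjectiveCover)
    (hgf : ∀ i, Function.Exact (g i) (f i)) (hg : ∀ i, (ker (g i)).IsSuperfluous) (i : ι) :
    Nonempty (MinimalProjectiveResolution.{u, v, w} R (M i)) :=
  ⟨{X := fun n => P (parity n)
    projective := fun n => by
      cases parity n
      · exact (hf i).projective
      · exact hP
    aug := f i
    d := fun n => splice s f g φ n i
    aug_surjective := (hf i).surjective
    exact_aug := hgf i
    exact_d := fun n => exact_splice φ (fun i => (hf i).surjective) hgf n i
    minimal_aug := (hf i).superfluous
    minimal_d := fun n => superfluous_splice φ (fun i => (hf i).superfluous) hg n i }⟩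

end Periodic

section Syzygy

variable {M₀ : Type y} [AddCommGroup M₀] [Module R M₀]
  {ι : Type x} {M : ι → Type v} [∀ i, AddCommGroup (M i)] [∀ i, Module R (M i)]
  {P : Bool → Type w} [∀ b, AddCommGroup (P b)] [∀ b, Module R (P b)] {s : ι → ι}
  {f : ∀ i, P false →ₗ[R] M i} {g : ι → (P true →ₗ[R] P false)}

/-- The terms and the even syzygies of a minimal projective resolution of a member of a family of
modules whose second syzygies are again in the family. -/
theorem syzygy_of_periodic (φ : ∀ i, M (s i) ≃ₗ[R] ker (g i))
    (hP : Module.Projective R (P true)) (hf : ∀ i, (f i).IsProjectiveCover)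
    (hgf : ∀ i, Function.Exact (g i) (f i)) (hg : ∀ i, (ker (g i)).IsSuperfluous) (i : ι)
    (X : MinimalProjectiveResolution R (M i)) (r : ℕ) :
    Nonempty (X.X (2 * r) ≃ₗ[R] P false) ∧ Nonempty (X.X (2 * r + 1) ≃ₗ[R] P true) ∧
      Nonempty (X.syzygySucc (2 * r + 1) ≃ₗ[R] M (s^[r + 1] i)) := by
  induction r with
  | zero =>
    obtain ⟨h1, h2, ⟨h3⟩⟩ := (hf i).second_step hP (hgf i) (hg i) X.isProjectiveCover_aug
      (X.projective 1) X.exact_aug (X.minimal_d 0) (LinearEquiv.refl R _)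
    exact ⟨h1, h2, ⟨h3.trans (φ i).symm⟩⟩
  | succ r ih =>
    obtain ⟨-, -, ⟨e⟩⟩ := ih
    -- The rest of the resolution starts with a projective cover of the current even syzygy, which
    -- `e` identifies with a member of the family. The comparison of the first two steps can then be
    -- repeated.
    let c : X.X (2 * r + 2) →ₗ[R] LinearMap.ker (X.d (2 * r)) :=
      (X.d (2 * r + 1)).codRestrict _ (X.exact_d (2 * r)).apply_apply_eq_zero
    have hc : c.IsProjectiveCover := LinearMap.IsProjectiveCover.codRestrict_ker
      (X.projective (2 * r + 2)) (X.exact_d (2 * r)) (X.minimal_d (2 * r + 1))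
    have hex : Function.Exact (X.d (2 * r + 2)) c := by
      intro z
      rw [← X.exact_d (2 * r + 1) z]
      exact Subtype.ext_iff
    obtain ⟨h1, h2, ⟨h3⟩⟩ := (hf (s^[r + 1] i)).second_step hP (hgf _) (hg _) hc
      (X.projective (2 * r + 3)) hex (X.minimal_d (2 * r + 2)) e
    rw [Function.iterate_succ_apply' s (r + 1)]
    exact ⟨h1, h2, ⟨LinearEquiv.trans h3 (φ _).symm⟩⟩

end Syzygy

section Complexity

variable {K : Type x} [Field K] [Algebra K R] {M : Type v} [AddCommGroup M] [Module R M]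

theorem finrank_ne_zero_of_nontrivial {N : Type y} [AddCommGroup N] (i : Module K N)
    (h : Module.Finite K N) (hN : Nontrivial N) : Module.finrank K N ≠ 0 :=
  Module.finrank_pos.ne'

/-- Only two terms occur up to isomorphism, both finite-dimensional, so the sum of their dimensions
is a bound; no term vanishes, which excludes exponent zero. -/
theorem hasComplexity_one {P : Bool → Type y} [∀ b, AddCommGroup (P b)] [∀ b, Module R (P b)]
    [∀ b, Module.Finite R (P b)] [∀ b, Nontrivial (P b)] [Module.Finite K R]
    (X : MinimalProjectiveResolution.{u, v, w} R M)
    (h : ∀ n, ∃ b, Nonempty (X.X n ≃ₗ[R] P b)) : X.HasComplexity K 1 := by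
  have key : ∀ n, ∃ b : Bool, Module.rank K (RestrictScalars K R (X.X n)) =
      ((Module.finrank K (RestrictScalars K R (P b)) : ℕ) : Cardinal) ∧
      Module.finrank K (RestrictScalars K R (P b)) ≠ 0 := by
    intro n
    obtain ⟨b, ⟨e⟩⟩ := h n
    let e' : RestrictScalars K R (X.X n) ≃ₗ[K] RestrictScalars K R (P b) :=
      { e.toAddEquiv with
        map_smul' := fun c z => e.map_smul (algebraMap K R c) z }
    let : Module R (RestrictScalars K R (P b)) := inferInstanceAs (Module R (P b))
    have : IsScalarTower K R (RestrictScalars K R (P b)) :=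
      RestrictScalars.isScalarTower K R (P b)
    have : Module.Finite R (RestrictScalars K R (P b)) := inferInstanceAs (Module.Finite R (P b))
    have hfin : Module.Finite K (RestrictScalars K R (P b)) := Module.Finite.trans R _
    have : Module.Finite K (RestrictScalars K R (X.X n)) := Module.Finite.equiv e'.symm
    have hN : Nontrivial (RestrictScalars K R (P b)) := inferInstanceAs (Nontrivial (P b))
    refine ⟨b, ?_, finrank_ne_zero_of_nontrivial (RestrictScalars.module K R (P b)) hfin hN⟩
    rw [← e'.finrank_eq, Module.finrank_eq_rank]
  constructor
  · refine ⟨Module.finrank K (RestrictScalars K R (P false)) +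
      Module.finrank K (RestrictScalars K R (P true)), fun n => ?_⟩
    obtain ⟨b, hb, -⟩ := key n
    rw [hb, pow_one]
    norm_cast
    rw [mul_comm]
    refine Nat.mul_le_mul_right _ ?_
    cases b
    · exact Nat.le_add_right _ _
    · exact Nat.le_add_left _ _
  · rintro c ⟨κ, hκ⟩
    by_contra! hc
    obtain rfl : c = 0 := by omega
    -- Testing the bound for exponent zero at `n = κ` gives `(κ + 1) * dim ≤ κ` with `dim ≥ 1`.
    obtain ⟨b, hb, hb'⟩ := key κ
    have := hκ κ
    rw [hb, pow_zero] at this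
    norm_cast at this
    have h1 := Nat.one_le_iff_ne_zero.2 hb'
    nlinarith

end Complexity

end MinimalProjectiveResolution

namespace SpecialBiserial

open MulOpposite

namespace Presentation

variable {K : Type u} [Field K] {V : Type v} [Quiver.{w} V]

/-! ### Socle paths -/

/-- `E` is one of the socle paths at `i`. -/
def IsSocle (S : Presentation K V) (i : V) (E : List (Quiver.Total V)) : Prop :=
  E = S.C i ∨ ValencyTwo i ∧ E = S.D i

/-- `l` is an initial subpath of a socle path at `i`. -/
def Good (S : Presentation K V) (i : V) (l : List (Quiver.Total V)) : Prop :=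
  ∃ E, S.IsSocle i E ∧ l <+: E

variable {S : Presentation K V} {i j : V} {E F l : List (Quiver.Total V)}

theorem IsSocle.isPath (h : S.IsSocle i E) : IsPath i E i := by
  rcases h with rfl | ⟨h, rfl⟩
  · exact S.C_path i
  · exact S.D_path i h

theorem IsSocle.isChain (h : S.IsSocle i E) : E.IsChain (fun γ α => ¬ S.Zero γ α) := by
  rcases h with rfl | ⟨h, rfl⟩
  · exact S.C_nonzero i
  · exact S.D_nonzero i h

theorem IsSocle.two_le (h : S.IsSocle i E) : 2 ≤ E.length := by
  rcases h with rfl | ⟨h, rfl⟩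
  · exact S.two_le_C i
  · exact S.two_le_D i h

theorem IsSocle.ne_nil (h : S.IsSocle i E) : E ≠ [] := by
  rintro rfl
  simpa using h.two_le

theorem IsSocle.good (h : S.IsSocle i E) : S.Good i E := ⟨E, h, List.prefix_rfl⟩

theorem IsSocle.rotate {l₁ l₂ : List (Quiver.Total V)} (h : S.IsSocle i (l₁ ++ l₂))
    (hp : IsPath i l₁ j) : S.IsSocle j (l₂ ++ l₁) :=
  S.rotation i j l₁ l₂ h hp

/-- A socle path is determined by its first arrow. -/
theorem IsSocle.eq_of_head (hE : S.IsSocle i E) (hF : S.IsSocle i F) (h : E.head? = F.head?) :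
    E = F := by
  rcases hE with rfl | ⟨h2, rfl⟩ <;> rcases hF with rfl | ⟨h2', rfl⟩
  · rfl
  · exact absurd h (S.head_ne i h2')
  · exact absurd h.symm (S.head_ne i h2)
  · rfl

theorem IsSocle.eq_of_prefix (hE : S.IsSocle i E) (hF : S.IsSocle i F) (hl : l ≠ [])
    (h : l <+: E) (h' : l <+: F) : E = F := by
  refine hE.eq_of_head hF ?_
  obtain ⟨α, l, rfl⟩ := List.exists_cons_of_ne_nil hl
  obtain ⟨r, rfl⟩ := h
  obtain ⟨r', rfl⟩ := h'
  rfl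

/-- A socle path is determined by its last arrow. -/
theorem IsSocle.eq_of_getLast (hE : S.IsSocle i E) (hF : S.IsSocle i F)
    (h : E.getLast? = F.getLast?) : E = F := by
  rcases List.eq_nil_or_concat' E with rfl | ⟨E, γ, rfl⟩
  · exact absurd rfl hE.ne_nil
  rcases List.eq_nil_or_concat' F with rfl | ⟨F, δ, rfl⟩
  · exact absurd rfl hF.ne_nil
  obtain rfl : γ = δ := by simpa using h
  -- Rotation moves the common last arrow to the front, which reduces the claim to the case of a
  -- common first arrow.
  obtain ⟨j, hj, hj'⟩ := BandWord.isPath_append.1 hE.isPath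
  obtain ⟨k, hk, hk'⟩ := BandWord.isPath_append.1 hF.isPath
  obtain rfl : j = k := hj'.1.symm.trans hk'.1
  have := (hE.rotate hj).eq_of_head (hF.rotate hk) (by simp)
  simpa using this

/-- Every arrow is the first arrow of a socle path. -/
theorem exists_isSocle (S : Presentation K V) (α : Quiver.Total V) :
    ∃ E, S.IsSocle α.left (α :: E) := by
  have hC : S.IsSocle α.left (S.C α.left) := Or.inl rfl
  obtain ⟨γ, c, hc⟩ := List.exists_cons_of_ne_nil hC.ne_nil
  have hγ : γ.left = α.left := by
    have := hC.isPath
    rw [hc] at this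
    exact this.1
  rcases S.valency α.left with h | h
  · have hD : S.IsSocle α.left (S.D α.left) := Or.inr ⟨h, rfl⟩
    obtain ⟨δ, d, hd⟩ := List.exists_cons_of_ne_nil hD.ne_nil
    have hδ : δ.left = α.left := by
      have := hD.isPath
      rw [hd] at this
      exact this.1
    have hne : γ ≠ δ := by
      have := S.head_ne _ h
      rw [hc, hd] at this
      simpa using this
    -- Exactly two arrows start here, and the two socle paths begin with different ones, so `α` is
    -- one of these.
    obtain ⟨x, y, hxy, hs⟩ := Set.ncard_eq_two.1 h.1
    have h1 : α ∈ ({x, y} : Set _) := by rw [← hs]; rfl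
    have h2 : γ ∈ ({x, y} : Set _) := by rw [← hs]; exact hγ
    have h3 : δ ∈ ({x, y} : Set _) := by rw [← hs]; exact hδ
    simp only [Set.mem_insert_iff, Set.mem_singleton_iff] at h1 h2 h3
    have : α = γ ∨ α = δ := by grind
    rcases this with h | h
    · exact ⟨c, by rw [h, ← hc, ← h]; exact hC⟩
    · exact ⟨d, by rw [h, ← hd, ← h]; exact hD⟩
  · obtain ⟨x, hs⟩ := Set.ncard_eq_one.1 h.1
    have h1 : α ∈ ({x} : Set _) := by rw [← hs]; rfl
    have h2 : γ ∈ ({x} : Set _) := by rw [← hs]; exact hγ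
    simp only [Set.mem_singleton_iff] at h1 h2
    have h : α = γ := h1.trans h2.symm
    exact ⟨c, by rw [h, ← hc, ← h]; exact hC⟩

theorem scalar_ne_zero (hi : ValencyTwo i) : S.scalar i E ≠ 0 := by
  unfold scalar
  split_ifs
  · exact S.p_ne_zero i hi
  · exact S.q_ne_zero i hi

theorem finite_good (S : Presentation K V) (i : V) : {l | S.Good i l}.Finite := by
  classical
  refine ((S.C i).inits.toFinset.finite_toSet.union
    (S.D i).inits.toFinset.finite_toSet).subset ?_
  rintro l ⟨E, rfl | ⟨-, rfl⟩, hl⟩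
  · left
    simpa using hl
  · right
    simpa using hl

variable [Fintype V]

/-! ### Paths in the algebra -/

variable (S) in
/-- The idempotent `e_i` in the algebra. -/
noncomputable def vert (i : V) : S.Alg :=
  RingQuot.mkAlgHom K S.Rel (PathAlgebra.vertex K i)

variable (S) in
/-- An arrow, as an element of the algebra. -/
noncomputable def arr (α : Quiver.Total V) : S.Alg :=
  RingQuot.mkAlgHom K S.Rel (PathAlgebra.arrow K α)

variable (S) in
/-- A path of positive length, as an element of the algebra. -/
noncomputable def pth (l : List (Quiver.Total V)) : S.Alg :=
  (l.map S.arr).prod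

variable (S) in
/-- A path starting at `i`, as an element of the algebra. -/
noncomputable def bp (i : V) (l : List (Quiver.Total V)) : S.Alg :=
  S.vert i * S.pth l

theorem mkAlgHom_path (l : List (Quiver.Total V)) :
    (RingQuot.mkAlgHom K S.Rel (PathAlgebra.path K l) : RingQuot S.Rel) = S.pth l := by
  rw [PathAlgebra.path, map_list_prod, List.map_map]
  rfl

/-- An algebra homomorphism out of the algebra, from the images of the vertices and arrows. -/
theorem exists_algHom {B : Type x} [Ring B] [Algebra K B] (S : Presentation K V) (ε : V → B)
    (τ : Quiver.Total V → B) (idem : ∀ i, ε i * ε i = ε i) (orth : ∀ i j, i ≠ j → ε i * ε j = 0)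
    (sum_one : ∑ i, ε i = 1) (source : ∀ α, ε α.left * τ α = τ α)
    (target : ∀ α, τ α * ε α.right = τ α) (zero : ∀ γ α, S.Zero γ α → τ γ * τ α = 0)
    (two : ∀ i, ValencyTwo i →
      S.p i • ((S.C i).map τ).prod + S.q i • ((S.D i).map τ).prod = 0)
    (one : ∀ i, ValencyOne i → ∀ α : Quiver.Total V, α.left = i →
      ((S.C i).map τ).prod * τ α = 0) :
    ∃ f : S.Alg →ₐ[K] B, (∀ i, f (S.vert i) = ε i) ∧ ∀ α, f (S.arr α) = τ α := by
  let f₀ : FreeAlgebra K (Gen V) →ₐ[K] B := FreeAlgebra.lift K (Sum.elim ε τ)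
  have h₀ : ∀ ⦃x y : FreeAlgebra K (Gen V)⦄, PathRel K V x y → f₀ x = f₀ y := by
    intro x y h
    cases h with
    | idem i => simpa [f₀] using idem i
    | orth i j h => simpa [f₀] using orth i j h
    | sum_one => simpa [f₀] using sum_one
    | source α => simpa [f₀] using source α
    | target α => simpa [f₀] using target α
  let f₁ : PathAlgebra K V →ₐ[K] B := RingQuot.liftAlgHom K ⟨f₀, h₀⟩
  have hv : ∀ i, f₁ (PathAlgebra.vertex K i) = ε i := by
    intro i
    simp [f₁, f₀, PathAlgebra.vertex]
  have ha : ∀ α, f₁ (PathAlgebra.arrow K α) = τ α := by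
    intro i
    simp [f₁, f₀, PathAlgebra.arrow]
  have hp : ∀ l, f₁ (PathAlgebra.path K l) = (l.map τ).prod := by
    intro l
    rw [PathAlgebra.path, map_list_prod, List.map_map]
    congr 2
    funext α
    exact ha α
  have h₁ : ∀ ⦃x y : PathAlgebra K V⦄, S.Rel x y → f₁ x = f₁ y := by
    intro x y h
    cases h with
    | zero γ α h => rw [hp, map_zero]; simpa using zero γ α h
    | two i h => rw [map_add, map_smul, map_smul, hp, hp, map_zero]; exact two i h
    | one i h α hα => rw [hp, map_zero]; simpa using one i h α hα
  refine ⟨RingQuot.liftAlgHom K ⟨f₁, h₁⟩, fun i => ?_, fun α => ?_⟩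
  · exact (RingQuot.liftAlgHom_mkAlgHom_apply K f₁ h₁ _).trans (hv i)
  · exact (RingQuot.liftAlgHom_mkAlgHom_apply K f₁ h₁ _).trans (ha α)

theorem vert_mul_vert (i : V) : S.vert i * S.vert i = S.vert i := by
  have := congrArg (RingQuot.mkAlgHom K S.Rel) (RingQuot.mkAlgHom_rel K (PathRel.idem (K := K) i))
  rw [map_mul, map_mul] at this
  exact this

theorem vert_mul_vert_of_ne (h : i ≠ j) : S.vert i * S.vert j = 0 := by
  have := congrArg (RingQuot.mkAlgHom K S.Rel)
    (RingQuot.mkAlgHom_rel K (PathRel.orth (K := K) i j h))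
  rw [map_mul, map_mul, map_zero, map_zero] at this
  exact this

variable (S) in
theorem sum_vert : ∑ i, S.vert i = 1 := by
  have := congrArg (RingQuot.mkAlgHom K S.Rel)
    (RingQuot.mkAlgHom_rel K (PathRel.sum_one (K := K) (V := V)))
  rw [map_sum, map_sum, map_one, map_one] at this
  exact this

theorem vert_mul_arr (α : Quiver.Total V) : S.vert α.left * S.arr α = S.arr α := by
  have := congrArg (RingQuot.mkAlgHom K S.Rel) (RingQuot.mkAlgHom_rel K (PathRel.source (K := K) α))
  rw [map_mul, map_mul] at this
  exact this

theorem arr_mul_vert (α : Quiver.Total V) : S.arr α * S.vert α.right = S.arr α := by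
  have := congrArg (RingQuot.mkAlgHom K S.Rel) (RingQuot.mkAlgHom_rel K (PathRel.target (K := K) α))
  rw [map_mul, map_mul] at this
  exact this

theorem arr_mul_arr_of_zero {γ α : Quiver.Total V} (h : S.Zero γ α) : S.arr γ * S.arr α = 0 := by
  have := RingQuot.mkAlgHom_rel K (Rel.zero γ α h)
  rw [mkAlgHom_path, map_zero, pth, List.map_cons, List.map_cons, List.map_nil, List.prod_cons,
    List.prod_singleton] at this
  exact this

theorem vert_mul_arr_of_ne {α : Quiver.Total V} (h : i ≠ α.left) : S.vert i * S.arr α = 0 := by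
  rw [← vert_mul_arr, ← mul_assoc, vert_mul_vert_of_ne h, zero_mul]

theorem arr_mul_vert_of_ne {α : Quiver.Total V} (h : α.right ≠ i) : S.arr α * S.vert i = 0 := by
  rw [← arr_mul_vert, mul_assoc, vert_mul_vert_of_ne h, mul_zero]

theorem arr_mul_arr_of_ne {γ α : Quiver.Total V} (h : γ.right ≠ α.left) :
    S.arr γ * S.arr α = 0 := by
  rw [← vert_mul_arr α, ← mul_assoc, arr_mul_vert_of_ne h, zero_mul]

theorem pth_append (l l' : List (Quiver.Total V)) : S.pth (l ++ l') = S.pth l * S.pth l' := by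
  simp [pth]

@[simp]
theorem pth_nil : S.pth [] = 1 := rfl

theorem pth_singleton (α : Quiver.Total V) : S.pth [α] = S.arr α := by
  simp [pth]

theorem bp_nil (i : V) : S.bp i [] = S.vert i := by
  simp [bp]

theorem bp_append (i : V) (l l' : List (Quiver.Total V)) :
    S.bp i (l ++ l') = S.bp i l * S.pth l' := by
  rw [bp, bp, pth_append, mul_assoc]

theorem vert_mul_bp (i : V) (l : List (Quiver.Total V)) : S.vert i * S.bp i l = S.bp i l := by
  rw [bp, ← mul_assoc, vert_mul_vert]

theorem bp_eq_pth (h : IsPath i l j) (hl : l ≠ []) : S.bp i l = S.pth l := by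
  obtain ⟨α, l, rfl⟩ := List.exists_cons_of_ne_nil hl
  obtain ⟨rfl, -⟩ := h
  simp [bp, pth, ← mul_assoc, vert_mul_arr]

theorem bp_mul_vert (h : IsPath i l j) : S.bp i l * S.vert j = S.bp i l := by
  rcases List.eq_nil_or_concat' l with rfl | ⟨l, α, rfl⟩
  · obtain rfl : i = j := h
    rw [bp_nil, vert_mul_vert]
  · obtain ⟨k, -, -, rfl⟩ := BandWord.isPath_append.1 h
    rw [bp_append, pth_singleton, mul_assoc, arr_mul_vert]

/-- Here `l` need not be a path: only its last arrow matters, or `i` if it is empty. This makes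
spans of the `bp i l` stable under the vertex idempotents. -/
theorem bp_mul_vert_eq_or (i : V) (l : List (Quiver.Total V)) (j : V) :
    S.bp i l * S.vert j = S.bp i l ∨ S.bp i l * S.vert j = 0 := by
  rcases List.eq_nil_or_concat' l with rfl | ⟨l, α, rfl⟩
  · rw [bp_nil]
    by_cases h : i = j
    · subst h
      exact Or.inl (vert_mul_vert i)
    · exact Or.inr (vert_mul_vert_of_ne h)
  · rw [bp_append, pth_singleton, mul_assoc]
    by_cases h : α.right = j
    · subst h
      rw [arr_mul_vert]
      exact Or.inl rfl
    · rw [arr_mul_vert_of_ne h, mul_zero]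
      exact Or.inr rfl

/-- Concatenation of a path from `i` to `j` and a path starting at `j`. -/
theorem pth_mul_bp (h : IsPath i l j) (hl : l ≠ []) (l' : List (Quiver.Total V)) :
    S.pth l * S.bp j l' = S.bp i (l ++ l') := by
  rw [bp_append, ← bp_mul_vert h, bp_eq_pth h hl, mul_assoc, bp]

/-- Makes the two socle paths interchangeable, so that later arguments need not know which of them
is `S.C i`. -/
theorem IsSocle.relation (hi : ValencyTwo i) (hE : S.IsSocle i E) (hF : S.IsSocle i F)
    (h : E ≠ F) : S.scalar i E • S.pth E + S.scalar i F • S.pth F = 0 := by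
  have h0 := RingQuot.mkAlgHom_rel K (Rel.two (S := S) i hi)
  rw [map_add, map_smul, map_smul, mkAlgHom_path, mkAlgHom_path, map_zero] at h0
  have h1 : S.p i • S.pth (S.C i) + S.q i • S.pth (S.D i) = 0 := h0
  have hCD : S.D i ≠ S.C i := fun h => S.head_ne i hi (by rw [h])
  rcases hE with rfl | ⟨-, rfl⟩ <;> rcases hF with rfl | ⟨-, rfl⟩
  · exact absurd rfl h
  · rwa [scalar, scalar, if_pos rfl, if_neg hCD]
  · rw [add_comm]
    rwa [scalar, scalar, if_pos rfl, if_neg hCD]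
  · exact absurd rfl h

/-- Socle paths span the socle: they are annihilated by the arrows. -/
theorem IsSocle.pth_mul_arr (hE : S.IsSocle i E) (β : Quiver.Total V) :
    S.pth E * S.arr β = 0 := by
  have key : ∀ {F γ δ}, S.arr γ * S.arr δ = 0 → S.pth (F ++ [γ]) * S.arr δ = 0 := by
    intro F γ δ h
    rw [pth_append, pth_singleton, mul_assoc, h, mul_zero]
  have hright : ∀ {F γ}, S.IsSocle i (F ++ [γ]) → γ.right = i := by
    intro F γ h
    obtain ⟨k, -, -, h⟩ := BandWord.isPath_append.1 h.isPath
    exact h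
  rcases List.eq_nil_or_concat' E with rfl | ⟨E, γ, rfl⟩
  · exact absurd rfl hE.ne_nil
  have hγ := hright hE
  by_cases hβ : i = β.left
  · rcases S.valency i with h | h
    · obtain ⟨F, hF, hne⟩ : ∃ F, S.IsSocle i F ∧ E ++ [γ] ≠ F := by
        by_cases hEC : E ++ [γ] = S.C i
        · exact ⟨S.D i, Or.inr ⟨h, rfl⟩, fun h' => S.head_ne i h (by rw [← hEC, h'])⟩
        · exact ⟨S.C i, Or.inl rfl, hEC⟩
      have hrel := hE.relation h hF hne
      rcases List.eq_nil_or_concat' F with rfl | ⟨F, δ, rfl⟩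
      · exact absurd rfl hF.ne_nil
      have hδ := hright hF
      have hγδ : γ ≠ δ := by
        rintro rfl
        exact hne (hE.eq_of_getLast hF (by simp))
      -- Exactly one of `γβ` and `δβ` is a zero relation. If it is `δβ`, the socle relation carries
      -- the vanishing over from the other socle path.
      have hx := S.zero_left γ δ β (hγ.trans hβ) (hδ.trans hβ) hγδ
      rcases hx with ⟨h0, -⟩ | ⟨h0, -⟩
      · exact key (arr_mul_arr_of_zero h0)
      · have h1 := congrArg (· * S.arr β) hrel
        simp only [add_mul, smul_mul_assoc, zero_mul] at h1
        rw [key (arr_mul_arr_of_zero h0), smul_zero, add_zero] at h1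
        exact (smul_eq_zero.1 h1).resolve_left (scalar_ne_zero h)
    · have hE' : E ++ [γ] = S.C i := by
        rcases hE with h' | ⟨h', -⟩
        · exact h'
        · have h1 := h'.1
          rw [h.1] at h1
          exact absurd h1 (by norm_num)
      have h0 := RingQuot.mkAlgHom_rel K (Rel.one (S := S) i h β hβ.symm)
      rw [mkAlgHom_path, map_zero] at h0
      rw [hE', ← pth_singleton, ← pth_append]
      exact h0
  · exact key (arr_mul_arr_of_ne fun h => hβ (hγ.symm.trans h))

/-- A path is zero in the algebra unless it is an initial subpath of a socle path. -/
theorem bp_eq_zero_or_good (S : Presentation K V) (i : V) (l : List (Quiver.Total V)) :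
    S.bp i l = 0 ∨ S.Good i l := by
  induction l using List.reverseRecOn with
  | nil => exact Or.inr ⟨S.C i, Or.inl rfl, List.nil_prefix⟩
  | append_singleton l β ih =>
    rw [bp_append, pth_singleton]
    rcases ih with h | ⟨E, hE, r, hr⟩
    · exact Or.inl (by rw [h, zero_mul])
    rcases List.eq_nil_or_concat' l with rfl | ⟨l, γ, rfl⟩
    · by_cases hβ : i = β.left
      · subst hβ
        obtain ⟨F, hF⟩ := S.exists_isSocle β
        exact Or.inr ⟨_, hF, F, rfl⟩
      · left
        rw [bp_nil, vert_mul_arr_of_ne hβ]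
    · cases r with
      | nil =>
        left
        rw [bp, mul_assoc]
        rw [List.append_nil] at hr
        rw [hr, hE.pth_mul_arr, mul_zero]
      | cons δ r =>
        by_cases hδ : δ = β
        · subst hδ
          exact Or.inr ⟨E, hE, r, by rw [← hr]; simp⟩
        · left
          rw [bp_append, pth_singleton, mul_assoc]
          by_cases hβ : γ.right = β.left
          · have hch := hE.isChain
            have hp := hE.isPath
            rw [← hr] at hch hp
            -- Since `γδ` lies on a socle path it is not a zero relation, so the other continuation
            -- `γβ` is one.
            have h1 : ¬ S.Zero γ δ := by
              rw [List.append_assoc] at hch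
              exact (List.isChain_cons_cons.1 hch.right_of_append).1
            obtain ⟨k, hk, hk'⟩ := BandWord.isPath_append.1 hp
            obtain ⟨k', -, -, hγ⟩ := BandWord.isPath_append.1 hk
            have h2 : γ.right = δ.left := hγ.trans hk'.1.symm
            rcases S.zero_right γ δ β h2 hβ hδ with ⟨h, -⟩ | ⟨h, -⟩
            · exact absurd h h1
            · rw [arr_mul_arr_of_zero h, mul_zero]
          · rw [arr_mul_arr_of_ne hβ, mul_zero]

/-- If `γ` does not follow the initial subpath `l` in a socle path, then `l γ = 0`. -/
theorem IsSocle.pth_mul_arr_eq_zero {r : List (Quiver.Total V)} {β γ : Quiver.Total V}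
    (hE : S.IsSocle i (l ++ β :: r)) (hl : l ≠ []) (h : γ ≠ β) : S.pth l * S.arr γ = 0 := by
  obtain ⟨k, hk, -⟩ := BandWord.isPath_append.1 hE.isPath
  rw [← bp_eq_pth hk hl, ← pth_singleton, ← bp_append]
  refine (S.bp_eq_zero_or_good i _).resolve_right ?_
  rintro ⟨F, hF, hF'⟩
  obtain rfl := hE.eq_of_prefix hF hl (List.prefix_append _ _)
    ((List.prefix_append _ _).trans hF')
  rw [List.prefix_append_right_inj] at hF'
  exact h (List.cons_prefix_cons.1 hF').1

/-! ### Generation and dimension -/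

theorem alg_induction {p : S.Alg → Prop} (x : S.Alg) (algebraMap : ∀ c : K, p (algebraMap K _ c))
    (vert : ∀ i, p (S.vert i)) (arr : ∀ α, p (S.arr α)) (add : ∀ x y, p x → p y → p (x + y))
    (mul : ∀ x y, p x → p y → p (x * y)) : p x := by
  obtain ⟨x, rfl⟩ := RingQuot.mkAlgHom_surjective K S.Rel x
  obtain ⟨x, rfl⟩ := RingQuot.mkAlgHom_surjective K (PathRel K V) x
  induction x using FreeAlgebra.induction with
  | grade0 c =>
    rw [AlgHom.commutes, AlgHom.commutes]
    exact algebraMap c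
  | grade1 x =>
    rcases x with i | α
    · exact vert i
    · exact arr α
  | mul a b ha hb =>
    rw [map_mul, map_mul]
    exact mul _ _ ha hb
  | add a b ha hb =>
    rw [map_add, map_add]
    exact add _ _ ha hb

/-- A subspace is closed under right multiplication if it is so for the generators. -/
theorem mul_mem_of_generators (N : Submodule K S.Alg) (hv : ∀ x ∈ N, ∀ i, x * S.vert i ∈ N)
    (ha : ∀ x ∈ N, ∀ α, x * S.arr α ∈ N) {x : S.Alg} (hx : x ∈ N) (y : S.Alg) : x * y ∈ N := by
  induction y using alg_induction generalizing x with
  | algebraMap c =>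
    rw [← Algebra.commutes, ← Algebra.smul_def]
    exact N.smul_mem c hx
  | vert i => exact hv x hx i
  | arr α => exact ha x hx α
  | add y z hy hz =>
    rw [mul_add]
    exact N.add_mem (hy hx) (hz hx)
  | mul y z hy hz =>
    rw [← mul_assoc]
    exact hz (hy hx)

/-- The projective module `e_i Λ` is spanned by the initial subpaths of socle paths. -/
theorem mem_span_bp (i : V) (y : S.Alg) :
    S.vert i * y ∈ Submodule.span K {z | ∃ l, S.Good i l ∧ S.bp i l = z} := by
  have h : ∀ l, S.bp i l ∈ Submodule.span K {z | ∃ l, S.Good i l ∧ S.bp i l = z} := by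
    intro l
    rcases S.bp_eq_zero_or_good i l with h | h
    · rw [h]
      exact Submodule.zero_mem _
    · exact Submodule.subset_span ⟨l, h, rfl⟩
  refine mul_mem_of_generators _ ?_ ?_ (by rw [← bp_nil]; exact h []) y
  · intro x hx j
    induction hx using Submodule.span_induction with
    | mem x hx =>
      obtain ⟨l, -, rfl⟩ := hx
      rcases bp_mul_vert_eq_or (S := S) i l j with h' | h' <;> rw [h']
      · exact h l
      · exact Submodule.zero_mem _
    | zero => rw [zero_mul]; exact Submodule.zero_mem _
    | add x y _ _ hx hy => rw [add_mul]; exact Submodule.add_mem _ hx hy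
    | smul c x _ hx => rw [smul_mul_assoc]; exact Submodule.smul_mem _ c hx
  · intro x hx α
    induction hx using Submodule.span_induction with
    | mem x hx =>
      obtain ⟨l, -, rfl⟩ := hx
      rw [← pth_singleton, ← bp_append]
      exact h _
    | zero => rw [zero_mul]; exact Submodule.zero_mem _
    | add x y _ _ hx hy => rw [add_mul]; exact Submodule.add_mem _ hx hy
    | smul c x _ hx => rw [smul_mul_assoc]; exact Submodule.smul_mem _ c hx

theorem span_bp_eq_top : Submodule.span K {z | ∃ i l, S.Good i l ∧ S.bp i l = z} = ⊤ := by
  rw [eq_top_iff]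
  intro y _
  rw [← one_mul y, ← S.sum_vert, Finset.sum_mul]
  refine Submodule.sum_mem _ fun i _ => ?_
  refine Submodule.span_mono ?_ (mem_span_bp i y)
  rintro _ ⟨l, hl, rfl⟩
  exact ⟨i, l, hl, rfl⟩

instance finite_alg (S : Presentation K V) : Module.Finite K S.Alg := by
  refine ⟨⟨(Set.Finite.toFinset (s := {z | ∃ i l, S.Good i l ∧ S.bp i l = z}) ?_), ?_⟩⟩
  · have : {z | ∃ i l, S.Good i l ∧ S.bp i l = z} = ⋃ i, S.bp i '' {l | S.Good i l} := by
      ext z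
      simp
    rw [this]
    exact Set.finite_iUnion fun i => (S.finite_good i).image _
  · rw [Set.Finite.coe_toFinset, span_bp_eq_top]

theorem finite_algOp (S : Presentation K V) : Module.Finite K S.Algᵐᵒᵖ :=
  Module.Finite.equiv (opLinearEquiv K : S.Alg ≃ₗ[K] S.Algᵐᵒᵖ)

/-! ### The arrow ideal -/

variable (S) in
/-- The subspace spanned by the paths of positive length. -/
noncomputable def arrowIdeal : Submodule K S.Alg :=
  Submodule.span K {z | ∃ l, l ≠ [] ∧ S.pth l = z}

theorem pth_mem_arrowIdeal (hl : l ≠ []) : S.pth l ∈ S.arrowIdeal :=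
  Submodule.subset_span ⟨l, hl, rfl⟩

/-- Appending an arrow keeps the length positive, and a vertex idempotent fixes or kills a path.
Right multiples suffice below because the maps multiply by paths from the left. -/
theorem pth_mul_mem_arrowIdeal (hl : l ≠ []) (y : S.Alg) : S.pth l * y ∈ S.arrowIdeal := by
  have h : ∀ z ∈ S.arrowIdeal, ∀ α, z * S.arr α ∈ S.arrowIdeal := by
    intro z hz α
    induction hz using Submodule.span_induction with
    | mem x hx =>
      obtain ⟨l, -, rfl⟩ := hx
      rw [← pth_singleton, ← pth_append]
      exact pth_mem_arrowIdeal (by simp)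
    | zero => rw [zero_mul]; exact Submodule.zero_mem _
    | add x y _ _ hx hy => rw [add_mul]; exact Submodule.add_mem _ hx hy
    | smul c x _ hx => rw [smul_mul_assoc]; exact Submodule.smul_mem _ c hx
  refine mul_mem_of_generators _ ?_ h (pth_mem_arrowIdeal hl) y
  intro z hz j
  induction hz using Submodule.span_induction with
  | mem x hx =>
    obtain ⟨l, hl, rfl⟩ := hx
    rcases List.eq_nil_or_concat' l with rfl | ⟨l, α, rfl⟩
    · exact absurd rfl hl
    by_cases hα : α.right = j
    · subst hα
      rw [pth_append, pth_singleton, mul_assoc, arr_mul_vert, ← pth_singleton, ← pth_append]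
      exact pth_mem_arrowIdeal hl
    · rw [pth_append, pth_singleton, mul_assoc, arr_mul_vert_of_ne hα, mul_zero]
      exact Submodule.zero_mem _
  | zero => rw [zero_mul]; exact Submodule.zero_mem _
  | add x y _ _ hx hy => rw [add_mul]; exact Submodule.add_mem _ hx hy
  | smul c x _ hx => rw [smul_mul_assoc]; exact Submodule.smul_mem _ c hx

theorem arrowIdeal_pow_le (n : ℕ) :
    S.arrowIdeal ^ n ≤ Submodule.span K {z | ∃ l, n ≤ l.length ∧ S.pth l = z} := by
  induction n with
  | zero =>
    rw [pow_zero, Submodule.one_le]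
    exact Submodule.subset_span ⟨[], le_rfl, rfl⟩
  | succ n ih =>
    rw [pow_succ]
    refine (mul_le_mul' ih le_rfl).trans ?_
    rw [arrowIdeal, Submodule.span_mul_span, Submodule.span_le]
    rintro _ ⟨_, ⟨l, hl, rfl⟩, _, ⟨l', hl', rfl⟩, rfl⟩
    refine Submodule.subset_span ⟨l ++ l', ?_, pth_append _ _⟩
    have := List.length_pos_iff.2 hl'
    simp
    omega

/-- A path longer than all socle paths is not an initial subpath of one, hence is zero. The chosen
exponent exceeds the lengths of all socle paths at all vertices. -/
theorem exists_arrowIdeal_pow_eq_bot (S : Presentation K V) : ∃ n, S.arrowIdeal ^ n = ⊥ := by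
  refine ⟨∑ i, ((S.C i).length + (S.D i).length) + 1, ?_⟩
  rw [eq_bot_iff]
  refine (arrowIdeal_pow_le _).trans ?_
  rw [Submodule.span_le]
  rintro _ ⟨l, hl, rfl⟩
  rw [← one_mul (S.pth l), ← S.sum_vert, Finset.sum_mul]
  refine Finset.sum_eq_zero fun i _ => (S.bp_eq_zero_or_good i l).resolve_right ?_
  rintro ⟨E, hE, hE'⟩
  have h1 := hE'.length_le
  have h2 : E.length ≤ (S.C i).length + (S.D i).length := by
    rcases hE with rfl | ⟨-, rfl⟩ <;> omega
  have h3 := Finset.single_le_sum (f := fun i => (S.C i).length + (S.D i).length)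
    (fun _ _ => Nat.zero_le _) (Finset.mem_univ i)
  omega

end Presentation

end SpecialBiserial

namespace SpecialBiserial

open MulOpposite

namespace Presentation

variable {K : Type u} [Field K] {V : Type v} [Quiver.{w} V]

/-! ### Linear independence of paths

For a vertex `i` of valency two, `e_i Λ` is realised on the free vector space on all lists of
arrows, the path `D_i` being replaced by a multiple of `C_i`. -/

/-- The end point of a path starting at `i`. -/
def endpoint (i : V) (l : List (Quiver.Total V)) : V :=
  l.getLast?.elim i fun α => α.right

theorem endpoint_append (i : V) (l : List (Quiver.Total V)) (α : Quiver.Total V) :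
    endpoint i (l ++ [α]) = α.right := by
  simp [endpoint]

theorem isPath_endpoint_eq {i j : V} {l : List (Quiver.Total V)} (h : IsPath i l j) :
    endpoint i l = j := by
  rcases List.eq_nil_or_concat' l with rfl | ⟨l, α, rfl⟩
  · exact h
  · obtain ⟨k, -, -, h⟩ := BandWord.isPath_append.1 h
    rw [endpoint_append]
    exact h

variable {S : Presentation K V} {i : V}

theorem Good.isPath {l : List (Quiver.Total V)} (h : S.Good i l) :
    IsPath i l (endpoint i l) := by
  obtain ⟨E, hE, r, rfl⟩ := h
  obtain ⟨k, hk, -⟩ := BandWord.isPath_append.1 hE.isPath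
  rwa [isPath_endpoint_eq hk]

theorem Good.of_append {l l' : List (Quiver.Total V)} (h : S.Good i (l ++ l')) : S.Good i l := by
  obtain ⟨E, hE, h⟩ := h
  exact ⟨E, hE, (List.prefix_append _ _).trans h⟩

theorem good_nil (S : Presentation K V) (i : V) : S.Good i [] :=
  ⟨S.C i, Or.inl rfl, List.nil_prefix⟩

theorem Good.isChain {l : List (Quiver.Total V)} (h : S.Good i l) :
    l.IsChain (fun γ α => ¬ S.Zero γ α) := by
  obtain ⟨E, hE, r, rfl⟩ := h
  exact hE.isChain.left_of_append

theorem IsSocle.not_good_append {E l : List (Quiver.Total V)} (hE : S.IsSocle i E)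
    (hl : l ≠ []) : ¬ S.Good i (E ++ l) := by
  rintro ⟨F, hF, h⟩
  obtain rfl := hE.eq_of_prefix hF hE.ne_nil List.prefix_rfl ((List.prefix_append _ _).trans h)
  have := h.length_le
  simp at this
  exact hl this

/-- A socle path is not a proper subpath of an initial subpath of a socle path. -/
theorem IsSocle.good_append {j : V} {E l r : List (Quiver.Total V)} (hE : S.IsSocle j E)
    (h : S.Good i (l ++ (E ++ r))) : l = [] ∧ r = [] ∧ i = j := by
  obtain ⟨F, hF, s, rfl⟩ := h
  have hF' : S.IsSocle i (l ++ (E ++ (r ++ s))) := by simpa using hF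
  obtain ⟨k, hk, hk'⟩ := BandWord.isPath_append.1 hF'.isPath
  obtain rfl : k = j := by
    obtain ⟨k', hk', -⟩ := BandWord.isPath_append.1 hk'
    have := hE.isPath
    obtain ⟨α, E, rfl⟩ := List.exists_cons_of_ne_nil hE.ne_nil
    exact hk'.1.symm.trans this.1
  -- Rotating the larger socle path puts `E` at its front. Two socle paths with the same first arrow
  -- coincide, so nothing else is left in it.
  have h1 := hF'.rotate hk
  have h2 := hE.eq_of_prefix h1 hE.ne_nil List.prefix_rfl (by simp)
  have h3 := congrArg List.length h2
  simp only [List.length_append] at h3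
  obtain rfl : l = [] := List.length_eq_zero_iff.1 (by omega)
  obtain rfl : r = [] := List.length_eq_zero_iff.1 (by omega)
  exact ⟨rfl, rfl, hk⟩

open Classical in
variable (S i) in
/-- The vector representing a path starting at `i`. -/
noncomputable def toVec (l : List (Quiver.Total V)) : List (Quiver.Total V) →₀ K :=
  if S.Good i l then
    if l = S.D i then Finsupp.single (S.C i) (-(S.p i / S.q i)) else Finsupp.single l 1
  else 0

variable (S i) in
/-- The action of an arrow. -/
noncomputable def arrowEnd (α : Quiver.Total V) :
    Module.End K (List (Quiver.Total V) →₀ K) :=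
  Finsupp.linearCombination K fun l => S.toVec i (l ++ [α])

open Classical in
variable (K i) in
/-- The action of a trivial path. -/
noncomputable def vertexEnd (j : V) : Module.End K (List (Quiver.Total V) →₀ K) :=
  Finsupp.linearCombination K fun l => if endpoint i l = j then Finsupp.single l 1 else 0

theorem arrowEnd_single (α : Quiver.Total V) (l : List (Quiver.Total V)) (c : K) :
    S.arrowEnd i α (Finsupp.single l c) = c • S.toVec i (l ++ [α]) := by
  rw [arrowEnd, Finsupp.linearCombination_single]

open Classical in
theorem vertexEnd_single (j : V) (l : List (Quiver.Total V)) (c : K) :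
    vertexEnd K i j (Finsupp.single l c) =
      if endpoint i l = j then Finsupp.single l c else 0 := by
  rw [vertexEnd, Finsupp.linearCombination_single]
  split_ifs <;> simp

theorem toVec_of_not_good {l : List (Quiver.Total V)} (h : ¬ S.Good i l) : S.toVec i l = 0 := by
  rw [toVec, if_neg h]

/-- Only `l = S.D i` needs care, being represented by a multiple of `S.C i`. Neither socle path can
be prolonged to an initial subpath of a socle path, so both sides vanish there. -/
theorem arrowEnd_toVec (hi : ValencyTwo i) (α : Quiver.Total V) (l : List (Quiver.Total V)) :
    S.arrowEnd i α (S.toVec i l) = S.toVec i (l ++ [α]) := by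
  have hC : S.IsSocle i (S.C i) := Or.inl rfl
  have hD : S.IsSocle i (S.D i) := Or.inr ⟨hi, rfl⟩
  by_cases h : S.Good i l
  · by_cases hl : l = S.D i
    · subst hl
      rw [toVec_of_not_good (hD.not_good_append (by simp)), toVec, if_pos h, if_pos rfl,
        arrowEnd_single, toVec_of_not_good (hC.not_good_append (by simp)), smul_zero]
    · rw [toVec, if_pos h, if_neg hl, arrowEnd_single, one_smul]
  · rw [toVec_of_not_good h, toVec_of_not_good fun h' => h h'.of_append, map_zero]

/-- Replacing `S.D i` by a multiple of `S.C i` is harmless because both paths end at `i`. -/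
theorem vertexEnd_toVec (hi : ValencyTwo i) (j : V) (l : List (Quiver.Total V))
    (h : endpoint i l = j) : vertexEnd K i j (S.toVec i l) = S.toVec i l := by
  have hC : S.IsSocle i (S.C i) := Or.inl rfl
  have hD : S.IsSocle i (S.D i) := Or.inr ⟨hi, rfl⟩
  unfold toVec
  split_ifs with h1 h2
  · subst h2
    rw [isPath_endpoint_eq hD.isPath] at h
    rw [vertexEnd_single, isPath_endpoint_eq hC.isPath, if_pos h]
  · rw [vertexEnd_single, if_pos h]
  · rw [map_zero]

/-- The action of a path, as an element of the opposite algebra of the endomorphism algebra. -/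
theorem unop_prod_toVec (hi : ValencyTwo i) (l l' : List (Quiver.Total V)) :
    ((l'.map fun α => op (S.arrowEnd i α)).prod).unop (S.toVec i l) = S.toVec i (l ++ l') := by
  induction l' generalizing l with
  | nil => simp
  | cons α l' ih =>
    rw [List.map_cons, List.prod_cons, unop_mul, Module.End.mul_apply, unop_op,
      arrowEnd_toVec hi, ih]
    simp

/-- The relations have to be checked on every basis vector, including lists that are not initial
subpaths of socle paths. The first arrow of `l'` already lands on a vector of the form `toVec`. -/
theorem unop_prod_single (hi : ValencyTwo i) (l l' : List (Quiver.Total V)) (hl' : l' ≠ []) :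
    ((l'.map fun α => op (S.arrowEnd i α)).prod).unop (Finsupp.single l 1) =
      S.toVec i (l ++ l') := by
  obtain ⟨α, l', rfl⟩ := List.exists_cons_of_ne_nil hl'
  rw [List.map_cons, List.prod_cons, unop_mul, Module.End.mul_apply, unop_op,
      arrowEnd_single, one_smul, unop_prod_toVec hi]
  simp

theorem op_end_ext {f g : (Module.End K (List (Quiver.Total V) →₀ K))ᵐᵒᵖ}
    (h : ∀ l, f.unop (Finsupp.single l 1) = g.unop (Finsupp.single l 1)) : f = g := by
  apply unop_injective
  ext l : 2
  exact h l

variable [Fintype V]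

/-- Coordinates of paths starting at `i`. -/
theorem exists_toVec (S : Presentation K V) (hi : ValencyTwo i) :
    ∃ f : S.Alg →ₗ[K] (List (Quiver.Total V) →₀ K), ∀ l, f (S.bp i l) = S.toVec i l := by
  have hC : ∀ j, S.IsSocle j (S.C j) := fun j => Or.inl rfl
  have hD : ∀ j, ValencyTwo j → S.IsSocle j (S.D j) := fun j hj => Or.inr ⟨hj, rfl⟩
  -- The opposite algebra appears because paths, composed from left to right, act by appending on
  -- the right.
  obtain ⟨f, hfv, hfa⟩ := exists_algHom S (fun j => op (vertexEnd K i j))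
    (fun α => op (S.arrowEnd i α))
    (idem := fun j => by
      refine op_end_ext fun l => ?_
      rw [unop_mul, Module.End.mul_apply, unop_op, vertexEnd_single]
      split_ifs with h
      · rw [vertexEnd_single, if_pos h]
      · rw [map_zero])
    (orth := fun j k hjk => by
      refine op_end_ext fun l => ?_
      rw [unop_mul, Module.End.mul_apply, unop_op, unop_op, vertexEnd_single]
      split_ifs with h
      · rw [vertexEnd_single, if_neg (by rw [h]; exact hjk)]
        rfl
      · rw [map_zero]
        rfl)
    (sum_one := by
      classical
      refine op_end_ext fun l => ?_
      rw [Finset.unop_sum, LinearMap.sum_apply]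
      simp_rw [unop_op, vertexEnd_single]
      simp)
    (source := fun α => by
      refine op_end_ext fun l => ?_
      rw [unop_mul, Module.End.mul_apply, unop_op, unop_op, vertexEnd_single]
      split_ifs with h
      · rfl
      · rw [map_zero, arrowEnd_single, toVec_of_not_good, smul_zero]
        intro h'
        apply h
        obtain ⟨k, hk, hk', -⟩ := BandWord.isPath_append.1 h'.isPath
        rw [isPath_endpoint_eq hk]
        exact hk'.symm)
    (target := fun α => by
      refine op_end_ext fun l => ?_
      rw [unop_mul, Module.End.mul_apply, unop_op, unop_op, arrowEnd_single, one_smul,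
        vertexEnd_toVec hi _ _ (endpoint_append i l α)])
    (zero := fun γ α h => by
      refine op_end_ext fun l => ?_
      rw [unop_mul, Module.End.mul_apply, unop_op, unop_op, arrowEnd_single, one_smul,
        arrowEnd_toVec hi, toVec_of_not_good]
      · rfl
      · intro h'
        have := h'.isChain
        rw [List.append_assoc] at this
        exact List.isChain_pair.1 this.right_of_append h)
    (two := fun j hj => by
      refine op_end_ext fun l => ?_
      rw [unop_add, unop_smul, unop_smul, LinearMap.add_apply, LinearMap.smul_apply,
        LinearMap.smul_apply, unop_prod_single hi _ _ (hC j).ne_nil,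
        unop_prod_single hi _ _ (hD j hj).ne_nil]
      -- A whole socle path can follow `l` inside a socle path only if `l` is empty and the base
      -- points agree. In every other case both terms act as zero.
      by_cases hl : l = [] ∧ i = j
      · obtain ⟨rfl, rfl⟩ := hl
        have hne : S.C i ≠ S.D i := fun h => S.head_ne i hi (by rw [h])
        rw [List.nil_append, List.nil_append, toVec, toVec, if_pos (hC i).good,
          if_pos (hD i hj).good, if_neg hne, if_pos rfl, Finsupp.smul_single, Finsupp.smul_single,
          ← Finsupp.single_add]
        have := S.q_ne_zero i hi
        -- The multiple of `S.C i` standing for `S.D i` is dictated by this relation.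
        have : S.p i • (1 : K) + S.q i • (-(S.p i / S.q i)) = 0 := by
          simp only [smul_eq_mul]
          field_simp
          ring
        rw [this, Finsupp.single_zero]
        rfl
      · rw [toVec_of_not_good, toVec_of_not_good, smul_zero, smul_zero, add_zero]
        · rfl
        · intro h
          rw [← List.append_nil (S.D j)] at h
          exact hl ⟨((hD j hj).good_append h).1, ((hD j hj).good_append h).2.2⟩
        · intro h
          rw [← List.append_nil (S.C j)] at h
          exact hl ⟨((hC j).good_append h).1, ((hC j).good_append h).2.2⟩)
    (one := fun j hj α hα => by
      refine op_end_ext fun l => ?_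
      rw [unop_mul, Module.End.mul_apply, unop_prod_single hi _ _ (hC j).ne_nil, unop_op,
        arrowEnd_toVec hi, toVec_of_not_good]
      · rfl
      · intro h
        rw [List.append_assoc] at h
        simpa using ((hC j).good_append h).2.1)
  -- Coordinates are read off by acting on the vector of the empty path.
  refine ⟨{ toFun := fun z => (f z).unop (S.toVec i []), map_add' := ?_, map_smul' := ?_ }, ?_⟩
  · intro z z'
    rw [map_add]
    rfl
  · intro c z
    rw [map_smul]
    rfl
  · intro l
    change (f (S.vert i * S.pth l)).unop _ = _
    have hl : f (S.pth l) = (l.map fun α => op (S.arrowEnd i α)).prod := by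
      rw [pth, map_list_prod, List.map_map]
      congr 2
      funext α
      exact hfa α
    rw [map_mul, hfv, hl, unop_mul, Module.End.mul_apply, unop_op, vertexEnd_toVec hi i [] rfl,
      unop_prod_toVec hi, List.nil_append]

/-- The initial subpaths of the socle paths at a vertex of valency two are linearly independent,
except for the relation between the two socle paths. -/
theorem exists_coeff (S : Presentation K V) (hi : ValencyTwo i) {l : List (Quiver.Total V)}
    (hl : S.Good i l) : ∃ χ : S.Alg →ₗ[K] K, χ (S.bp i l) = 1 ∧
      ∀ l', S.Good i l' → l' ≠ l → ¬ (S.IsSocle i l ∧ S.IsSocle i l') → χ (S.bp i l') = 0 := by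
  obtain ⟨f, hf⟩ := S.exists_toVec hi
  have hC : S.IsSocle i (S.C i) := Or.inl rfl
  have hD : S.IsSocle i (S.D i) := Or.inr ⟨hi, rfl⟩
  have hne : S.C i ≠ S.D i := fun h => S.head_ne i hi (by rw [h])
  -- The path `S.D i` has no coordinate of its own: its form is the rescaled coordinate at `S.C i`.
  -- For any other `l` the coordinate at `l` serves.
  by_cases hlD : l = S.D i
  · have hpq : -(S.p i / S.q i) ≠ 0 :=
      neg_ne_zero.2 (div_ne_zero (S.p_ne_zero i hi) (S.q_ne_zero i hi))
    refine ⟨(-(S.p i / S.q i))⁻¹ • Finsupp.lapply (S.C i) ∘ₗ f, ?_, fun l' hl' hne' hs => ?_⟩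
    · rw [LinearMap.smul_apply, LinearMap.comp_apply, hf, toVec, if_pos hl, if_pos hlD]
      simpa using inv_mul_cancel₀ hpq
    · have h1 : l' ≠ S.D i := hlD ▸ hne'
      have h2 : l' ≠ S.C i := by
        rintro rfl
        exact hs ⟨hlD ▸ hD, hC⟩
      rw [LinearMap.smul_apply, LinearMap.comp_apply, hf, toVec, if_pos hl', if_neg h1]
      simp [h2.symm]
  · refine ⟨Finsupp.lapply l ∘ₗ f, ?_, fun l' hl' hne' hs => ?_⟩
    · rw [LinearMap.comp_apply, hf, toVec, if_pos hl, if_neg hlD]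
      simp
    · rw [LinearMap.comp_apply, hf, toVec, if_pos hl']
      split_ifs with h
      · have : S.C i ≠ l := by
          rintro rfl
          exact hs ⟨hC, h ▸ hD⟩
        simp [this.symm]
      · simp [hne'.symm]

end Presentation

end SpecialBiserial

/-- The kernel of `f` is contained in a subspace `R` of it if the whole space is spanned modulo `R`
by vectors whose images are linearly independent, as witnessed by linear forms. -/
theorem LinearMap.mem_of_mem_ker_of_dual {K : Type u} [Field K] {E : Type v} [AddCommGroup E]
    [Module K E] {F : Type w} [AddCommGroup F] [Module K F] {J : Type x} (f : E →ₗ[K] F)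
    (R : Submodule K E) (hR : R ≤ LinearMap.ker f) (s : J → E) (χ : J → F →ₗ[K] K)
    (h1 : ∀ j, χ j (f (s j)) ≠ 0) (h2 : ∀ j j', j ≠ j' → χ j (f (s j')) = 0) {z : E}
    (hz : z ∈ R ⊔ Submodule.span K (Set.range s)) (hfz : f z = 0) : z ∈ R := by
  obtain ⟨r, hr, t, ht, rfl⟩ := Submodule.mem_sup.1 hz
  obtain ⟨c, rfl⟩ := Finsupp.mem_span_range_iff_exists_finsupp.1 ht
  rw [map_add, LinearMap.mem_ker.1 (hR hr), zero_add, Finsupp.sum, map_sum] at hfz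
  have hc : ∀ j, c j = 0 := by
    intro j
    have h := congrArg (χ j) hfz
    rw [map_sum, map_zero, Finset.sum_eq_single j] at h
    · rw [map_smul, map_smul, smul_eq_mul] at h
      exact (mul_eq_zero.1 h).resolve_right (h1 j)
    · intro j' _ hj'
      rw [map_smul, map_smul, h2 j j' hj'.symm, smul_zero]
    · intro hj
      rw [Finsupp.notMem_support_iff.1 hj, zero_smul, map_zero, map_zero]
  obtain rfl : c = 0 := Finsupp.ext hc
  simpa using hr

namespace SpecialBiserial

open MulOpposite

namespace Presentation

variable {K : Type u} [Field K] {V : Type v} [Quiver.{w} V] [Fintype V] {S : Presentation K V}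
  {ι : Type x}

/-! ### Projective modules -/

variable (S) in
/-- The projective module `⨁ e_{x_t} Λ`. -/
def projSub (x : ι → V) : Submodule S.Algᵐᵒᵖ (ι → S.Alg) where
  carrier := {u | ∀ t, S.vert (x t) * u t = u t}
  add_mem' := fun {u u'} hu hu' t => by rw [Pi.add_apply, mul_add, hu t, hu' t]
  zero_mem' := fun t => mul_zero _
  smul_mem' := fun r u hu t => by
    rw [Pi.smul_apply, smul_eq_mul_unop, ← mul_assoc, hu t]

variable (S) in
/-- The projection onto `⨁ e_{x_t} Λ`. -/
noncomputable def projMap (x : ι → V) : (ι → S.Alg) →ₗ[S.Algᵐᵒᵖ] S.projSub x where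
  toFun u := ⟨fun t => S.vert (x t) * u t, fun t => by rw [← mul_assoc, vert_mul_vert]⟩
  map_add' u u' := Subtype.ext <| funext fun t => mul_add _ _ _
  map_smul' r u := Subtype.ext <| funext fun t => (mul_assoc _ _ _).symm

theorem projMap_apply (x : ι → V) (u : ι → S.Alg) (t : ι) :
    (S.projMap x u : ι → S.Alg) t = S.vert (x t) * u t :=
  rfl

theorem projMap_coe (x : ι → V) (u : S.projSub x) : S.projMap x u = u :=
  Subtype.ext <| funext fun t => u.2 t

theorem projective_alg : Module.Projective S.Algᵐᵒᵖ S.Alg :=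
  Module.Projective.of_equiv
    ({ opAddEquiv.symm with
        map_smul' := fun r z => unop_mul r z } : S.Algᵐᵒᵖ ≃ₗ[S.Algᵐᵒᵖ] S.Alg)

/-- A direct summand of a free module, split off by left multiplication with the idempotents. -/
theorem projective_projSub [Finite ι] (x : ι → V) :
    Module.Projective S.Algᵐᵒᵖ (S.projSub x) := by
  have := projective_alg (S := S)
  have : Module.Projective S.Algᵐᵒᵖ (ι → S.Alg) := by
    classical
    have := Fintype.ofFinite ι
    exact Module.Projective.of_equiv (DirectSum.linearEquivFunOnFintype S.Algᵐᵒᵖ ι fun _ => S.Alg)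
  exact Module.Projective.of_split (S.projSub x).subtype (S.projMap x)
    (LinearMap.ext fun u => projMap_coe x u)

instance finite_projSub [Finite ι] (x : ι → V) : Module.Finite S.Algᵐᵒᵖ (S.projSub x) := by
  have : Module.Finite S.Algᵐᵒᵖ S.Alg :=
    Module.Finite.equiv ({ opAddEquiv.symm with
        map_smul' := fun r z => unop_mul r z } : S.Algᵐᵒᵖ ≃ₗ[S.Algᵐᵒᵖ] S.Alg)
  exact Module.Finite.of_surjective (S.projMap x) fun u => ⟨u, projMap_coe x u⟩

theorem vert_ne_zero {i : V} (hi : ValencyTwo i) : S.vert i ≠ 0 := by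
  obtain ⟨χ, hχ, -⟩ := S.exists_coeff hi (S.good_nil i)
  intro h
  rw [bp_nil, h, map_zero] at hχ
  exact zero_ne_one hχ

theorem nontrivial_projSub [Nonempty ι] {x : ι → V} (hx : ∀ t, ValencyTwo (x t)) :
    Nontrivial (S.projSub x) := by
  refine ⟨S.projMap x 1, 0, fun h => ?_⟩
  have := congrFun (congrArg Subtype.val h) (Classical.arbitrary ι)
  rw [projMap_apply, Pi.one_apply, mul_one] at this
  exact vert_ne_zero (hx _) this

variable [DecidableEq ι]

theorem single_vert_mem (x : ι → V) (t : ι) : Pi.single t (S.vert (x t)) ∈ S.projSub x := by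
  intro s
  by_cases h : s = t
  · subst h
    rw [Pi.single_eq_same, vert_mul_vert]
  · rw [Pi.single_eq_of_ne h, mul_zero]

variable [Fintype ι]

theorem sum_single_smul {x : ι → V} {u : ι → S.Alg} (hu : u ∈ S.projSub x) :
    ∑ t, op (u t) • (Pi.single t (S.vert (x t)) : ι → S.Alg) = u := by
  funext s
  rw [Finset.sum_apply, Finset.sum_eq_single s]
  · rw [Pi.smul_apply, Pi.single_eq_same, op_smul_eq_mul, hu s]
  · intro t _ ht
    rw [Pi.smul_apply, Pi.single_eq_of_ne ht.symm, smul_zero]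
  · simp

theorem mem_span_single_bp {x : ι → V} {u : ι → S.Alg} (hu : u ∈ S.projSub x) :
    u ∈ Submodule.span K {z | ∃ t l, S.Good (x t) l ∧ Pi.single t (S.bp (x t) l) = z} := by
  rw [← Finset.univ_sum_single u]
  refine Submodule.sum_mem _ fun t _ => ?_
  have h := mem_span_bp (x t) (u t)
  rw [hu t] at h
  have h' := Submodule.mem_map_of_mem (f := LinearMap.single K (fun _ : ι => S.Alg) t) h
  rw [Submodule.map_span] at h'
  refine Submodule.span_mono ?_ h'
  rintro _ ⟨_, ⟨l, hl, rfl⟩, rfl⟩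
  exact ⟨t, l, hl, rfl⟩

/-- A submodule of the radical of `⨁ e_{x_t} Λ` is superfluous. -/
theorem isSuperfluous_of_mem_arrowIdeal {x : ι → V} (N : Submodule S.Algᵐᵒᵖ (S.projSub x))
    (hN : ∀ u ∈ N, ∀ t, (u : ι → S.Alg) t ∈ S.arrowIdeal) : N.IsSuperfluous := by
  intro L hL
  obtain ⟨n, hn⟩ := S.exists_arrowIdeal_pow_eq_bot
  -- Nakayama's argument by descending powers: `k = 0` is nilpotence, and `k = n` is the first power
  -- of the arrow ideal, where the entries of `N` lie.
  replace hn : S.arrowIdeal ^ (n + 1) = ⊥ := by rw [pow_succ, hn, Submodule.bot_mul]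
  have key : ∀ k ≤ n, ∀ u : S.projSub x,
      (∀ t, (u : ι → S.Alg) t ∈ S.arrowIdeal ^ (n + 1 - k)) → u ∈ L := by
    intro k
    induction k with
    | zero =>
      intro _ u hu
      rw [Nat.sub_zero, hn] at hu
      have : u = 0 := Subtype.ext (funext fun t => (Submodule.mem_bot K).1 (hu t))
      rw [this]
      exact L.zero_mem
    | succ k ih =>
      intro hk u hu
      -- Each generator splits into a part in `N` and a part in `L`. Multiplying the `N`-parts by
      -- the entries of `u` raises the power of the arrow ideal by one, so the induction hypothesis
      -- applies to them.
      have h : ∀ t, ∃ z ∈ N, ∃ y ∈ L, z + y = ⟨_, single_vert_mem x t⟩ := fun t =>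
        Submodule.mem_sup.1 (hL ▸ Submodule.mem_top)
      choose z hz y hy hzy using h
      have hu' : u = ∑ t, op ((u : ι → S.Alg) t) • z t + ∑ t, op ((u : ι → S.Alg) t) • y t := by
        rw [← Finset.sum_add_distrib]
        simp_rw [← smul_add, hzy]
        apply Subtype.ext
        rw [AddSubmonoidClass.coe_finsetSum]
        exact (sum_single_smul u.2).symm
      rw [hu']
      refine L.add_mem (ih (by omega) _ fun s => ?_)
        (Submodule.sum_mem _ fun t _ => L.smul_mem _ (hy t))
      rw [AddSubmonoidClass.coe_finsetSum, Finset.sum_apply]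
      refine Submodule.sum_mem _ fun t _ => ?_
      have hnk : n + 1 - k = n + 1 - (k + 1) + 1 := by omega
      rw [hnk, pow_succ']
      exact Submodule.mul_mem_mul (hN _ (hz t) s) (hu t)
  have hNL : N ≤ L := fun u hu => key n le_rfl u fun t => by
    rw [Nat.add_sub_cancel_left, pow_one]
    exact hN u hu t
  rwa [sup_eq_right.2 hNL] at hL

end Presentation

/-! ### Cycles of socle paths -/

/-- A cyclic configuration of paths `a_t : x_t → y_t`, `b_t : x_{σ t} → y_t`, `A_t : y_t → x_t` and
`B_t : y_t → x_{σ t}` such that `a_t A_t`, `b_t B_t`, `A_t a_t` and `B_t b_t` are socle paths. -/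
structure SocleCycle {K : Type u} [Field K] {V : Type v} [Quiver.{w} V] (S : Presentation K V)
    (ι : Type x) where
  /-- the vertices `x_t` -/
  x : ι → V
  /-- the vertices `y_t` -/
  y : ι → V
  /-- the permutation `t ↦ t + 1` -/
  σ : Equiv.Perm ι
  /-- the paths `a_t` -/
  a : ι → List (Quiver.Total V)
  /-- the paths `b_t` -/
  b : ι → List (Quiver.Total V)
  /-- the paths `A_t` -/
  A : ι → List (Quiver.Total V)
  /-- the paths `B_t` -/
  B : ι → List (Quiver.Total V)
  valency_x : ∀ t, ValencyTwo (x t)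
  valency_y : ∀ t, ValencyTwo (y t)
  a_ne : ∀ t, a t ≠ []
  b_ne : ∀ t, b t ≠ []
  A_ne : ∀ t, A t ≠ []
  B_ne : ∀ t, B t ≠ []
  a_path : ∀ t, IsPath (x t) (a t) (y t)
  b_path : ∀ t, IsPath (x (σ t)) (b t) (y t)
  soc_aA : ∀ t, S.IsSocle (x t) (a t ++ A t)
  soc_bB : ∀ t, S.IsSocle (x (σ t)) (b t ++ B t)
  ne_x : ∀ t, a (σ t) ++ A (σ t) ≠ b t ++ B t
  ne_y : ∀ t, A t ++ a t ≠ B t ++ b t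

namespace SocleCycle

open Presentation

section

variable {K : Type u} [Field K] {V : Type v} [Quiver.{w} V] {S : Presentation K V}
  {ι : Type x} (Z : SocleCycle S ι) (t : ι)

theorem A_path : IsPath (Z.y t) (Z.A t) (Z.x t) := by
  obtain ⟨k, hk, hk'⟩ := BandWord.isPath_append.1 (Z.soc_aA t).isPath
  rw [← isPath_endpoint_eq hk, isPath_endpoint_eq (Z.a_path t)] at hk'
  exact hk'

theorem B_path : IsPath (Z.y t) (Z.B t) (Z.x (Z.σ t)) := by
  obtain ⟨k, hk, hk'⟩ := BandWord.isPath_append.1 (Z.soc_bB t).isPath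
  rw [← isPath_endpoint_eq hk, isPath_endpoint_eq (Z.b_path t)] at hk'
  exact hk'

theorem soc_Aa : S.IsSocle (Z.y t) (Z.A t ++ Z.a t) := (Z.soc_aA t).rotate (Z.a_path t)

theorem soc_Bb : S.IsSocle (Z.y t) (Z.B t ++ Z.b t) := (Z.soc_bB t).rotate (Z.b_path t)

/-- The configuration with the roles of the `x_t` and the `y_t` exchanged. -/
@[simps]
def swap : SocleCycle S ι where
  x := Z.y
  y := Z.x
  σ := Z.σ.symm
  a := Z.A
  b t := Z.B (Z.σ.symm t)
  A := Z.a
  B t := Z.b (Z.σ.symm t)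
  valency_x := Z.valency_y
  valency_y := Z.valency_x
  a_ne := Z.A_ne
  b_ne t := Z.B_ne _
  A_ne := Z.a_ne
  B_ne t := Z.b_ne _
  a_path := Z.A_path
  b_path t := by
    have := Z.B_path (Z.σ.symm t)
    rwa [Equiv.apply_symm_apply] at this
  soc_aA := Z.soc_Aa
  soc_bB t := Z.soc_Bb _
  ne_x t := Z.ne_y _
  ne_y t := by
    have := Z.ne_x (Z.σ.symm t)
    rwa [Equiv.apply_symm_apply] at this

/-- A common first arrow would make the two socle paths at `Z.x (Z.σ t)` equal. -/
theorem eq_of_prefix_a_of_prefix_b {r : List (Quiver.Total V)} (h : r <+: Z.a (Z.σ t))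
    (h' : r <+: Z.b t) : r = [] := by
  by_contra hr
  exact Z.ne_x t ((Z.soc_aA _).eq_of_prefix (Z.soc_bB t) hr (h.trans (List.prefix_append _ _))
    (h'.trans (List.prefix_append _ _)))

end

end SocleCycle

end SpecialBiserial

/-! ### Maps between the projectives of a cycle of socle paths, and their exactness -/

namespace SpecialBiserial

open MulOpposite Presentation

namespace SocleCycle

section

variable {K : Type u} [Field K] {V : Type v} [Quiver.{w} V] {S : Presentation K V} {ι : Type x}
  (Z : SocleCycle S ι)

theorem good_a (t : ι) (k : ℕ) : S.Good (Z.x t) (Z.a t ++ (Z.A t).take k) :=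
  ⟨_, Z.soc_aA t, List.prefix_append_right_inj _ |>.2 (List.take_prefix _ _)⟩

theorem good_b (t : ι) (k : ℕ) : S.Good (Z.x (Z.σ t)) (Z.b t ++ (Z.B t).take k) :=
  ⟨_, Z.soc_bB t, List.prefix_append_right_inj _ |>.2 (List.take_prefix _ _)⟩

theorem not_isSocle_b {t : ι} {k : ℕ} (hk : k < (Z.B t).length) :
    ¬ S.IsSocle (Z.x (Z.σ t)) (Z.b t ++ (Z.B t).take k) := by
  intro h
  have h1 := h.eq_of_prefix (Z.soc_bB t) (l := Z.b t) (Z.b_ne t) (List.prefix_append _ _)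
    (List.prefix_append _ _)
  have h2 := congrArg List.length h1
  simp at h2
  omega

theorem a_append_ne_b_append (t : ι) (r r' : List (Quiver.Total V)) :
    Z.a (Z.σ t) ++ r ≠ Z.b t ++ r' := by
  intro h
  obtain ⟨α, a, ha⟩ := List.exists_cons_of_ne_nil (Z.a_ne (Z.σ t))
  obtain ⟨β, b, hb⟩ := List.exists_cons_of_ne_nil (Z.b_ne t)
  rw [ha, hb] at h
  obtain ⟨rfl, -⟩ := List.cons.inj h
  have := Z.eq_of_prefix_a_of_prefix_b t (r := [α]) (by rw [ha]; exact ⟨a, rfl⟩)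
    (by rw [hb]; exact ⟨b, rfl⟩)
  simp at this

end

variable {K : Type u} [Field K] {V : Type v} [Quiver.{w} V] [Fintype V] {S : Presentation K V}
  {ι : Type x} (Z : SocleCycle S ι)

/-- After a non-empty initial subpath `l` of a socle path the next arrow is forced; any path
starting with another arrow is killed. -/
theorem pth_mul_pth_eq_zero {i : V} {l m r : List (Quiver.Total V)} (hE : S.IsSocle i (l ++ m))
    (hl : l ≠ []) (hm : m ≠ []) (hr : r ≠ []) (h : ∀ γ, [γ] <+: r → ¬ [γ] <+: m) :
    S.pth l * S.pth r = 0 := by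
  obtain ⟨β, m, rfl⟩ := List.exists_cons_of_ne_nil hm
  obtain ⟨γ, r, rfl⟩ := List.exists_cons_of_ne_nil hr
  have hne : γ ≠ β := by
    rintro rfl
    exact h γ ⟨r, rfl⟩ ⟨m, rfl⟩
  rw [← List.singleton_append, pth_append, pth_singleton, ← mul_assoc,
    hE.pth_mul_arr_eq_zero hl hne, zero_mul]

/-- The socle path through `B t` continues with `b t`, while `a (σ t)` leaves the same vertex by the
other arrow. This and the next three lemmas kill the mixed products; they are stated for initial
subpaths `r` because truncated paths occur in the spanning and independence arguments. -/
theorem B_mul_a {t : ι} {r : List (Quiver.Total V)} (hr : r ≠ []) (h : r <+: Z.a (Z.σ t)) :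
    S.pth (Z.B t) * S.pth r = 0 :=
  pth_mul_pth_eq_zero (Z.soc_Bb t) (Z.B_ne t) (Z.b_ne t) hr fun γ h1 h2 =>
    absurd (Z.eq_of_prefix_a_of_prefix_b t (h1.trans h) h2) (by simp)

theorem A_mul_b {t : ι} {r : List (Quiver.Total V)} (hr : r ≠ []) (h : r <+: Z.b t) :
    S.pth (Z.A (Z.σ t)) * S.pth r = 0 :=
  pth_mul_pth_eq_zero (Z.soc_Aa _) (Z.A_ne _) (Z.a_ne _) hr fun γ h1 h2 =>
    absurd (Z.eq_of_prefix_a_of_prefix_b t h2 (h1.trans h)) (by simp)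

theorem b_mul_A {t : ι} {r : List (Quiver.Total V)} (hr : r ≠ []) (h : r <+: Z.A t) :
    S.pth (Z.b t) * S.pth r = 0 := by
  -- The index is `σ t` because `swap` inverts the permutation.
  have := Z.swap.B_mul_a (t := Z.σ t) (r := r) hr (by simpa using h)
  simpa using this

theorem a_mul_B {t : ι} {r : List (Quiver.Total V)} (hr : r ≠ []) (h : r <+: Z.B t) :
    S.pth (Z.a t) * S.pth r = 0 := by
  have := Z.swap.A_mul_b (t := Z.σ t) (r := r) hr (by simpa using h)
  simpa using this

/-- The homomorphism `⨁ e_{y_t} Λ → ⨁ e_{x_t} Λ` which sends the generator `φ_t` to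
`c_t ε_t a_t + c'_{σ t} ε_{σ t} b_t`. -/
noncomputable def dmap (c c' : ι → K) : (ι → S.Alg) →ₗ[S.Algᵐᵒᵖ] (ι → S.Alg) where
  toFun u s := c s • (S.pth (Z.a s) * u s) +
    c' s • (S.pth (Z.b (Z.σ.symm s)) * u (Z.σ.symm s))
  map_add' u u' := by
    funext s
    simp only [Pi.add_apply, mul_add, smul_add]
    abel
  map_smul' r u := by
    funext s
    simp only [Pi.smul_apply, smul_eq_mul_unop, RingHom.id_apply, add_mul, smul_mul_assoc,
      mul_assoc]

theorem dmap_apply (c c' : ι → K) (u : ι → S.Alg) (s : ι) :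
    Z.dmap c c' u s = c s • (S.pth (Z.a s) * u s) +
      c' s • (S.pth (Z.b (Z.σ.symm s)) * u (Z.σ.symm s)) :=
  rfl

theorem dmap_mem (c c' : ι → K) (u : ι → S.Alg) : Z.dmap c c' u ∈ S.projSub Z.x := by
  intro s
  have h1 := bp_eq_pth (S := S) (Z.a_path s) (Z.a_ne s)
  have h2 := bp_eq_pth (S := S) (Z.b_path (Z.σ.symm s)) (Z.b_ne _)
  rw [Equiv.apply_symm_apply] at h2
  rw [dmap_apply, mul_add, mul_smul_comm, mul_smul_comm, ← mul_assoc, ← mul_assoc, ← bp, ← bp,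
    h1, h2]

theorem dmap_mem_arrowIdeal (c c' : ι → K) (u : ι → S.Alg) (s : ι) :
    Z.dmap c c' u s ∈ S.arrowIdeal :=
  Submodule.add_mem _ (Submodule.smul_mem _ _ (pth_mul_mem_arrowIdeal (Z.a_ne _) _))
    (Submodule.smul_mem _ _ (pth_mul_mem_arrowIdeal (Z.b_ne _) _))

/-- As `a s` and `b s` end at `y s`, the map sees only the part of `u` in the projective module.
Preimages found in the free module can thus be moved there. -/
theorem dmap_projMap (c c' : ι → K) (u : ι → S.Alg) :
    Z.dmap c c' (S.projMap Z.y u) = Z.dmap c c' u := by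
  funext s
  have h1 : S.pth (Z.a s) * S.vert (Z.y s) = S.pth (Z.a s) := by
    rw [← bp_eq_pth (Z.a_path s) (Z.a_ne s), bp_mul_vert (Z.a_path s)]
  have h2 : ∀ s, S.pth (Z.b s) * S.vert (Z.y s) = S.pth (Z.b s) := fun s => by
    rw [← bp_eq_pth (Z.b_path s) (Z.b_ne s), bp_mul_vert (Z.b_path s)]
  rw [dmap_apply, dmap_apply, projMap_apply, projMap_apply, ← mul_assoc, ← mul_assoc, h1, h2]

/-- The composite of two consecutive maps is zero if the coefficients are compatible with the
socle relations. -/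
theorem dmap_dmap {c c' k k' : ι → K}
    (h : ∀ t, c (Z.σ t) * k (Z.σ t) * S.scalar (Z.x (Z.σ t)) (Z.b t ++ Z.B t) =
      c' (Z.σ t) * k' t * S.scalar (Z.x (Z.σ t)) (Z.a (Z.σ t) ++ Z.A (Z.σ t)))
    (u : ι → S.Alg) : Z.dmap c c' (Z.swap.dmap k k' u) = 0 := by
  funext s
  obtain ⟨t, rfl⟩ := Z.σ.surjective s
  have h1 : S.pth (Z.a (Z.σ t)) * S.pth (Z.B (Z.σ t)) = 0 :=
    Z.a_mul_B (Z.B_ne _) List.prefix_rfl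
  have h2 : S.pth (Z.b t) * S.pth (Z.A t) = 0 := Z.b_mul_A (Z.A_ne _) List.prefix_rfl
  have h3 := (Z.soc_aA (Z.σ t)).relation (Z.valency_x _) (Z.soc_bB t) (Z.ne_x t)
  have h4 := scalar_ne_zero (S := S) (E := Z.b t ++ Z.B t) (Z.valency_x (Z.σ t))
  set p := S.scalar (Z.x (Z.σ t)) (Z.a (Z.σ t) ++ Z.A (Z.σ t))
  set q := S.scalar (Z.x (Z.σ t)) (Z.b t ++ Z.B t)
  rw [dmap_apply, dmap_apply, dmap_apply]
  simp only [swap_a, swap_b, swap_σ, Equiv.symm_symm, Equiv.symm_apply_apply, mul_add,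
    mul_smul_comm, ← mul_assoc, h1, h2, zero_mul, smul_zero, add_zero, zero_add]
  rw [← pth_append, ← pth_append, smul_smul, smul_smul, ← smul_mul_assoc, ← smul_mul_assoc,
    ← add_mul]
  -- The mixed products are gone. By `h`, `q` times the remaining coefficient is a multiple of the
  -- socle relation, and `q` is non-zero.
  have h5 : q • ((c (Z.σ t) * k (Z.σ t)) • S.pth (Z.a (Z.σ t) ++ Z.A (Z.σ t)) +
      (c' (Z.σ t) * k' t) • S.pth (Z.b t ++ Z.B t)) = (c' (Z.σ t) * k' t) •
      (p • S.pth (Z.a (Z.σ t) ++ Z.A (Z.σ t)) + q • S.pth (Z.b t ++ Z.B t)) := by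
    rw [smul_add, smul_add, smul_smul, smul_smul, smul_smul, smul_smul, mul_comm q, h t, mul_comm q]
  rw [h3, smul_zero] at h5
  rw [(smul_eq_zero.1 h5).resolve_left h4, zero_mul]
  rfl

variable [DecidableEq ι]

theorem dmap_single (c c' : ι → K) (t : ι) (z : S.Alg) :
    Z.dmap c c' (Pi.single t z) = Pi.single t (c t • (S.pth (Z.a t) * z)) +
      Pi.single (Z.σ t) (c' (Z.σ t) • (S.pth (Z.b t) * z)) := by
  funext s
  rw [dmap_apply, Pi.add_apply]
  congr 1
  · by_cases h : s = t
    · subst h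
      simp
    · simp [h]
  · by_cases h : s = Z.σ t
    · subst h
      simp
    · have : Z.σ.symm s ≠ t := by
        rintro rfl
        simp at h
      simp [h, this]

/-- The index set of a basis of a complement of the kernel of `dmap`. -/
abbrev ComplIdx : Type x :=
  (Σ t : ι, Fin ((Z.A t).length + 1)) ⊕ (Σ t : ι, Fin ((Z.B t).length - 1))

/-- A basis of a complement of the kernel of `dmap`. -/
noncomputable def complVec : Z.ComplIdx → (ι → S.Alg)
  | Sum.inl ⟨t, k⟩ => Pi.single t (S.bp (Z.y t) ((Z.A t).take k))
  | Sum.inr ⟨t, k⟩ => Pi.single t (S.bp (Z.y t) ((Z.B t).take (k + 1)))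

/-- For the empty path both branches survive; as soon as one arrow of `A t` is present, the branch
through `b t` dies. -/
theorem dmap_complVec_inl (c c' : ι → K) (t : ι) (k : Fin ((Z.A t).length + 1)) :
    Z.dmap c c' (Z.complVec (Sum.inl ⟨t, k⟩)) =
      Pi.single t (c t • S.bp (Z.x t) (Z.a t ++ (Z.A t).take k)) +
      Pi.single (Z.σ t) (if k.1 = 0 then c' (Z.σ t) • S.bp (Z.x (Z.σ t)) (Z.b t) else 0) := by
  rw [complVec, dmap_single, pth_mul_bp (Z.a_path t) (Z.a_ne t)]
  split_ifs with h
  · rw [h, List.take_zero, bp_nil, ← bp_eq_pth (Z.b_path t) (Z.b_ne t), bp_mul_vert (Z.b_path t)]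
  · congr 2
    rw [pth_mul_bp (Z.b_path t) (Z.b_ne t), bp, pth_append,
      Z.b_mul_A _ (List.take_prefix k.1 _), mul_zero, smul_zero]
    rw [Ne, List.take_eq_nil_iff]
    have := Z.A_ne t
    tauto

theorem dmap_complVec_inr (c c' : ι → K) (t : ι) (k : Fin ((Z.B t).length - 1)) :
    Z.dmap c c' (Z.complVec (Sum.inr ⟨t, k⟩)) =
      Pi.single (Z.σ t) (c' (Z.σ t) • S.bp (Z.x (Z.σ t)) (Z.b t ++ (Z.B t).take (k + 1))) := by
  rw [complVec, dmap_single, pth_mul_bp (Z.b_path t) (Z.b_ne t),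
    pth_mul_bp (Z.a_path t) (Z.a_ne t), bp, pth_append, Z.a_mul_B _ (List.take_prefix (k.1 + 1) _),
    mul_zero, smul_zero, Pi.single_zero, zero_add]
  rw [Ne, List.take_eq_nil_iff]
  have := Z.B_ne t
  simp [this]

/-- Linear forms which are dual to the images of the vectors `complVec`. -/
theorem exists_dual {c c' : ι → K} (hc : ∀ t, c t ≠ 0) (hc' : ∀ t, c' t ≠ 0) (j : Z.ComplIdx) :
    ∃ χ : (ι → S.Alg) →ₗ[K] K, χ (Z.dmap c c' (Z.complVec j)) ≠ 0 ∧
      ∀ j', j ≠ j' → χ (Z.dmap c c' (Z.complVec j')) = 0 := by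
  rcases j with ⟨t, k⟩ | ⟨t, k⟩
  · obtain ⟨χ, h1, h2⟩ := S.exists_coeff (Z.valency_x t) (Z.good_a t k)
    -- The bound on `k'` keeps these paths off the socle. This is essential when the tested path is
    -- all of `a t ++ A t`, since the two socle paths are proportional; it is why `ComplIdx` omits
    -- the whole of `B t`.
    have hb : ∀ t' (k' : ℕ), k' < (Z.B t').length → Z.σ t' = t →
        χ (S.bp (Z.x t) (Z.b t' ++ (Z.B t').take k')) = 0 := by
      rintro t' k' hk' rfl
      exact h2 _ (Z.good_b t' k') (Z.a_append_ne_b_append t' _ _).symm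
        fun h => Z.not_isSocle_b hk' h.2
    have hb' : ∀ t', Z.σ t' = t → χ (S.bp (Z.x t) (Z.b t')) = 0 := by
      intro t' ht'
      simpa using hb t' 0 (List.length_pos_iff.2 (Z.B_ne t')) ht'
    refine ⟨χ ∘ₗ LinearMap.proj t, ?_, ?_⟩
    · rw [LinearMap.comp_apply, LinearMap.proj_apply, dmap_complVec_inl, Pi.add_apply,
        Pi.single_eq_same, map_add, map_smul, h1, smul_eq_mul, mul_one]
      -- At a fixed point of `σ` both summands of the image lie in the same coordinate.
      by_cases ht : Z.σ t = t
      · rw [Pi.single_apply, if_pos ht.symm]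
        split_ifs
        · rw [map_smul, ht, hb' t ht, smul_zero, add_zero]
          exact hc t
        · rw [map_zero, add_zero]
          exact hc t
      · rw [Pi.single_eq_of_ne (Ne.symm ht), map_zero, add_zero]
        exact hc t
    · rintro (⟨t', k'⟩ | ⟨t', k'⟩) hne
      · rw [LinearMap.comp_apply, LinearMap.proj_apply, dmap_complVec_inl, Pi.add_apply, map_add]
        have e1 : χ (Pi.single (M := fun _ => S.Alg) t'
            (c t' • S.bp (Z.x t') (Z.a t' ++ (Z.A t').take k')) t) = 0 := by
          by_cases ht : t = t'
          · subst ht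
            rw [Pi.single_eq_same, map_smul, h2 _ (Z.good_a t k'), smul_zero]
            · intro h
              have := congrArg List.length h
              have hk := k.2
              have hk' := k'.2
              simp only [List.length_append, List.length_take] at this
              apply hne
              congr 2
              apply Fin.ext
              omega
            · rintro ⟨h, h'⟩
              have := h.eq_of_prefix h' (Z.a_ne t) (List.prefix_append _ _)
                (List.prefix_append _ _)
              have := congrArg List.length this
              have hk := k.2
              have hk' := k'.2
              simp only [List.length_append, List.length_take] at this
              apply hne
              congr 2
              apply Fin.ext
              omega
          · rw [Pi.single_eq_of_ne ht, map_zero]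
        rw [e1, zero_add]
        by_cases ht : Z.σ t' = t
        · rw [ht, Pi.single_eq_same]
          split_ifs
          · rw [map_smul, hb' t' ht, smul_zero]
          · rw [map_zero]
        · rw [Pi.single_eq_of_ne (Ne.symm ht), map_zero]
      · rw [LinearMap.comp_apply, LinearMap.proj_apply, dmap_complVec_inr]
        by_cases ht : Z.σ t' = t
        · have hk' := k'.2
          rw [ht, Pi.single_eq_same, map_smul, hb t' (k'.1 + 1) (by omega) ht, smul_zero]
        · rw [Pi.single_eq_of_ne (Ne.symm ht), map_zero]
  · have hk := k.2
    obtain ⟨χ, h1, h2⟩ := S.exists_coeff (Z.valency_x (Z.σ t)) (Z.good_b t (k + 1))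
    have hs := Z.not_isSocle_b (t := t) (k := k + 1) (by omega)
    refine ⟨χ ∘ₗ LinearMap.proj (Z.σ t), ?_, ?_⟩
    · rw [LinearMap.comp_apply, LinearMap.proj_apply, dmap_complVec_inr, Pi.single_eq_same,
        map_smul, h1, smul_eq_mul, mul_one]
      exact hc' _
    · rintro (⟨t', k'⟩ | ⟨t', k'⟩) hne
      · rw [LinearMap.comp_apply, LinearMap.proj_apply, dmap_complVec_inl, Pi.add_apply, map_add]
        have e1 : χ (Pi.single (M := fun _ => S.Alg) t'
            (c t' • S.bp (Z.x t') (Z.a t' ++ (Z.A t').take k')) (Z.σ t)) = 0 := by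
          by_cases ht : Z.σ t = t'
          · subst ht
            rw [Pi.single_eq_same, map_smul, h2 _ (Z.good_a _ k') (Z.a_append_ne_b_append t _ _)
              (fun h => hs h.1), smul_zero]
          · rw [Pi.single_eq_of_ne ht, map_zero]
        rw [e1, zero_add]
        by_cases ht : t = t'
        · subst ht
          rw [Pi.single_eq_same]
          split_ifs
          · have hg := Z.good_b t 0
            rw [List.take_zero, List.append_nil] at hg
            rw [map_smul, h2 _ hg _ (fun h => hs h.1), smul_zero]
            intro h
            have := congrArg List.length h
            simp only [List.length_append, List.length_take] at this
            omega
          · rw [map_zero]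
        · rw [Pi.single_eq_of_ne fun h => ht (Z.σ.injective h), map_zero]
      · rw [LinearMap.comp_apply, LinearMap.proj_apply, dmap_complVec_inr]
        by_cases ht : t = t'
        · subst ht
          have hk' := k'.2
          rw [Pi.single_eq_same, map_smul, h2 _ (Z.good_b t _) _ (fun h => hs h.1), smul_zero]
          intro h
          have := congrArg List.length h
          simp only [List.length_append, List.length_take] at this
          apply hne
          congr 2
          apply Fin.ext
          omega
        · rw [Pi.single_eq_of_ne fun h => ht (Z.σ.injective h), map_zero]

variable [Fintype ι]

/-- The relevant paths at `y t` are the initial subpaths of `A t ++ a t` and `B t ++ b t`. Those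
running beyond `A t` or `B t` lie in the range up to a scalar; those inside are in `complVec`,
except the whole of `B t`, which the range trades for `A (σ t)`. -/
theorem mem_range_sup_span {k k' : ι → K} (hk : ∀ t, k t ≠ 0) (hk' : ∀ t, k' t ≠ 0)
    {u : ι → S.Alg} (hu : u ∈ S.projSub Z.y) :
    u ∈ LinearMap.range ((Z.swap.dmap k k').restrictScalars K) ⊔
      Submodule.span K (Set.range Z.complVec) := by
  have hs : ∀ j, Z.complVec j ∈ LinearMap.range ((Z.swap.dmap k k').restrictScalars K) ⊔
      Submodule.span K (Set.range Z.complVec) := fun j =>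
    Submodule.mem_sup_right (Submodule.subset_span ⟨j, rfl⟩)
  have hr : ∀ z, Z.swap.dmap k k' z ∈ LinearMap.range ((Z.swap.dmap k k').restrictScalars K) ⊔
      Submodule.span K (Set.range Z.complVec) := fun z =>
    Submodule.mem_sup_left ⟨z, rfl⟩
  have hd : ∀ t z, Z.swap.dmap k k' (Pi.single (Z.σ t) z) =
      Pi.single (Z.σ t) (k (Z.σ t) • (S.pth (Z.A (Z.σ t)) * z)) +
        Pi.single t (k' t • (S.pth (Z.B t) * z)) := by
    intro t z
    rw [dmap_single]
    simp
  have hsm : ∀ t (c : K) (z : S.Alg), c ≠ 0 → Pi.single t (c • z) ∈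
      LinearMap.range ((Z.swap.dmap k k').restrictScalars K) ⊔
      Submodule.span K (Set.range Z.complVec) → (Pi.single t z : ι → S.Alg) ∈
      LinearMap.range ((Z.swap.dmap k k').restrictScalars K) ⊔
      Submodule.span K (Set.range Z.complVec) := by
    intro t c z hc h
    have := Submodule.smul_mem _ c⁻¹ h
    rwa [← Pi.single_smul, smul_smul, inv_mul_cancel₀ hc, one_smul] at this
  refine (Submodule.span_le.2 ?_) (mem_span_single_bp hu)
  rintro _ ⟨t, l, ⟨E, hE, hl⟩, rfl⟩
  have hE' : E = Z.A t ++ Z.a t ∨ E = Z.B t ++ Z.b t := by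
    have h1 := Z.soc_Aa t
    have h2 := Z.soc_Bb t
    have h3 := Z.ne_y t
    rcases hE with rfl | ⟨h, rfl⟩ <;> rcases h1 with h1 | ⟨-, h1⟩ <;>
      rcases h2 with h2 | ⟨-, h2⟩ <;> grind
  rcases hE' with rfl | rfl
  · by_cases h : l <+: Z.A t
    · have := hs (Sum.inl ⟨t, ⟨l.length, Nat.lt_succ_of_le h.length_le⟩⟩)
      rwa [complVec, ← List.prefix_iff_eq_take.1 h] at this
    obtain ⟨r, rfl⟩ := (List.prefix_or_prefix_of_prefix hl (List.prefix_append _ _)).resolve_left h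
    have hr0 : r ≠ [] := by
      rintro rfl
      simp at h
    obtain ⟨t, rfl⟩ := Z.σ.surjective t
    -- The other branch of this image contains `B t` followed by `r`, which is zero.
    have h1 := hr (Pi.single (Z.σ t) (S.pth r))
    rw [hd, Z.B_mul_a hr0 ((List.prefix_append_right_inj _).1 hl), smul_zero, Pi.single_zero,
      add_zero] at h1
    rw [SetLike.mem_coe, bp_append, bp_eq_pth (Z.A_path _) (Z.A_ne _)]
    exact hsm _ _ _ (hk _) h1
  · by_cases h : l <+: Z.B t
    · rcases h.length_le.lt_or_eq with hlt | heq
      · by_cases hl0 : l = []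
        · subst hl0
          exact hs (Sum.inl ⟨t, 0⟩)
        · have hpos := List.length_pos_iff.2 hl0
          have := hs (Sum.inr ⟨t, ⟨l.length - 1, by omega⟩⟩)
          rw [complVec] at this
          simp only [Nat.sub_add_cancel hpos] at this
          rwa [← List.prefix_iff_eq_take.1 h] at this
      · obtain rfl := h.eq_of_length heq
        -- The image of a generator is a combination of `A (σ t)` and `B t` with non-zero
        -- coefficients, and the former is already in the span.
        have h1 := hr (Pi.single (Z.σ t) (S.vert (Z.x (Z.σ t))))
        have h2 := hs (Sum.inl ⟨Z.σ t, ⟨(Z.A (Z.σ t)).length, Nat.lt_succ_self _⟩⟩)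
        rw [complVec, List.take_length] at h2
        rw [hd, ← bp_eq_pth (Z.A_path _) (Z.A_ne _), bp_mul_vert (Z.A_path _),
          ← bp_eq_pth (Z.B_path _) (Z.B_ne _), bp_mul_vert (Z.B_path _), Pi.single_smul] at h1
        exact hsm _ _ _ (hk' _) ((Submodule.add_mem_iff_right _ (Submodule.smul_mem _ _ h2)).1 h1)
    obtain ⟨r, rfl⟩ := (List.prefix_or_prefix_of_prefix hl (List.prefix_append _ _)).resolve_left h
    have hr0 : r ≠ [] := by
      rintro rfl
      simp at h
    have h1 := hr (Pi.single (Z.σ t) (S.pth r))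
    rw [hd, Z.A_mul_b hr0 ((List.prefix_append_right_inj _).1 hl), smul_zero, Pi.single_zero,
      zero_add] at h1
    rw [SetLike.mem_coe, bp_append, bp_eq_pth (Z.B_path _) (Z.B_ne _)]
    exact hsm _ _ _ (hk' _) h1

/-- Exactness at the middle term. -/
theorem exists_dmap_eq {c c' k k' : ι → K} (hc : ∀ t, c t ≠ 0) (hc' : ∀ t, c' t ≠ 0)
    (hk : ∀ t, k t ≠ 0) (hk' : ∀ t, k' t ≠ 0)
    (h : ∀ t, c (Z.σ t) * k (Z.σ t) * S.scalar (Z.x (Z.σ t)) (Z.b t ++ Z.B t) =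
      c' (Z.σ t) * k' t * S.scalar (Z.x (Z.σ t)) (Z.a (Z.σ t) ++ Z.A (Z.σ t)))
    {u : ι → S.Alg} (hu : u ∈ S.projSub Z.y) (hd : Z.dmap c c' u = 0) :
    ∃ z ∈ S.projSub Z.x, Z.swap.dmap k k' z = u := by
  choose χ h1 h2 using Z.exists_dual hc hc'
  obtain ⟨z, rfl⟩ := LinearMap.mem_of_mem_ker_of_dual ((Z.dmap c c').restrictScalars K)
    (LinearMap.range ((Z.swap.dmap k k').restrictScalars K))
    (by rintro _ ⟨z, rfl⟩; exact Z.dmap_dmap h z) Z.complVec χ h1 h2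
    (Z.mem_range_sup_span hk hk' hu) hd
  exact ⟨S.projMap Z.x z, (S.projMap Z.x z).2, Z.swap.dmap_projMap k k' z⟩

end SocleCycle

end SpecialBiserial

/-! ### Presentation of the band module -/

namespace SpecialBiserial

open MulOpposite Presentation

namespace BandWord

section

variable {K : Type u} [Field K] {V : Type v} [Quiver.{w} V] {S : Presentation K V}

/-- A non-empty path is initial in at most one socle path, so the case distinction in `complement`
picks `E`. -/
theorem append_complement {i : V} {l E : List (Quiver.Total V)} (hE : S.IsSocle i E)
    (hl : IsProperInitial l E) : l ++ S.complement i l = E := by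
  obtain ⟨hl, ⟨r, rfl⟩, -⟩ := hl
  unfold complement
  split_ifs with h
  · rw [← hE.eq_of_prefix (Or.inl rfl) hl (List.prefix_append _ _) h, List.drop_left]
  · rcases hE with hE | ⟨-, hE⟩
    · rw [← hE] at h
      exact absurd (List.prefix_append _ _) h
    · rw [← hE, List.drop_left]

theorem complement_ne_nil {i : V} {l E : List (Quiver.Total V)} (hE : S.IsSocle i E)
    (hl : IsProperInitial l E) : S.complement i l ≠ [] := by
  intro h
  have := append_complement hE hl
  rw [h, List.append_nil] at this
  exact hl.2.2 this

variable (W : BandWord S)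

theorem exists_isSocle_a (t : Fin (W.m + 1)) :
    ∃ E, S.IsSocle (W.e t) E ∧ IsProperInitial (W.a t) E := by
  rcases W.initial t with h | h
  · exact ⟨_, Or.inl rfl, h.1⟩
  · exact ⟨_, Or.inr ⟨W.valency_e t, rfl⟩, h.1⟩

theorem exists_isSocle_b (t : Fin (W.m + 1)) :
    ∃ E, S.IsSocle (W.e (t + 1)) E ∧ IsProperInitial (W.b t) E := by
  have h := W.initial (t + 1)
  rw [add_sub_cancel_right] at h
  rcases h with h | h
  · exact ⟨_, Or.inr ⟨W.valency_e _, rfl⟩, h.2⟩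
  · exact ⟨_, Or.inl rfl, h.2⟩

/-- The paths of a band word and their complements in socle paths. -/
@[simps]
noncomputable def cycle : SocleCycle S (Fin (W.m + 1)) where
  x := W.e
  y := W.f
  σ := Equiv.addRight 1
  a := W.a
  b := W.b
  A := W.A
  B := W.B
  valency_x := W.valency_e
  valency_y := W.valency_f
  a_ne := W.a_ne_nil
  b_ne := W.b_ne_nil
  A_ne t := by
    obtain ⟨E, hE, h⟩ := W.exists_isSocle_a t
    exact complement_ne_nil hE h
  B_ne t := by
    obtain ⟨E, hE, h⟩ := W.exists_isSocle_b t
    exact complement_ne_nil hE h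
  a_path := W.a_path
  b_path := W.b_path
  soc_aA t := by
    obtain ⟨E, hE, h⟩ := W.exists_isSocle_a t
    rw [A, append_complement hE h]
    exact hE
  soc_bB t := by
    obtain ⟨E, hE, h⟩ := W.exists_isSocle_b t
    rw [B, Equiv.coe_addRight, append_complement hE h]
    exact hE
  ne_x t := by
    have h2 := W.valency_e (t + 1)
    have hC : S.IsSocle (W.e (t + 1)) (S.C (W.e (t + 1))) := Or.inl rfl
    have hD : S.IsSocle (W.e (t + 1)) (S.D (W.e (t + 1))) := Or.inr ⟨h2, rfl⟩
    have hne : S.C (W.e (t + 1)) ≠ S.D (W.e (t + 1)) := fun h => S.head_ne _ h2 (by rw [h])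
    rw [A, B, Equiv.coe_addRight]
    have h := W.initial (t + 1)
    rw [add_sub_cancel_right] at h
    rcases h with ⟨h, h'⟩ | ⟨h, h'⟩
    · rw [append_complement hC h, append_complement hD h']
      exact hne
    · rw [append_complement hC h', append_complement hD h]
      exact hne.symm
  ne_y t := by
    intro h
    have := congrArg List.getLast? h
    rw [List.getLast?_append_of_ne_nil _ (W.a_ne_nil t),
      List.getLast?_append_of_ne_nil _ (W.b_ne_nil t)] at this
    exact W.last_ne t this

theorem getElem_a_ne_getElem_b (t : Fin (W.m + 1)) (ha : 0 < (W.a (t + 1)).length)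
    (hb : 0 < (W.b t).length) : (W.a (t + 1))[0] ≠ (W.b t)[0] := by
  intro h
  have h1 : [(W.a (t + 1))[0]] <+: W.a (t + 1) := by
    refine ⟨(W.a (t + 1)).tail, ?_⟩
    rw [List.singleton_append, ← List.head_eq_getElem_zero (W.a_ne_nil _), List.cons_head_tail]
  have h2 : [(W.b t)[0]] <+: W.b t := by
    refine ⟨(W.b t).tail, ?_⟩
    rw [List.singleton_append, ← List.head_eq_getElem_zero (W.b_ne_nil _), List.cons_head_tail]
  rw [← h] at h2
  exact absurd (W.cycle.eq_of_prefix_a_of_prefix_b t h1 h2) (by simp)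

/-- An arrow occurrence is determined by its starting point and its arrow. -/
theorem eq_of_start_of_label {s s' : W.Pos} (h : W.start s = W.start s')
    (h' : W.label s = W.label s') : s = s' := by
  rcases s with ⟨t, k⟩ | ⟨t, ⟨_ | k, hk⟩⟩ <;> rcases s' with ⟨t', k'⟩ | ⟨t', ⟨_ | k', hk'⟩⟩
  · exact h
  · simp only [start, Sum.inl.injEq] at h
    obtain ⟨rfl, h⟩ := Sigma.mk.inj h
    obtain rfl := eq_of_heq h
    exact absurd h' (W.getElem_a_ne_getElem_b t' _ _)
  · simp [start] at h
  · simp only [start, Sum.inl.injEq] at h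
    obtain ⟨rfl, h⟩ := Sigma.mk.inj h
    obtain rfl := eq_of_heq h
    exact absurd h'.symm (W.getElem_a_ne_getElem_b t _ _)
  · simp only [start, Sum.inl.injEq] at h
    obtain ⟨h, -⟩ := Sigma.mk.inj h
    obtain rfl := add_right_cancel h
    rfl
  · simp [start] at h
  · simp [start] at h
  · simp [start] at h
  · simp only [start, Sum.inr.injEq] at h
    obtain ⟨rfl, h⟩ := Sigma.mk.inj h
    have := congrArg Fin.val (eq_of_heq h)
    simp only at this
    subst this
    rfl

-- By `eq_of_start_of_label` an arrow occurs at most once with a given starting point, so the sum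
-- defining this row reduces to one term.
open Classical in
theorem arrowMatrix_start (lam : K) (s : W.Pos) :
    W.arrowMatrix lam (W.label s) (W.start s) = Pi.single (W.finish s) (W.weight lam s) := by
  funext y
  rw [arrowMatrix, Matrix.sum_apply, Finset.sum_eq_single s]
  · rw [if_pos rfl, Matrix.single_apply, Pi.single_apply]
    by_cases h : W.finish s = y
    · simp [h]
    · simp [h, Ne.symm h]
  · intro s' _ hs'
    split_ifs with h
    · rw [Matrix.single_apply, if_neg]
      rintro ⟨h', -⟩
      exact hs' (W.eq_of_start_of_label h' h)
    · rfl
  · simp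

noncomputable instance moduleBandModule (lam : K) : Module K (W.BandModule lam) :=
  inferInstanceAs (Module K (W.Pos → K))

/-- The basis vector of the band module at a point of the word. -/
noncomputable def basisVec (lam : K) (s : W.Pos) : W.BandModule lam :=
  (open Classical in Pi.single s 1 : W.Pos → K)

/-- The coordinates of the band module. -/
def coord (lam : K) (s : W.Pos) : W.BandModule lam →ₗ[K] K :=
  (LinearMap.proj s : (W.Pos → K) →ₗ[K] K)

theorem coord_basisVec_self (lam : K) (s : W.Pos) : W.coord lam s (W.basisVec lam s) = 1 := by
  classical
  exact Pi.single_eq_same (M := fun _ : W.Pos => K) s (1 : K)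

theorem coord_basisVec_of_ne (lam : K) {s s' : W.Pos} (h : s ≠ s') :
    W.coord lam s (W.basisVec lam s') = 0 := by
  classical
  exact Pi.single_eq_of_ne (M := fun _ : W.Pos => K) h (1 : K)

theorem sum_coord_smul (lam : K) (z : W.BandModule lam) :
    ∑ s, W.coord lam s z • W.basisVec lam s = z := by
  classical
  exact (pi_eq_sum_univ' z).symm

/-- The scalar by which the path `a_t` acts. -/
def wt (lam : K) (t : Fin (W.m + 1)) : K := if t = 0 then lam else 1

theorem wt_ne_zero {lam : K} (h : lam ≠ 0) (t : Fin (W.m + 1)) : W.wt lam t ≠ 0 := by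
  unfold wt
  split_ifs
  · exact h
  · exact one_ne_zero

variable [Fintype V]

theorem op_smul_def (lam : K) (r : S.Alg) (z : W.BandModule lam) :
    op r • z = (Matrix.vecMul (z : W.Pos → K) (W.rep lam r) : W.Pos → K) :=
  rfl

instance isScalarTower_bandModule (lam : K) :
    IsScalarTower K S.Algᵐᵒᵖ (W.BandModule lam) where
  smul_assoc c r z := by
    change Matrix.vecMul (z : W.Pos → K) (W.rep lam (c • r.unop)) =
      c • Matrix.vecMul (z : W.Pos → K) (W.rep lam r.unop)
    rw [map_smul]
    exact Matrix.vecMul_smul _ _ _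

theorem rep_arr (lam : K) (α : Quiver.Total V) :
    W.rep lam (S.arr α) = W.arrowMatrix lam α := by
  have h1 : W.rep lam (S.arr α) = W.pathRep lam (PathAlgebra.arrow K α) :=
    RingQuot.liftAlgHom_mkAlgHom_apply K (W.pathRep lam) (W.pathRep_rel lam) _
  rw [h1]
  simp [pathRep, PathAlgebra.arrow, freeRep]

theorem rep_vert (lam : K) (i : V) : W.rep lam (S.vert i) = W.vertexMatrix i := by
  have h1 : W.rep lam (S.vert i) = W.pathRep lam (PathAlgebra.vertex K i) :=
    RingQuot.liftAlgHom_mkAlgHom_apply K (W.pathRep lam) (W.pathRep_rel lam) _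
  rw [h1]
  simp [pathRep, PathAlgebra.vertex, freeRep]

theorem arr_smul_basisVec (lam : K) (s : W.Pos) :
    op (S.arr (W.label s)) • W.basisVec lam (W.start s) =
      W.weight lam s • W.basisVec lam (W.finish s) := by
  classical
  have h1 : op (S.arr (W.label s)) • W.basisVec lam (W.start s) =
      (Pi.single (W.finish s) (W.weight lam s) : W.Pos → K) := by
    rw [op_smul_def, rep_arr, ← arrowMatrix_start]
    exact Matrix.single_one_vecMul _ _
  have h2 : W.weight lam s • W.basisVec lam (W.finish s) =
      (W.weight lam s • Pi.single (W.finish s) 1 : W.Pos → K) := rfl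
  rw [h1, h2, ← Pi.single_smul, smul_eq_mul, mul_one]

theorem vert_smul_basisVec (lam : K) {i : V} {s : W.Pos} (h : W.vertexAt s = i) :
    op (S.vert i) • W.basisVec lam s = W.basisVec lam s := by
  classical
  rw [op_smul_def, rep_vert]
  refine (Matrix.single_one_vecMul _ _).trans ?_
  funext y
  change W.vertexMatrix i s y = (Pi.single s 1 : W.Pos → K) y
  rw [vertexMatrix, Matrix.diagonal_apply, Pi.single_apply]
  by_cases hy : s = y
  · rw [if_pos hy, if_pos hy.symm, if_pos h]
  · rw [if_neg hy, if_neg (Ne.symm hy)]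

/-- The point `e_t` of the word. -/
def posE (t : Fin (W.m + 1)) : W.Pos :=
  Sum.inl ⟨t, ⟨0, List.length_pos_iff.2 (W.a_ne_nil t)⟩⟩

/-- The point `f_t` of the word. -/
def posF (t : Fin (W.m + 1)) : W.Pos :=
  Sum.inr ⟨t, ⟨(W.b t).length - 1, Nat.sub_lt (List.length_pos_iff.2 (W.b_ne_nil t)) Nat.one_pos⟩⟩

theorem vert_smul_posE (lam : K) (t : Fin (W.m + 1)) :
    op (S.vert (W.e t)) • W.basisVec lam (W.posE t) = W.basisVec lam (W.posE t) :=
  W.vert_smul_basisVec lam (isPath_getElem_zero (W.a_path t) _)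

theorem bp_smul_posE (lam : K) (t : Fin (W.m + 1)) (l : List (Quiver.Total V)) :
    op (S.bp (W.e t) l) • W.basisVec lam (W.posE t) =
      op (S.pth l) • W.basisVec lam (W.posE t) := by
  rw [bp, op_mul, mul_smul, vert_smul_posE]

theorem pth_take_succ (l : List (Quiver.Total V)) (k : ℕ) (hk : k < l.length) :
    S.pth (l.take (k + 1)) = S.pth (l.take k) * S.arr l[k] := by
  rw [← List.take_append_getElem hk, pth_append, pth_singleton]

theorem op_smul_smul (lam : K) (r : S.Alg) (c : K) (z : W.BandModule lam) :
    op r • c • z = c • op r • z :=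
  smul_algebra_smul_comm c (op r) z

/-- The scalar enters with the first arrow only, so every non-empty initial subpath acts with the
same factor. Using `finish` treats inner points of `a t` and the end point `f t` together. -/
theorem a_take_succ_smul_posE (lam : K) (t : Fin (W.m + 1)) (k : ℕ) (hk : k < (W.a t).length) :
    op (S.pth ((W.a t).take (k + 1))) • W.basisVec lam (W.posE t) =
      W.wt lam t • W.basisVec lam (W.finish (Sum.inl ⟨t, ⟨k, hk⟩⟩)) := by
  have h := W.arr_smul_basisVec lam (Sum.inl ⟨t, ⟨k, hk⟩⟩)
  change op (S.arr (W.a t)[k]) • W.basisVec lam (Sum.inl ⟨t, ⟨k, hk⟩⟩) =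
    (if t = 0 ∧ k = 0 then lam else 1) • _ at h
  rw [pth_take_succ _ _ hk, op_mul, mul_smul]
  cases k with
  | zero =>
    rw [List.take_zero, pth_nil, op_one, one_smul]
    simpa [wt, posE] using h
  | succ k =>
    have hf : W.finish (Sum.inl ⟨t, ⟨k, by omega⟩⟩) = Sum.inl ⟨t, ⟨k + 1, hk⟩⟩ := by
      simp [finish, hk]
    rw [a_take_succ_smul_posE lam t k (by omega), hf, op_smul_smul, h]
    simp

theorem a_take_smul_posE (lam : K) (t : Fin (W.m + 1)) (k : ℕ) (hk : k < (W.a t).length) :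
    op (S.pth ((W.a t).take k)) • W.basisVec lam (W.posE t) =
      (if k = 0 then 1 else W.wt lam t) • W.basisVec lam (Sum.inl ⟨t, ⟨k, hk⟩⟩) := by
  cases k with
  | zero => simp [posE]
  | succ k =>
    rw [a_take_succ_smul_posE W lam t k (by omega)]
    simp [finish, hk]

theorem a_smul_posE (lam : K) (t : Fin (W.m + 1)) :
    op (S.pth (W.a t)) • W.basisVec lam (W.posE t) = W.wt lam t • W.basisVec lam (W.posF t) := by
  have hpos := List.length_pos_iff.2 (W.a_ne_nil t)
  have h := W.a_take_succ_smul_posE lam t ((W.a t).length - 1) (by omega)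
  rw [Nat.sub_add_cancel hpos, List.take_length] at h
  rw [h]
  simp [finish, posF, Nat.sub_add_cancel hpos]

theorem b_take_smul_posE (lam : K) (t : Fin (W.m + 1)) (k : ℕ) (hk : k < (W.b t).length) :
    op (S.pth ((W.b t).take (k + 1))) • W.basisVec lam (W.posE (t + 1)) =
      W.basisVec lam (Sum.inr ⟨t, ⟨k, hk⟩⟩) := by
  have h := W.arr_smul_basisVec lam (Sum.inr ⟨t, ⟨k, hk⟩⟩)
  rw [weight, one_smul] at h
  change op (S.arr (W.b t)[k]) • _ = W.basisVec lam (Sum.inr ⟨t, ⟨k, hk⟩⟩) at h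
  rw [pth_take_succ _ _ hk, op_mul, mul_smul]
  cases k with
  | zero =>
    rw [List.take_zero, pth_nil, op_one, one_smul]
    exact h
  | succ k =>
    rw [b_take_smul_posE lam t k (by omega)]
    exact h

theorem b_smul_posE (lam : K) (t : Fin (W.m + 1)) :
    op (S.pth (W.b t)) • W.basisVec lam (W.posE (t + 1)) = W.basisVec lam (W.posF t) := by
  have hpos := List.length_pos_iff.2 (W.b_ne_nil t)
  have h := W.b_take_smul_posE lam t ((W.b t).length - 1) (by omega)
  rwa [Nat.sub_add_cancel hpos, List.take_length] at h

/-- The homomorphism `⨁ e_{e_t} Λ → M(lam)` which sends the generator `ε_t` to `κ_t` times the basis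
vector at the point `e_t`. -/
noncomputable def aug (lam : K) (κ : Fin (W.m + 1) → K) :
    (Fin (W.m + 1) → S.Alg) →ₗ[S.Algᵐᵒᵖ] W.BandModule lam where
  toFun u := ∑ t, op (u t) • κ t • W.basisVec lam (W.posE t)
  map_add' u u' := by
    simp only [Pi.add_apply, op_add, add_smul, Finset.sum_add_distrib]
  map_smul' r u := by
    simp only [Pi.smul_apply, smul_eq_mul_unop, op_mul, op_unop, mul_smul, Finset.smul_sum,
      RingHom.id_apply]

theorem aug_single (lam : K) (κ : Fin (W.m + 1) → K) (t : Fin (W.m + 1)) (z : S.Alg) :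
    W.aug lam κ (Pi.single t z) = κ t • op z • W.basisVec lam (W.posE t) := by
  change ∑ s, op ((Pi.single t z : Fin (W.m + 1) → S.Alg) s) • κ s • _ = _
  rw [Finset.sum_eq_single t]
  · rw [Pi.single_eq_same, op_smul_smul]
  · intro s _ hs
    rw [Pi.single_eq_of_ne hs, op_zero, zero_smul]
  · simp

/-- Both `a t` and `b t` lead to the point `f t`, and `h` says that their contributions there
cancel. -/
theorem aug_dmap {lam : K} {κ c c' : Fin (W.m + 1) → K}
    (h : ∀ t, c t * κ t * W.wt lam t + c' (t + 1) * κ (t + 1) = 0) (u : Fin (W.m + 1) → S.Alg) :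
    W.aug lam κ (W.cycle.dmap c c' u) = 0 := by
  rw [← Finset.univ_sum_single u, map_sum, map_sum]
  refine Finset.sum_eq_zero fun t _ => ?_
  rw [SocleCycle.dmap_single, map_add, aug_single, aug_single]
  simp only [cycle_a, cycle_b, cycle_σ, Equiv.coe_addRight, op_smul, smul_assoc, op_mul,
    mul_smul, a_smul_posE, b_smul_posE, op_smul_smul]
  rw [smul_smul, smul_smul, smul_smul, ← add_smul]
  have := h t
  rw [show κ t * c t * W.wt lam t + κ (t + 1) * c' (t + 1) = 0 by rw [← this]; ring, zero_smul]

/-- Lifts of multiples of the basis vectors of the band module. -/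
noncomputable def liftVec : W.Pos → (Fin (W.m + 1) → S.Alg)
  | Sum.inl ⟨t, k⟩ => Pi.single t (S.bp (W.e t) ((W.a t).take k))
  | Sum.inr ⟨t, k⟩ => Pi.single (t + 1) (S.bp (W.e (t + 1)) ((W.b t).take (k + 1)))

theorem exists_aug_liftVec {lam : K} (hlam : lam ≠ 0) {κ : Fin (W.m + 1) → K} (hκ : ∀ t, κ t ≠ 0)
    (s : W.Pos) : ∃ c : K, c ≠ 0 ∧ W.aug lam κ (W.liftVec s) = c • W.basisVec lam s := by
  rcases s with ⟨t, k⟩ | ⟨t, k⟩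
  · refine ⟨κ t * if k.1 = 0 then 1 else W.wt lam t, mul_ne_zero (hκ t) ?_, ?_⟩
    · split_ifs
      · exact one_ne_zero
      · exact W.wt_ne_zero hlam t
    · rw [liftVec, aug_single, bp_smul_posE, W.a_take_smul_posE lam t k.1 k.2, smul_smul]
  · refine ⟨κ (t + 1), hκ _, ?_⟩
    rw [liftVec, aug_single, bp_smul_posE, W.b_take_smul_posE lam t k.1 k.2]

theorem liftVec_mem (s : W.Pos) : W.liftVec s ∈ S.projSub W.e := by
  have h : ∀ t l, Pi.single t (S.bp (W.e t) l) ∈ S.projSub W.e := by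
    intro t l s
    by_cases h : s = t
    · subst h
      rw [Pi.single_eq_same, vert_mul_bp]
    · rw [Pi.single_eq_of_ne h, mul_zero]
  rcases s with ⟨t, k⟩ | ⟨t, k⟩
  · exact h _ _
  · exact h _ _

theorem aug_surjective {lam : K} (hlam : lam ≠ 0) {κ : Fin (W.m + 1) → K} (hκ : ∀ t, κ t ≠ 0)
    (z : W.BandModule lam) : ∃ u ∈ S.projSub W.e, W.aug lam κ u = z := by
  choose c hc h using W.exists_aug_liftVec hlam hκ
  refine ⟨∑ s, op (algebraMap K S.Alg (W.coord lam s z * (c s)⁻¹)) • W.liftVec s,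
    Submodule.sum_mem _ fun s _ => Submodule.smul_mem _ _ (W.liftVec_mem s), ?_⟩
  rw [map_sum]
  conv_rhs => rw [← W.sum_coord_smul lam z]
  refine Finset.sum_congr rfl fun s _ => ?_
  rw [map_smul, h]
  have h1 : op (algebraMap K S.Alg (W.coord lam s z * (c s)⁻¹)) =
      algebraMap K S.Algᵐᵒᵖ (W.coord lam s z * (c s)⁻¹) := rfl
  rw [h1, algebraMap_smul, smul_smul, mul_assoc, inv_mul_cancel₀ (hc s), mul_one]

/-- Initial subpaths running beyond `a` or `b` lie in the range up to a scalar. Inside, only the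
whole of `a t` has no lift in `liftVec`: it reaches the same point `f t` as `b t` and is traded for
it. -/
theorem mem_range_sup_span {c c' : Fin (W.m + 1) → K} (hc : ∀ t, c t ≠ 0) (hc' : ∀ t, c' t ≠ 0)
    {u : Fin (W.m + 1) → S.Alg} (hu : u ∈ S.projSub W.e) :
    u ∈ LinearMap.range ((W.cycle.dmap c c').restrictScalars K) ⊔
      Submodule.span K (Set.range W.liftVec) := by
  set N := LinearMap.range ((W.cycle.dmap c c').restrictScalars K) ⊔
      Submodule.span K (Set.range W.liftVec)
  have hs : ∀ j, W.liftVec j ∈ N := fun j =>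
    Submodule.mem_sup_right (Submodule.subset_span ⟨j, rfl⟩)
  have hr : ∀ z, W.cycle.dmap c c' z ∈ N := fun z => Submodule.mem_sup_left ⟨z, rfl⟩
  have hd : ∀ t z, W.cycle.dmap c c' (Pi.single t z) =
      Pi.single t (c t • (S.pth (W.a t) * z)) +
        Pi.single (t + 1) (c' (t + 1) • (S.pth (W.b t) * z)) := fun t z =>
    W.cycle.dmap_single c c' t z
  have hsm : ∀ t (c : K) (z : S.Alg), c ≠ 0 → Pi.single t (c • z) ∈ N →
      (Pi.single t z : Fin (W.m + 1) → S.Alg) ∈ N := by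
    intro t c z hc h
    have := Submodule.smul_mem _ c⁻¹ h
    rwa [← Pi.single_smul, smul_smul, inv_mul_cancel₀ hc, one_smul] at this
  have hb : ∀ t l, l <+: W.b t → Pi.single (t + 1) (S.bp (W.e (t + 1)) l) ∈ N := by
    intro t l h
    by_cases hl0 : l = []
    · subst hl0
      exact hs (W.posE (t + 1))
    · have hpos := List.length_pos_iff.2 hl0
      have hle := h.length_le
      have := hs (Sum.inr ⟨t, ⟨l.length - 1, by omega⟩⟩)
      rw [liftVec] at this
      simp only [Nat.sub_add_cancel hpos] at this
      rwa [← List.prefix_iff_eq_take.1 h] at this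
  refine (Submodule.span_le.2 ?_) (mem_span_single_bp hu)
  rintro _ ⟨t, l, ⟨E, hE, hl⟩, rfl⟩
  rw [SetLike.mem_coe]
  obtain ⟨t, rfl⟩ : ∃ t', t = t' + 1 := ⟨t - 1, by simp⟩
  have hE' : E = W.a (t + 1) ++ W.A (t + 1) ∨ E = W.b t ++ W.B t := by
    have h1 : S.IsSocle (W.e (t + 1)) (W.a (t + 1) ++ W.A (t + 1)) := W.cycle.soc_aA (t + 1)
    have h2 : S.IsSocle (W.e (t + 1)) (W.b t ++ W.B t) := W.cycle.soc_bB t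
    have h3 : W.a (t + 1) ++ W.A (t + 1) ≠ W.b t ++ W.B t := W.cycle.ne_x t
    rcases hE with rfl | ⟨h, rfl⟩ <;> rcases h1 with h1 | ⟨-, h1⟩ <;>
      rcases h2 with h2 | ⟨-, h2⟩ <;> grind
  rcases hE' with rfl | rfl
  · generalize t + 1 = t at *
    by_cases h : l <+: W.a t
    · rcases h.length_le.lt_or_eq with hlt | heq
      · have := hs (Sum.inl ⟨t, ⟨l.length, hlt⟩⟩)
        rwa [liftVec, ← List.prefix_iff_eq_take.1 h] at this
      · obtain rfl := h.eq_of_length heq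
        have h1 := hr (Pi.single t (S.vert (W.f t)))
        have h2 := hb t _ List.prefix_rfl
        rw [hd, ← bp_eq_pth (W.a_path _) (W.a_ne_nil _), bp_mul_vert (W.a_path _),
          ← bp_eq_pth (W.b_path _) (W.b_ne_nil _), bp_mul_vert (W.b_path _),
          Pi.single_smul (t + 1)] at h1
        exact hsm _ _ _ (hc _) ((Submodule.add_mem_iff_left _ (Submodule.smul_mem _ _ h2)).1 h1)
    obtain ⟨r, rfl⟩ := (List.prefix_or_prefix_of_prefix hl (List.prefix_append _ _)).resolve_left h
    have hr0 : r ≠ [] := by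
      rintro rfl
      simp at h
    have h0 : S.pth (W.b t) * S.pth r = 0 :=
      W.cycle.b_mul_A hr0 ((List.prefix_append_right_inj _).1 hl)
    have h1 := hr (Pi.single t (S.pth r))
    rw [hd, h0, smul_zero, Pi.single_zero, add_zero] at h1
    rw [bp_append, bp_eq_pth (W.a_path _) (W.a_ne_nil _)]
    exact hsm _ _ _ (hc _) h1
  · by_cases h : l <+: W.b t
    · exact hb t l h
    obtain ⟨r, rfl⟩ := (List.prefix_or_prefix_of_prefix hl (List.prefix_append _ _)).resolve_left h
    have hr0 : r ≠ [] := by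
      rintro rfl
      simp at h
    have h0 : S.pth (W.a t) * S.pth r = 0 :=
      W.cycle.a_mul_B hr0 ((List.prefix_append_right_inj _).1 hl)
    have h1 := hr (Pi.single t (S.pth r))
    rw [hd, h0, smul_zero, Pi.single_zero, zero_add] at h1
    rw [bp_append, bp_eq_pth (W.b_path _) (W.b_ne_nil _)]
    exact hsm _ _ _ (hc' _) h1

/-- The presentation of the band module. -/
theorem exists_dmap_eq_of_aug_eq_zero {lam : K} (hlam : lam ≠ 0) {κ c c' : Fin (W.m + 1) → K}
    (hκ : ∀ t, κ t ≠ 0) (hc : ∀ t, c t ≠ 0) (hc' : ∀ t, c' t ≠ 0)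
    (h : ∀ t, c t * κ t * W.wt lam t + c' (t + 1) * κ (t + 1) = 0)
    {u : Fin (W.m + 1) → S.Alg} (hu : u ∈ S.projSub W.e) (hu0 : W.aug lam κ u = 0) :
    ∃ z ∈ S.projSub W.f, W.cycle.dmap c c' z = u := by
  choose d hd hd' using W.exists_aug_liftVec hlam hκ
  obtain ⟨z, rfl⟩ := LinearMap.mem_of_mem_ker_of_dual ((W.aug lam κ).restrictScalars K)
    (LinearMap.range ((W.cycle.dmap c c').restrictScalars K))
    (by rintro _ ⟨z, rfl⟩; exact W.aug_dmap h z) W.liftVec (W.coord lam)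
    (fun s => by
      rw [LinearMap.restrictScalars_apply, hd', map_smul, coord_basisVec_self, smul_eq_mul,
        mul_one]
      exact hd s)
    (fun s s' hs => by
      rw [LinearMap.restrictScalars_apply, hd', map_smul, coord_basisVec_of_ne W lam hs,
        smul_zero])
    (W.mem_range_sup_span hc hc' hu) hu0
  exact ⟨S.projMap W.f z, (S.projMap W.f z).2, W.cycle.dmap_projMap c c' z⟩

end

end BandWord

end SpecialBiserial

/-! ### Rescaling, the second syzygy, and the proposition -/

/-- Surjections with the same kernel have isomorphic targets. -/
theorem LinearMap.nonempty_equiv_of_ker_eq {R : Type u} [Ring R] {P : Type v} [AddCommGroup P]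
    [Module R P] {M : Type w} [AddCommGroup M] [Module R M] {N : Type x} [AddCommGroup N]
    [Module R N] {f : P →ₗ[R] M} {g : P →ₗ[R] N} (hf : Function.Surjective f)
    (hg : Function.Surjective g) (h : ∀ z, f z = 0 ↔ g z = 0) : Nonempty (M ≃ₗ[R] N) :=
  ⟨(f.quotKerEquivOfSurjective hf).symm.trans
    ((Submodule.quotEquivOfEq _ _ (Submodule.ext h)).trans (g.quotKerEquivOfSurjective hg))⟩

/-- A multiplicative cocycle on a cycle with trivial product is a coboundary. -/
theorem Fin.exists_coboundary {K : Type u} [Field K] {m : ℕ} (f : Fin (m + 1) → K)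
    (hf : ∀ t, f t ≠ 0) (h : ∏ t, f t = 1) :
    ∃ κ : Fin (m + 1) → K, (∀ t, κ t ≠ 0) ∧ ∀ t, κ (t + 1) = f t * κ t := by
  -- Partial products solve the recursion; at the wrap from the last index to 0 it holds because the
  -- full product is 1.
  refine ⟨fun t => ∏ i ∈ Finset.Iio t, f i, fun t => Finset.prod_ne_zero_iff.2 fun i _ => hf i,
    fun t => ?_⟩
  have hI : ∏ i ∈ Finset.Iic t, f i = f t * ∏ i ∈ Finset.Iio t, f i := by
    rw [← Finset.Iio_insert, Finset.prod_insert (by simp)]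
  simp only
  rw [← hI]
  rcases Fin.eq_castSucc_or_eq_last t with ⟨j, rfl⟩ | rfl
  · rw [Fin.coeSucc_eq_succ]
    congr 1
  · rw [Fin.last_add_one]
    have h1 : Finset.Iic (Fin.last m) = Finset.univ := by
      ext i
      simp [Fin.le_last]
    have h2 : Finset.Iio (0 : Fin (m + 1)) = ∅ := by
      ext i
      simp
    rw [h1, h2, h, Finset.prod_empty]

namespace SpecialBiserial

open MulOpposite Presentation

theorem SocleCycle.swap_swap {K : Type u} [Field K] {V : Type v} [Quiver.{w} V]
    {S : Presentation K V} {ι : Type x} (Z : SocleCycle S ι) : Z.swap.swap = Z := by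
  cases Z
  simp [SocleCycle.swap]

namespace BandWord

variable {K : Type u} [Field K] {V : Type v} [Quiver.{w} V] {S : Presentation K V}
  (W : BandWord S)

theorem pF_ne_zero (t : Fin (W.m + 1)) : W.pF t ≠ 0 := scalar_ne_zero (W.valency_f t)

theorem qF_ne_zero (t : Fin (W.m + 1)) : W.qF t ≠ 0 := scalar_ne_zero (W.valency_f t)

theorem pE_ne_zero (t : Fin (W.m + 1)) : W.pE t ≠ 0 := scalar_ne_zero (W.valency_e t)

theorem qE_ne_zero (t : Fin (W.m + 1)) : W.qE t ≠ 0 := scalar_ne_zero (W.valency_e t)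

theorem parameter_ne_zero : W.parameter ≠ 0 :=
  Finset.prod_ne_zero_iff.2 fun t _ => mul_ne_zero (div_ne_zero (W.qF_ne_zero t) (W.pF_ne_zero t))
    (div_ne_zero (W.pE_ne_zero t) (W.qE_ne_zero t))

theorem prod_wt (lam : K) : ∏ t, W.wt lam t = lam := by
  simp [wt]

/-- A coefficient of the second differential. -/
noncomputable def coeffSnd (lam : K) (t : Fin (W.m + 1)) : K := -(W.qE (t + 1) / W.wt lam t)

theorem coeffSnd_ne_zero {lam : K} (hlam : lam ≠ 0) (t : Fin (W.m + 1)) :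
    W.coeffSnd lam t ≠ 0 :=
  neg_ne_zero.2 (div_ne_zero (W.qE_ne_zero _) (W.wt_ne_zero hlam t))

/-- The hypothesis of `dmap_dmap` at the vertices `e`; solving it for the last coefficient is what
gives `coeffSnd`. -/
theorem firstDiff_compat {lam : K} (hlam : lam ≠ 0) (t : Fin (W.m + 1)) :
    (1 : K) * W.pE (W.cycle.σ t) *
        S.scalar (W.cycle.x (W.cycle.σ t)) (W.cycle.b t ++ W.cycle.B t) =
      -W.wt lam (W.cycle.σ t - 1) * W.coeffSnd lam t * S.scalar (W.cycle.x (W.cycle.σ t))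
        (W.cycle.a (W.cycle.σ t) ++ W.cycle.A (W.cycle.σ t)) := by
  have h1 : S.scalar (W.cycle.x (W.cycle.σ t)) (W.cycle.b t ++ W.cycle.B t) = W.qE (t + 1) := by
    simp [qE]
  have h2 : S.scalar (W.cycle.x (W.cycle.σ t))
        (W.cycle.a (W.cycle.σ t) ++ W.cycle.A (W.cycle.σ t)) = W.pE (t + 1) := rfl
  have h3 : W.cycle.σ t = t + 1 := rfl
  have := W.wt_ne_zero hlam t
  rw [h1, h2, h3, add_sub_cancel_right, coeffSnd]
  field_simp

/-- The factor by which the parameter changes at one step of the word. -/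
noncomputable def twist (lam : K) (t : Fin (W.m + 1)) : K :=
  W.wt lam t * (W.pE t * W.qF t / (W.qE (t + 1) * W.pF t))

theorem twist_ne_zero {lam : K} (hlam : lam ≠ 0) (t : Fin (W.m + 1)) : W.twist lam t ≠ 0 :=
  mul_ne_zero (W.wt_ne_zero hlam t) (div_ne_zero (mul_ne_zero (W.pE_ne_zero t) (W.qF_ne_zero t))
    (mul_ne_zero (W.qE_ne_zero _) (W.pF_ne_zero t)))

/-- The index shift in `qE` disappears in the product over the whole cycle. -/
theorem prod_twist (lam : K) : ∏ t, W.twist lam t = W.parameter * lam := by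
  have h : ∏ t, W.qE (t + 1) = ∏ t, W.qE t := Equiv.prod_comp (Equiv.addRight 1) W.qE
  simp only [twist, parameter, Finset.prod_mul_distrib, Finset.prod_div_distrib, prod_wt, h]
  have h1 := Finset.prod_ne_zero_iff.2 fun t (_ : t ∈ (Finset.univ : Finset (Fin (W.m + 1)))) => W.qE_ne_zero t
  have h2 := Finset.prod_ne_zero_iff.2 fun t (_ : t ∈ (Finset.univ : Finset (Fin (W.m + 1)))) => W.pF_ne_zero t
  field_simp

/-- The same condition one step later, at the vertices `f`; solving it gives `twist`. -/
theorem secondDiff_compat {lam : K} (hlam : lam ≠ 0) (t : Fin (W.m + 1)) :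
    W.pE (W.cycle.swap.σ t) * 1 * S.scalar (W.cycle.swap.x (W.cycle.swap.σ t))
        (W.cycle.swap.b t ++ W.cycle.swap.B t) =
      W.coeffSnd lam (W.cycle.swap.σ t) * -W.twist lam (t - 1) *
        S.scalar (W.cycle.swap.x (W.cycle.swap.σ t))
          (W.cycle.swap.a (W.cycle.swap.σ t) ++ W.cycle.swap.A (W.cycle.swap.σ t)) := by
  obtain ⟨t, rfl⟩ := W.cycle.σ.surjective t
  have h0 : W.cycle.swap.σ (W.cycle.σ t) = t := W.cycle.σ.symm_apply_apply t
  have h1 : S.scalar (W.cycle.swap.x t) (W.cycle.swap.b (W.cycle.σ t) ++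
      W.cycle.swap.B (W.cycle.σ t)) = W.qF t := by
    simp [qF]
  have h2 : S.scalar (W.cycle.swap.x t) (W.cycle.swap.a t ++ W.cycle.swap.A t) = W.pF t := rfl
  have h3 : W.cycle.σ t = t + 1 := rfl
  have h4 := W.wt_ne_zero hlam t
  have h5 := W.qE_ne_zero (t + 1)
  have h6 := W.pF_ne_zero t
  rw [h0, h1, h2, h3, add_sub_cancel_right, coeffSnd, twist]
  field_simp

variable [Fintype V]

/-- The terms of the minimal projective resolution of a band module. -/
abbrev term (b : Bool) : Type (max u v w) :=
  S.projSub (if b then W.f else W.e)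

/-- The projective cover of the band module. -/
noncomputable def cover (lam : K) : W.term false →ₗ[S.Algᵐᵒᵖ] W.BandModule lam :=
  (W.aug lam fun _ => 1).domRestrict (S.projSub W.e)

/-- The first differential of the minimal projective resolution of the band module. -/
noncomputable def firstDiff (lam : K) : W.term true →ₗ[S.Algᵐᵒᵖ] W.term false :=
  ((W.cycle.dmap (fun _ => 1) fun t => -W.wt lam (t - 1)).domRestrict (S.projSub W.f)).codRestrict
    (S.projSub W.e) fun _ => W.cycle.dmap_mem _ _ _

theorem exact_firstDiff {lam : K} (hlam : lam ≠ 0) :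
    Function.Exact (W.firstDiff lam) (W.cover lam) := by
  have h : ∀ t, (1 : K) * 1 * W.wt lam t + -W.wt lam (t + 1 - 1) * 1 = 0 := by
    intro t
    rw [add_sub_cancel_right]
    ring
  intro u
  constructor
  · intro hu
    obtain ⟨z, hz, hzu⟩ := W.exists_dmap_eq_of_aug_eq_zero hlam (κ := fun _ => 1)
      (c := fun _ => 1) (c' := fun t => -W.wt lam (t - 1)) (fun _ => one_ne_zero)
      (fun _ => one_ne_zero) (fun t => neg_ne_zero.2 (W.wt_ne_zero hlam _)) h u.2 hu
    exact ⟨⟨z, hz⟩, Subtype.ext hzu⟩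
  · rintro ⟨z, rfl⟩
    exact W.aug_dmap h _

theorem isProjectiveCover_cover {lam : K} (hlam : lam ≠ 0) :
    (W.cover lam).IsProjectiveCover where
  projective := projective_projSub _
  surjective z := by
    obtain ⟨u, hu, rfl⟩ := W.aug_surjective hlam (κ := fun _ => 1) (fun _ => one_ne_zero) z
    exact ⟨⟨u, hu⟩, rfl⟩
  superfluous := by
    refine isSuperfluous_of_mem_arrowIdeal _ fun u hu t => ?_
    obtain ⟨z, rfl⟩ := (W.exact_firstDiff hlam u).1 hu
    exact W.cycle.dmap_mem_arrowIdeal (fun _ => 1) (fun t => -W.wt lam (t - 1)) z t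

theorem exists_eq_of_firstDiff_eq_zero {lam : K} (hlam : lam ≠ 0) {u : W.term true}
    (hu : W.firstDiff lam u = 0) : ∃ z ∈ S.projSub W.e,
      W.cycle.swap.dmap W.pE (W.coeffSnd lam) z = u :=
  W.cycle.exists_dmap_eq (fun _ => one_ne_zero) (fun _ => neg_ne_zero.2 (W.wt_ne_zero hlam _))
    W.pE_ne_zero (W.coeffSnd_ne_zero hlam) (W.firstDiff_compat hlam) u.2
    (congrArg Subtype.val hu)

theorem isSuperfluous_ker_firstDiff {lam : K} (hlam : lam ≠ 0) :
    (LinearMap.ker (W.firstDiff lam)).IsSuperfluous := by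
  refine isSuperfluous_of_mem_arrowIdeal _ fun u hu _ => ?_
  obtain ⟨z, -, hz⟩ := W.exists_eq_of_firstDiff_eq_zero hlam hu
  rw [← hz]
  exact W.cycle.swap.dmap_mem_arrowIdeal _ _ _ _

/-- The second syzygy of a band module. -/
theorem nonempty_equiv_ker_firstDiff {lam : K} (hlam : lam ≠ 0) :
    Nonempty (W.BandModule (W.parameter * lam) ≃ₗ[S.Algᵐᵒᵖ] LinearMap.ker (W.firstDiff lam)) := by
  have hv : W.parameter * lam ≠ 0 := mul_ne_zero W.parameter_ne_zero hlam
  -- Rescaling the generators by `κ` turns the factors `twist` into the weights of the band module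
  -- with parameter `v * lam`. It exists because both families have product `v * lam`.
  obtain ⟨κ, hκ, hκ'⟩ := Fin.exists_coboundary
    (fun t => W.wt (W.parameter * lam) t / W.twist lam t)
    (fun t => div_ne_zero (W.wt_ne_zero hv t) (W.twist_ne_zero hlam t))
    (by rw [Finset.prod_div_distrib, prod_wt, prod_twist, div_self hv])
  have h : ∀ t, (1 : K) * κ t * W.wt (W.parameter * lam) t +
      -W.twist lam (t + 1 - 1) * κ (t + 1) = 0 := by
    intro t
    have := W.twist_ne_zero hlam t
    rw [add_sub_cancel_right, hκ']
    field_simp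
    ring
  let f : S.projSub W.e →ₗ[S.Algᵐᵒᵖ] W.BandModule (W.parameter * lam) :=
    (W.aug _ κ).domRestrict _
  let g : S.projSub W.e →ₗ[S.Algᵐᵒᵖ] LinearMap.ker (W.firstDiff lam) :=
    (((W.cycle.swap.dmap W.pE (W.coeffSnd lam)).domRestrict (S.projSub W.e)).codRestrict
      (S.projSub W.f) fun _ => W.cycle.swap.dmap_mem _ _ _).codRestrict _ fun z =>
        Subtype.ext (W.cycle.dmap_dmap (W.firstDiff_compat hlam) _)
  -- Both maps are onto, and both kernels are the image of the third map, with coefficients `1` and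
  -- `-twist`, which belongs to the doubly swapped cycle, that is, to the original one.
  refine LinearMap.nonempty_equiv_of_ker_eq (N := LinearMap.ker (W.firstDiff lam)) (f := f) (g := g) ?_ ?_ fun z => ⟨fun hz => ?_,
    fun hz => ?_⟩
  · intro z
    obtain ⟨u, hu, rfl⟩ := W.aug_surjective hv hκ z
    exact ⟨⟨u, hu⟩, rfl⟩
  · rintro ⟨z, hz⟩
    obtain ⟨u, hu, huz⟩ := W.exists_eq_of_firstDiff_eq_zero hlam hz
    exact ⟨⟨u, hu⟩, Subtype.ext (Subtype.ext huz)⟩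
  · obtain ⟨u, hu, huz⟩ := W.exists_dmap_eq_of_aug_eq_zero hv hκ (c := fun _ => 1)
      (c' := fun t => -W.twist lam (t - 1)) (fun _ => one_ne_zero)
      (fun t => neg_ne_zero.2 (W.twist_ne_zero hlam _)) h z.2 hz
    have := W.cycle.swap.dmap_dmap (c := W.pE) (c' := W.coeffSnd lam) (k := fun _ => 1)
      (k' := fun t => -W.twist lam (t - 1)) (W.secondDiff_compat hlam) u
    rw [SocleCycle.swap_swap, huz] at this
    exact Subtype.ext (Subtype.ext this)
  · have hz' : W.cycle.swap.dmap W.pE (W.coeffSnd lam) z = 0 :=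
      congrArg (fun q : LinearMap.ker (W.firstDiff lam) =>
        ((q : W.term true) : Fin (W.m + 1) → S.Alg)) hz
    obtain ⟨u, hu, huz⟩ := W.cycle.swap.exists_dmap_eq (k := fun _ => 1)
      (k' := fun t => -W.twist lam (t - 1)) W.pE_ne_zero (W.coeffSnd_ne_zero hlam)
      (fun _ => one_ne_zero) (fun t => neg_ne_zero.2 (W.twist_ne_zero hlam _))
      (W.secondDiff_compat hlam) z.2 hz'
    rw [SocleCycle.swap_swap] at huz
    change W.aug _ κ z = 0
    rw [← huz]
    exact W.aug_dmap h u

end BandWord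

end SpecialBiserial

theorem proposition3p7 {K : Type u} [Field K] {V : Type v} [Quiver.{w} V] [Fintype V]
    (S : SpecialBiserial.Presentation K V) (W : SpecialBiserial.BandWord S)
    (lam : K) (hlam : lam ≠ 0) :
    W.parameter ≠ 0 ∧
    Nonempty (MinimalProjectiveResolution.{max u v w, u, max u v w} S.Algᵐᵒᵖ (W.BandModule lam)) ∧
    ∀ P : MinimalProjectiveResolution.{max u v w, u, y} S.Algᵐᵒᵖ (W.BandModule lam),
      Nonempty (P.syzygySucc 1 ≃ₗ[S.Algᵐᵒᵖ] W.BandModule (W.parameter * lam)) ∧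
      (∀ r : ℕ, Nonempty (P.syzygySucc (2 * r + 1) ≃ₗ[S.Algᵐᵒᵖ]
        W.BandModule (W.parameter ^ (r + 1) * lam))) ∧
      P.HasComplexity K 1 := by
  -- The band modules with non-zero parameter form a family closed under second syzygies, which
  -- multiply the parameter by `v`.
  let s : {c : K // c ≠ 0} → {c : K // c ≠ 0} := fun c =>
    ⟨W.parameter * c, mul_ne_zero W.parameter_ne_zero c.2⟩
  have hs : ∀ r, ((s^[r] ⟨lam, hlam⟩ : {c : K // c ≠ 0}) : K) = W.parameter ^ r * lam := by
    intro r
    induction r with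
    | zero => simp
    | succ r ih =>
      rw [Function.iterate_succ_apply']
      change W.parameter * ((s^[r] ⟨lam, hlam⟩ : {c : K // c ≠ 0}) : K) = _
      rw [ih, pow_succ']
      ring
  have hP := SpecialBiserial.Presentation.projective_projSub (S := S) W.f
  let φ : ∀ c : {c : K // c ≠ 0}, W.BandModule (s c) ≃ₗ[S.Algᵐᵒᵖ] LinearMap.ker (W.firstDiff c) :=
    fun c => (W.nonempty_equiv_ker_firstDiff c.2).some
  refine ⟨W.parameter_ne_zero, ?_, fun P => ?_⟩
  · exact MinimalProjectiveResolution.nonempty_of_periodic (P := W.term)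
      (M := fun c : {c : K // c ≠ 0} => W.BandModule c) (s := s) φ hP
      (fun c => W.isProjectiveCover_cover c.2) (fun c => W.exact_firstDiff c.2)
      (fun c => W.isSuperfluous_ker_firstDiff c.2) ⟨lam, hlam⟩
  · have key := MinimalProjectiveResolution.syzygy_of_periodic (P := W.term)
      (M := fun c : {c : K // c ≠ 0} => W.BandModule c) (s := s) φ hP
      (fun c => W.isProjectiveCover_cover c.2) (fun c => W.exact_firstDiff c.2)
      (fun c => W.isSuperfluous_ker_firstDiff c.2) ⟨lam, hlam⟩ P
    -- As `syzygySucc` starts with the first syzygy at index 0, index `2 * r + 1` is the syzygy of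
    -- order `2 * (r + 1)`.
    have hr : ∀ r : ℕ, Nonempty (P.syzygySucc (2 * r + 1) ≃ₗ[S.Algᵐᵒᵖ]
        W.BandModule (W.parameter ^ (r + 1) * lam)) := fun r => by
      rw [← hs]
      exact (key r).2.2
    refine ⟨?_, hr, ?_⟩
    · have := hr 0
      rwa [zero_add, pow_one] at this
    · have := S.finite_algOp
      have : ∀ b, Nontrivial (W.term b) := fun b =>
        SpecialBiserial.Presentation.nontrivial_projSub (by
          cases b
          · exact W.valency_e
          · exact W.valency_f)
      refine P.hasComplexity_one (P := W.term) fun n => ?_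
      rcases Nat.even_or_odd' n with ⟨r, rfl | rfl⟩
      · exact ⟨false, (key r).1⟩
      · exact ⟨true, (key r).2.1⟩
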